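/- Let $\Gamma$ be a finite connected graph, possibly with loops and multiple edges, with $E\ge 1$ edges and no vertex of degree two (a loop counts twice in the degree of its vertex). Replace each edge $e$ by two directed edges $e,\hat e$ of opposite orientation, and let $S$ be the $2E\times 2E$ matrix indexed by directed edges with $S_{j,i}=\frac{2}{\deg v}-\delta_{i,\hat j}$ if $i$ ends at the vertex $v$ from which $j$ starts, and $S_{j,i}=0$ otherwise. For $\kappa\in\mathbb T^E:=\mathbb R^E/2\pi\mathbb Z^E$ let $U_\kappa:=\operatorname{diag}(e^{i\kappa_1},\dots,e^{i\kappa_E},e^{i\kappa_1},\dots,e^{i\kappa_E})\,S$, a unitary matrix. The secular manifold is $\Sigma:=\{\kappa\in\mathbb T^E:\det(1-U_\kappa)=0\}$, and its regular part is $\Sigma^{\mathrm{reg}}:=\{\kappa\in\Sigma:\nabla\det(1-U_\kappa)\neq 0\}$, an $(E-1)$-dimensional Riemannian submanifold of the flat torus, with volume measure $ds$ and unit normal field $\hat n$ chosen to have non-negative entries. For $\ell\in\mathbb R_{\ge 0}^E\setminus\{0\}$ with $L:=\sum_e\ell_e$, the Barra–Gaspard measure $\mu_\ell$ on $\Sigma$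 is defined by $\mu_\ell(\Sigma\setminus\Sigma^{\mathrm{reg}})=0$ and $d\mu_\ell=\frac{\pi}{L}\frac{1}{(2\pi)^E}(\hat n\cdot\ell)\,ds$ on $\Sigma^{\mathrm{reg}}$. Let $\ell\in\mathbb R_{\ge 0}^E\setminus\{0\}$ and $\boldsymbol L:=\operatorname{diag}(\ell,\ell)$. At every $\kappa\in\mathbb T^E$ let $\theta_n(\kappa)\in\mathbb R/2\pi\mathbb Z$ and $a_n(\kappa)\in\mathbb C^{2E}$, $n=1,\dots,2E$, be the eigenphases and a corresponding orthonormal basis of eigenvectors of $U_\kappa$, so $U_\kappa a_n=e^{i\theta_n}a_n$ (the numbering and the choice of basis are arbitrary at each $\kappa$). Write $\kappa-\theta$ for $(\kappa_1-\theta,\dots,\kappa_E-\theta)$; then $\kappa-\theta_n(\kappa)\in\Sigma$ for all $n$. For every measurable $h:\Sigma\to\mathbb C$, the function $$\kappa\mapsto\sum_{n=1}^{2E}h\big(\kappa-\theta_n(\kappa)\big)\frac{a_n(\kappa)^*\boldsymbol L\,a_n(\kappa)}{\operatorname{tr}\boldsymbol L}$$ is measurable on $\mathbb T^E$, and if $h$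 is $\mu_\ell$-integrable, then it is integrable and $$\int_\Sigma h\,d\mu_\ell=\int_{\mathbb T^E}\sum_{n=1}^{2E}h\big(\kappa-\theta_n(\kappa)\big)\frac{a_n(\kappa)^*\boldsymbol L\,a_n(\kappa)}{\operatorname{tr}\boldsymbol L}\,\frac{d\kappa}{(2\pi)^E}.$$ The same measurability and the same identity hold, with values in $[0,\infty]$, for every measurable $h:\Sigma\to[0,\infty]$. -/

import Mathlib

open MeasureTheory Matrix
open scoped Real ENNReal

noncomputable section

/-- The period `2π` is positive; this gives `ℝ / 2πℤ` its Lebesgue measure of total mass `2π`. -/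
instance factTwoPiPos : Fact (0 < 2 * π) := ⟨Real.two_pi_pos⟩

/-- The flat torus `𝕋^E = ℝ^E / 2πℤ^E`. Its `volume` is the product Lebesgue measure, of total
mass `(2π)^E`. -/
abbrev Torus (E : Type*) : Type _ := E → AddCircle (2 * π)

namespace Torus

variable {E : Type*}

/-- The covering map `ℝ^E → 𝕋^E`. -/
def mk (x : EuclideanSpace ℝ E) : Torus E := fun e => (x e : AddCircle (2 * π))

/-- The diagonal action `κ - t`: subtract the phase `t` from every coordinate. -/
def subDiag (κ : Torus E) (t : AddCircle (2 * π)) : Torus E := fun e => κ e - t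

variable [Fintype E]

/-- `φ` restricted to the open set `O ⊆ ℝ^d` is a local parametrization of the `d`-dimensional
submanifold `M` of the torus. It is written in flat coordinates, i.e. `φ` takes values in `ℝ^E`
and parametrizes `M` through the covering map. -/
structure IsLocalParam (d : ℕ) (M : Set (Torus E)) (O : Set (EuclideanSpace ℝ (Fin d)))
    (φ : EuclideanSpace ℝ (Fin d) → EuclideanSpace ℝ E) : Prop where
  isOpen : IsOpen O
  contDiffOn : ContDiffOn ℝ 1 φ O
  immersion : ∀ x ∈ O, Function.Injective (fderiv ℝ φ x)
  mapsTo : ∀ x ∈ O, mk (φ x) ∈ M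
  injOn : Set.InjOn (fun x => mk (φ x)) O

/-- The density `√(det g)` of the Riemannian volume in the local coordinates given by `φ`, where
`g i j = ⟪∂ᵢφ, ∂ⱼφ⟫` is the metric induced by the flat metric. -/
def gramDensity {d : ℕ} (φ : EuclideanSpace ℝ (Fin d) → EuclideanSpace ℝ E)
    (x : EuclideanSpace ℝ (Fin d)) : ℝ :=
  √(gram ℝ fun i : Fin d => fderiv ℝ φ x (EuclideanSpace.single i 1)).det

/-- The Riemannian volume measure of the `d`-dimensional submanifold `M` of the flat torus, as a
measure on the torus. On the image of a local parametrization `φ` it is the push-forward of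
`√(det g) dx`; these measures agree on overlaps, and the supremum (in the lattice of measures) over
all local parametrizations glues them. -/
def riemannianVolume (d : ℕ) (M : Set (Torus E)) : Measure (Torus E) :=
  sSup {ν | ∃ (O : Set (EuclideanSpace ℝ (Fin d)))
      (φ : EuclideanSpace ℝ (Fin d) → EuclideanSpace ℝ E), IsLocalParam d M O φ ∧
      ν = Measure.map (fun x => mk (φ x))
        ((volume.restrict O).withDensity fun x => ENNReal.ofReal (gramDensity φ x))}

end Torus

/-- A graph with vertices `V` and edges `E`, possibly with loops and multiple edges. The graph is
undirected; `tail e` and `head e` are the endpoints of `e`, in an arbitrary reference order, which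
is only used to number the two directed versions of `e`. -/
structure QGraph (V E : Type*) where
  tail : E → V
  head : E → V

namespace QGraph

variable {V E : Type*} (G : QGraph V E)

/-- The underlying simple graph (loops and multiplicities forgotten), used for connectedness. -/
def toSimpleGraph : SimpleGraph V := SimpleGraph.fromRel fun u v => ∃ e, G.tail e = u ∧ G.head e = v

/-- The vertex at which a directed edge starts; `inl e` is `e` in its reference direction and
`inr e` is its reversal. -/
def origin : E ⊕ E → V := Sum.elim G.tail G.head

/-- The vertex at which a directed edge ends. -/
def terminus : E ⊕ E → V := Sum.elim G.head G.tail

variable [DecidableEq V] [Fintype E] [DecidableEq E]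

/-- The degree of a vertex: the number of directed edges leaving it, so that loops count twice. -/
def deg (v : V) : ℕ := (Finset.univ.filter fun b : E ⊕ E => G.origin b = v).card

/-- Standing assumptions: the (finite) graph is connected, has at least one edge and has no vertex
of degree two. -/
structure IsAdmissible : Prop where
  connected : G.toSimpleGraph.Connected
  nonempty_edges : Nonempty E
  deg_ne_two : ∀ v, G.deg v ≠ 2

/-- The bond scattering matrix `S`; the reversal of a directed edge `j` is `j.swap`. -/
def scattering : Matrix (E ⊕ E) (E ⊕ E) ℝ := fun j i =>
  if G.terminus i = G.origin j then
    if i = j.swap then 2 / (G.deg (G.origin j) : ℝ) - 1 else 2 / (G.deg (G.origin j) : ℝ)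
  else 0

/-- The unitary evolution matrix `U_κ = e^{i κ̂} S`. -/
def evolution (κ : Torus E) : Matrix (E ⊕ E) (E ⊕ E) ℂ :=
  diagonal (Sum.elim (fun e => ((κ e).toCircle : ℂ)) fun e => ((κ e).toCircle : ℂ)) *
    G.scattering.map Complex.ofReal

/-- The secular function `det (1 - U_κ)`. -/
def secular (κ : Torus E) : ℂ := (1 - G.evolution κ).det

/-- The secular manifold `Σ`. -/
def secularManifold : Set (Torus E) := {κ | G.secular κ = 0}

/-- The regular part of `Σ`, where the gradient of the secular function does not vanish. -/
def regularPart : Set (Torus E) :=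
  {κ | κ ∈ G.secularManifold ∧
    ∃ x, Torus.mk x = κ ∧ fderiv ℝ (fun y => G.secular (Torus.mk y)) x ≠ 0}

/-- `n` is a unit normal vector with non-negative entries to the regular part of `Σ` at `κ`. -/
structure IsPositiveNormal (κ : Torus E) (n : EuclideanSpace ℝ E) : Prop where
  norm_eq_one : ‖n‖ = 1
  nonneg : ∀ e, 0 ≤ n e
  orthogonal : ∀ x, Torus.mk x = κ →
    ∀ v ∈ tangentConeAt ℝ (Torus.mk ⁻¹' G.regularPart) x, inner ℝ n v = 0

open Classical in
/-- The normal vector field of the regular part of `Σ` with non-negative entries (with value `0`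
where there is no such normal vector). -/
def normal (κ : Torus E) : EuclideanSpace ℝ E :=
  if h : κ ∈ G.regularPart ∧ ∃ n, G.IsPositiveNormal κ n then h.2.choose else 0

/-- The Barra–Gaspard measure `μ_ℓ` on `Σ`: it is carried by the regular part, where
`dμ_ℓ = (π / L) (2π)^{-E} (n̂ · ℓ) ds`. -/
def bgMeasure (ℓ : E → ℝ) : Measure G.secularManifold :=
  Measure.comap Subtype.val
    (ENNReal.ofReal (π / (∑ e, ℓ e) * (1 / (2 * π) ^ Fintype.card E)) •
      (Torus.riemannianVolume (Fintype.card E - 1) G.regularPart).withDensity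
        fun κ => ENNReal.ofReal (∑ e, G.normal κ e * ℓ e))

/-- The diagonal matrix `diag(ℓ, ℓ)`. -/
def lengthMatrix (ℓ : E → ℝ) : Matrix (E ⊕ E) (E ⊕ E) ℂ :=
  diagonal (Sum.elim (fun e => (ℓ e : ℂ)) fun e => (ℓ e : ℂ))

/-- The weight `a^* L a / tr L` of a vector `a`, with `L = diag(ℓ, ℓ)`; for `ℓ ≥ 0` it is a
non-negative real number. -/
def weight (ℓ : E → ℝ) (a : EuclideanSpace ℂ (E ⊕ E)) : ℂ :=
  (star a.ofLp ⬝ᵥ (lengthMatrix ℓ *ᵥ a.ofLp)) / (lengthMatrix ℓ).trace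

/-- `θ n` and `a n`, `1 ≤ n ≤ 2E`, are the eigenphases and orthonormal eigenvectors of `U_κ`. -/
def IsEigensystem (κ : Torus E) (θ : Fin (2 * Fintype.card E) → AddCircle (2 * π))
    (a : OrthonormalBasis (Fin (2 * Fintype.card E)) ℂ (EuclideanSpace ℂ (E ⊕ E))) : Prop :=
  ∀ n, G.evolution κ *ᵥ (a n).ofLp = ((θ n).toCircle : ℂ) • (a n).ofLp

variable {G}

/-- If `θ n` is an eigenphase of `U_κ`, then `κ - θ n` lies on `Σ`. -/
theorem IsEigensystem.subDiag_mem {κ : Torus E}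
    {θ : Fin (2 * Fintype.card E) → AddCircle (2 * π)}
    {a : OrthonormalBasis (Fin (2 * Fintype.card E)) ℂ (EuclideanSpace ℂ (E ⊕ E))}
    (h : G.IsEigensystem κ θ a) (n : Fin (2 * Fintype.card E)) :
    κ.subDiag (θ n) ∈ G.secularManifold := by
  have hU : G.evolution (κ.subDiag (θ n)) = ((θ n).toCircle : ℂ)⁻¹ • G.evolution κ := by
    ext i j
    rcases i with i | i <;>
      simp [evolution, Torus.subDiag, sub_eq_add_neg, AddCircle.toCircle_add,
        AddCircle.toCircle_neg] <;> ring
  have hne : (a n).ofLp ≠ 0 := by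
    intro h0
    exact (a.orthonormal.ne_zero n) (by ext i; simpa using congrFun h0 i)
  refine Matrix.exists_mulVec_eq_zero_iff.mp ⟨(a n).ofLp, hne, ?_⟩
  rw [Matrix.sub_mulVec, hU, Matrix.smul_mulVec, h n, smul_smul, inv_mul_cancel₀ (by simp)]
  simp

/-- The point `κ - θ n` of `Σ`. -/
def phasePoint {κ : Torus E} {θ : Fin (2 * Fintype.card E) → AddCircle (2 * π)}
    {a : OrthonormalBasis (Fin (2 * Fintype.card E)) ℂ (EuclideanSpace ℂ (E ⊕ E))}
    (h : G.IsEigensystem κ θ a) (n : Fin (2 * Fintype.card E)) : G.secularManifold :=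
  ⟨κ.subDiag (θ n), h.subDiag_mem n⟩

end QGraph

end

set_option linter.unusedSectionVars false

/-! The proof reads the torus through the diagonal flow. Subtracting a phase `t` from every
coordinate multiplies `U_κ` by `e^{-it}`, so `κ - t` lies on `Σ` exactly when `t` is an eigenphase
of `U_κ`. For weights `q ≥ 0` on the edges, put at each `κ` the spectral measure with an atom of
mass `∑_e q_e (|a_e|² + |a_ê|²)` at each eigenphase, integrate over the torus and push forward by
`(κ, t) ↦ κ - t`. The right-hand side of the theorem is an integral against this flux (`phaseFlux`)
for `q = ℓ / (2L)`, divided by `(2π)^E`. It remains to identify the flux with the Barra–Gaspard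
measure.

Geometry. At a regular point the eigenphase `0` is simple, and the gradient of the secular function
is a complex multiple of the vector `s` of edge masses of its eigenvector (`exists_gradCLM_eq`).
Hence `n̂ = s / ‖s‖` (`normal_eq`). Since `∑_e s_e = 1`, the flow direction `(1, …, 1)` has normal
component `1 / ‖s‖`. A chart of the regular part, moved along the flow for time `2π`, therefore has
Jacobian `√(det g) / ‖s‖`, and it covers `κ` once for every eigenphase whose point lies in the
chart. The area formula (`lintegral_gramDensity_eq`) gives `ds = (‖s‖ / 2π) dσ`, with `σ` the flux
for `q = 1`. As the flux for `q` has density `q · s` with respect to `σ`, the factors `‖s‖` cancel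
in `(n̂ · ℓ) ds`.

Null sets. The flux must not charge the singular part, that is, almost every `U_κ` must have simple
spectrum (`ae_injective_phases`). The discriminant is real-analytic, so one point with simple
spectrum suffices. Where the number of distinct eigenphases is maximal no eigenphase splits, and
first-order perturbation compresses every edge projection to a scalar on each eigenspace. Time
reversal and an isotropic vector then produce, in a multiple eigenspace, a wave travelling one way
along every edge. Its vertex phases express the `κ_e` as coboundary plus constant. All degrees are
then at least three, so `|V| < |E|` and the `κ_e` satisfy a nontrivial integer relation, which fails
generically.

Measurability. The `θ_n`, `a_n` are arbitrary at each `κ`, but the Fourier coefficients of the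
spectral measures are traces of `U_κ^k P_e` or their conjugates, hence continuous. So the spectral
measures form a kernel (`measurable_phaseMeasure`). -/

noncomputable section

/-! ### Determinants, adjugates and traces in an eigenbasis of `U_κ` -/

/-- Adjugate of a unitarily diagonalized matrix of the form `1 - A D Aᴴ`. -/
theorem adjugate_one_sub_conj_diagonal {m n : Type*} [Fintype m] [DecidableEq m] [Fintype n]
    [DecidableEq n] (e : n ≃ m) (A : Matrix m n ℂ) (h₁ : Aᴴ * A = 1) (h₂ : A * Aᴴ = 1)
    (μ : n → ℂ) :
    (1 - A * diagonal μ * Aᴴ).adjugate =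
      A * diagonal (fun i => ∏ j ∈ Finset.univ.erase i, (1 - μ j)) * Aᴴ := by
  -- Eigenvectors and directed edges are indexed by different types, while multiplicativity of the
  -- adjugate needs a single one. The square case is proved first and transported along `e`.
  have key : ∀ B : Matrix n n ℂ, Bᴴ * B = 1 → B * Bᴴ = 1 →
      (1 - B * diagonal μ * Bᴴ).adjugate =
      B * diagonal (fun i => ∏ j ∈ Finset.univ.erase i, (1 - μ j)) * Bᴴ := by
    intro B h₁ h₂
    have hB : 1 - B * diagonal μ * Bᴴ = B * diagonal (fun i => 1 - μ i) * Bᴴ := by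
      have : diagonal (fun i => 1 - μ i) = 1 - diagonal μ := by
        rw [← diagonal_one, diagonal_sub]
      rw [this, Matrix.mul_sub, Matrix.sub_mul, Matrix.mul_one, h₂]
    have hdet : B.det * (Bᴴ).det = 1 := by rw [← det_mul, h₂, det_one]
    have a1 : B.adjugate = B.det • Bᴴ := by
      calc B.adjugate = B.adjugate * (B * Bᴴ) := by rw [h₂, Matrix.mul_one]
        _ = _ := by rw [← Matrix.mul_assoc, adjugate_mul, Matrix.smul_mul, Matrix.one_mul]
    have a2 : (Bᴴ).adjugate = (Bᴴ).det • B := by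
      calc (Bᴴ).adjugate = (Bᴴ).adjugate * (Bᴴ * B) := by rw [h₁, Matrix.mul_one]
        _ = _ := by rw [← Matrix.mul_assoc, adjugate_mul, Matrix.smul_mul, Matrix.one_mul]
    rw [hB, adjugate_mul_distrib, adjugate_mul_distrib, adjugate_diagonal, a1, a2]
    simp only [Matrix.smul_mul, Matrix.mul_smul, smul_smul]
    rw [hdet, one_smul, Matrix.mul_assoc]
  have hk := key (A.submatrix e id)
    (by rw [conjTranspose_submatrix, submatrix_mul_equiv, h₁, submatrix_id_id])
    (by rw [conjTranspose_submatrix, ← submatrix_mul _ _ e id e Function.bijective_id, h₂,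
      submatrix_one_equiv])
  have e1 : ∀ D : n → ℂ, A.submatrix e id * diagonal D * (A.submatrix e id)ᴴ =
      (A * diagonal D * Aᴴ).submatrix e e := by
    intro D
    ext i j
    simp [Matrix.mul_apply]
  rw [e1, e1] at hk
  have e2 : (1 - (A * diagonal μ * Aᴴ).submatrix e e) = (1 - A * diagonal μ * Aᴴ).submatrix e e := by
    rw [submatrix_sub, Pi.sub_apply, Pi.sub_apply, submatrix_one_equiv]
  rw [e2, adjugate_submatrix_equiv_self] at hk
  have := congrArg (fun M => M.submatrix e.symm e.symm) hk
  simpa using this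

namespace QGraph

variable {V E : Type*} {G : QGraph V E} [DecidableEq V] [Fintype E] [DecidableEq E]

/-- The mass `|a_e|² + |a_ê|²` which the vector `a` puts on the edge `e`. -/
def edgeMass (a : EuclideanSpace ℂ (E ⊕ E)) (e : E) : ℝ := ‖a (.inl e)‖ ^ 2 + ‖a (.inr e)‖ ^ 2

/-- The orthogonal projection onto the two directions of the edge `e`. -/
def edgeProj (e : E) : Matrix (E ⊕ E) (E ⊕ E) ℂ :=
  diagonal (Sum.elim (Pi.single e 1) (Pi.single e 1))

theorem edgeMass_nonneg (a : EuclideanSpace ℂ (E ⊕ E)) (e : E) : 0 ≤ edgeMass a e := by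
  unfold edgeMass; positivity

theorem sum_edgeMass (a : EuclideanSpace ℂ (E ⊕ E)) : ∑ e, edgeMass a e = ‖a‖ ^ 2 := by
  simp only [edgeMass, EuclideanSpace.norm_sq_eq, Fintype.sum_sum_type, Finset.sum_add_distrib]

theorem star_dotProduct_edgeProj (a : EuclideanSpace ℂ (E ⊕ E)) (e : E) :
    star a.ofLp ⬝ᵥ (edgeProj e *ᵥ a.ofLp) = (edgeMass a e : ℂ) := by
  simp only [edgeProj, mulVec_diagonal, dotProduct, Fintype.sum_sum_type, Sum.elim_inl,
    Sum.elim_inr, Pi.single_apply, edgeMass, Pi.star_apply]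
  simp [← Complex.conj_mul']

theorem lengthMatrix_eq_sum (ℓ : E → ℝ) :
    lengthMatrix ℓ = ∑ e, (ℓ e : ℂ) • edgeProj e := by
  ext i j
  rw [Matrix.sum_apply]
  rcases i with i | i <;> by_cases hij : i = j.elim id id <;> rcases j with j | j <;>
    simp_all [lengthMatrix, edgeProj, Pi.single_apply]

/-- The trace of `diag(ℓ, ℓ)` is `2 ∑ ℓ_e`. The constructions below work for any nonnegative edge
coefficients `q`; this identifies the choice of `q` that the theorem needs, while `q = 1` gives
every eigenvector weight one. -/
theorem weight_eq (ℓ : E → ℝ) (a : EuclideanSpace ℂ (E ⊕ E)) :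
    weight ℓ a = ((∑ e, ℓ e / (2 * ∑ e, ℓ e) * edgeMass a e : ℝ) : ℂ) := by
  have h1 : star a.ofLp ⬝ᵥ (lengthMatrix ℓ *ᵥ a.ofLp) = ∑ e, (ℓ e : ℂ) * edgeMass a e := by
    rw [lengthMatrix_eq_sum, Matrix.sum_mulVec, dotProduct_sum]
    refine Finset.sum_congr rfl fun e _ => ?_
    rw [Matrix.smul_mulVec, dotProduct_smul, star_dotProduct_edgeProj, smul_eq_mul]
  have h2 : (lengthMatrix ℓ).trace = 2 * ∑ e, (ℓ e : ℂ) := by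
    simp [lengthMatrix, trace_diagonal, Fintype.sum_sum_type, two_mul]
  rw [weight, h1, h2]
  push_cast
  rw [Finset.sum_div]
  exact Finset.sum_congr rfl fun e _ => by ring

theorem evolution_subDiag (κ : Torus E) (t : AddCircle (2 * π)) :
    G.evolution (κ.subDiag t) = (t.toCircle : ℂ)⁻¹ • G.evolution κ := by
  ext i j
  rcases i with i | i <;>
    simp [evolution, Torus.subDiag, sub_eq_add_neg, AddCircle.toCircle_add,
      AddCircle.toCircle_neg] <;> ring

theorem continuous_evolution : Continuous G.evolution := by
  have hc : Continuous fun x : AddCircle (2 * π) => (x.toCircle : ℂ) :=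
    continuous_subtype_val.comp AddCircle.continuous_toCircle
  unfold evolution
  refine Continuous.matrix_mul (Continuous.matrix_diagonal (continuous_pi fun j => ?_))
    continuous_const
  rcases j with j | j
  · exact hc.comp (continuous_apply j)
  · exact hc.comp (continuous_apply j)

theorem continuous_secular : Continuous G.secular :=
  (continuous_const.sub continuous_evolution).matrix_det

variable (G) in
/-- The coefficients of the gradient of the secular function, up to the factor `-i`. -/
def gradCoeff (κ : Torus E) (e : E) : ℂ :=
  ((1 - G.evolution κ).adjugate * (edgeProj e * G.evolution κ)).trace

theorem continuous_gradCoeff (e : E) : Continuous fun κ => G.gradCoeff κ e :=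
  ((continuous_const.sub continuous_evolution).matrix_adjugate.matrix_mul
    (continuous_const.matrix_mul continuous_evolution)).matrix_trace

namespace IsEigensystem

variable {κ : Torus E} {θ : Fin (2 * Fintype.card E) → AddCircle (2 * π)}
    {a : OrthonormalBasis (Fin (2 * Fintype.card E)) ℂ (EuclideanSpace ℂ (E ⊕ E))}

theorem conjTranspose_mul_self
    (a : OrthonormalBasis (Fin (2 * Fintype.card E)) ℂ (EuclideanSpace ℂ (E ⊕ E))) :
    (of fun j n => a n j)ᴴ * (of fun j n => a n j) = 1 := by
  ext n m
  have := orthonormal_iff_ite.mp a.orthonormal n m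
  rw [EuclideanSpace.inner_eq_star_dotProduct, dotProduct_comm] at this
  simpa [Matrix.mul_apply, dotProduct, one_apply] using this

theorem mul_conjTranspose_self
    (a : OrthonormalBasis (Fin (2 * Fintype.card E)) ℂ (EuclideanSpace ℂ (E ⊕ E))) :
    (of fun j n => a n j) * (of fun j n => a n j)ᴴ = 1 := by
  rw [Matrix.mul_eq_one_comm_of_equiv (Fintype.equivOfCardEq (by simp [two_mul]))]
  exact conjTranspose_mul_self a

theorem evolution_eq (h : G.IsEigensystem κ θ a) :
    G.evolution κ = (of fun j n => a n j) * diagonal (fun n => ((θ n).toCircle : ℂ)) *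
      (of fun j n => a n j)ᴴ := by
  have hU : G.evolution κ * (of fun j n => a n j) =
      (of fun j n => a n j) * diagonal (fun n => ((θ n).toCircle : ℂ)) := by
    ext j n
    have := congrFun (h n) j
    rw [mul_diagonal]
    simpa [Matrix.mul_apply, mulVec, dotProduct, mul_comm] using this
  rw [← hU, Matrix.mul_assoc, mul_conjTranspose_self, Matrix.mul_one]

theorem subDiag (h : G.IsEigensystem κ θ a) (t : AddCircle (2 * π)) :
    G.IsEigensystem (κ.subDiag t) (fun n => θ n - t) a := by
  intro n
  have ht : ((θ n - t).toCircle : ℂ) = (t.toCircle : ℂ)⁻¹ * (θ n).toCircle := by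
    rw [sub_eq_add_neg, AddCircle.toCircle_add, AddCircle.toCircle_neg, mul_comm]
    simp
  rw [evolution_subDiag, Matrix.smul_mulVec, h n, smul_smul, ht]

theorem det_sub (h : G.IsEigensystem κ θ a) (z : ℂ) :
    (z • (1 : Matrix (E ⊕ E) (E ⊕ E) ℂ) - G.evolution κ).det =
      ∏ n, (z - ((θ n).toCircle : ℂ)) := by
  have h2 : z • (1 : Matrix (E ⊕ E) (E ⊕ E) ℂ) - G.evolution κ =
      (of fun j n => a n j) * diagonal (fun n => z - ((θ n).toCircle : ℂ)) *
        (of fun j n => a n j)ᴴ := by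
    have : diagonal (fun n => z - ((θ n).toCircle : ℂ)) =
        z • (1 : Matrix _ _ ℂ) - diagonal fun n => ((θ n).toCircle : ℂ) := by
      rw [← diagonal_one, ← diagonal_smul, diagonal_sub]
      simp
    rw [this, Matrix.mul_sub, Matrix.sub_mul, ← h.evolution_eq, Matrix.mul_smul, Matrix.smul_mul,
      Matrix.mul_one, mul_conjTranspose_self]
  rw [h2, det_conj_of_mul_eq_one (mul_conjTranspose_self a) (conjTranspose_mul_self a),
    det_diagonal]

theorem secular_eq (h : G.IsEigensystem κ θ a) :
    G.secular κ = ∏ n, (1 - ((θ n).toCircle : ℂ)) := by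
  simpa [secular] using h.det_sub 1

theorem det_evolution (h : G.IsEigensystem κ θ a) :
    (G.evolution κ).det = ∏ n, ((θ n).toCircle : ℂ) := by
  rw [h.evolution_eq, det_conj_of_mul_eq_one (mul_conjTranspose_self a) (conjTranspose_mul_self a),
    det_diagonal]

theorem conjTranspose_mul_edgeProj_mul
    (a : OrthonormalBasis (Fin (2 * Fintype.card E)) ℂ (EuclideanSpace ℂ (E ⊕ E))) (e : E)
    (n : Fin (2 * Fintype.card E)) :
    ((of fun j n => a n j)ᴴ * edgeProj e * (of fun j n => a n j)) n n = (edgeMass (a n) e : ℂ) := by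
  rw [← star_dotProduct_edgeProj, Matrix.mul_assoc, Matrix.mul_apply]
  simp [dotProduct, mulVec, Matrix.mul_apply]

/-- Traces of `f(U) P_e`, where `f(U) = A D Aᴴ` in the eigenbasis. -/
theorem trace_conj_diagonal_mul_edgeProj
    (a : OrthonormalBasis (Fin (2 * Fintype.card E)) ℂ (EuclideanSpace ℂ (E ⊕ E)))
    (D : Fin (2 * Fintype.card E) → ℂ) (e : E) :
    ((of fun j n => a n j) * diagonal D * (of fun j n => a n j)ᴴ * edgeProj e).trace =
      ∑ n, D n * (edgeMass (a n) e : ℂ) := by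
  rw [Matrix.mul_assoc, Matrix.mul_assoc, trace_mul_comm, Matrix.mul_assoc, trace]
  refine Finset.sum_congr rfl fun n _ => ?_
  rw [diag_apply, diagonal_mul, conjTranspose_mul_edgeProj_mul]

theorem conj_diagonal_mul
    (a : OrthonormalBasis (Fin (2 * Fintype.card E)) ℂ (EuclideanSpace ℂ (E ⊕ E)))
    (D D' : Fin (2 * Fintype.card E) → ℂ) :
    ((of fun j n => a n j) * diagonal D * (of fun j n => a n j)ᴴ) *
      ((of fun j n => a n j) * diagonal D' * (of fun j n => a n j)ᴴ) =
      (of fun j n => a n j) * diagonal (fun n => D n * D' n) * (of fun j n => a n j)ᴴ := by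
  rw [← diagonal_mul_diagonal]
  simp only [Matrix.mul_assoc]
  rw [← Matrix.mul_assoc (of fun j n => a n j)ᴴ (of fun j n => a n j), conjTranspose_mul_self,
    Matrix.one_mul]

theorem evolution_pow (h : G.IsEigensystem κ θ a) (k : ℕ) :
    G.evolution κ ^ k = (of fun j n => a n j) * diagonal (fun n => ((θ n).toCircle : ℂ) ^ k) *
      (of fun j n => a n j)ᴴ := by
  induction k with
  | zero => simp [mul_conjTranspose_self]
  | succ k ih => rw [pow_succ, ih, h.evolution_eq, conj_diagonal_mul]; simp [pow_succ]

theorem trace_evolution_pow (h : G.IsEigensystem κ θ a) (k : ℕ) :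
    (G.evolution κ ^ k).trace = ∑ n, ((θ n).toCircle : ℂ) ^ k := by
  rw [h.evolution_pow, trace_mul_comm, ← Matrix.mul_assoc, conjTranspose_mul_self, Matrix.one_mul,
    trace_diagonal]

theorem trace_evolution_pow_mul_edgeProj (h : G.IsEigensystem κ θ a) (k : ℕ) (e : E) :
    (G.evolution κ ^ k * edgeProj e).trace =
      ∑ n, ((θ n).toCircle : ℂ) ^ k * (edgeMass (a n) e : ℂ) := by
  rw [h.evolution_pow, trace_conj_diagonal_mul_edgeProj]

theorem sum_edgeMass_eq_two
    (a : OrthonormalBasis (Fin (2 * Fintype.card E)) ℂ (EuclideanSpace ℂ (E ⊕ E))) (e : E) :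
    ∑ n, edgeMass (a n) e = 2 := by
  have := trace_conj_diagonal_mul_edgeProj a (fun _ => 1) e
  rw [diagonal_one, Matrix.mul_one, mul_conjTranspose_self, Matrix.one_mul] at this
  have h2 : (edgeProj e : Matrix (E ⊕ E) (E ⊕ E) ℂ).trace = 2 := by
    simp [edgeProj, trace_diagonal, Fintype.sum_sum_type]; norm_num
  rw [h2] at this
  simp only [one_mul] at this
  exact_mod_cast this.symm

theorem gradCoeff_eq (h : G.IsEigensystem κ θ a) (e : E) :
    G.gradCoeff κ e = ∑ n, ((∏ m ∈ Finset.univ.erase n, (1 - ((θ m).toCircle : ℂ))) *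
      ((θ n).toCircle : ℂ)) * (edgeMass (a n) e : ℂ) := by
  rw [gradCoeff, trace_mul_comm, Matrix.mul_assoc, trace_mul_comm]
  have h1 : (1 - G.evolution κ).adjugate = (of fun j n => a n j) *
      diagonal (fun n => ∏ m ∈ Finset.univ.erase n, (1 - ((θ m).toCircle : ℂ))) *
        (of fun j n => a n j)ᴴ := by
    rw [h.evolution_eq]
    exact adjugate_one_sub_conj_diagonal (Fintype.equivOfCardEq (by simp [two_mul])) _
      (conjTranspose_mul_self a) (mul_conjTranspose_self a) _
  rw [h1, h.evolution_eq, conj_diagonal_mul, trace_conj_diagonal_mul_edgeProj]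
  simp only [mul_comm]

/-- Every summand with another index contains the factor `1 - e^{iθ_n} = 0`. If `0` is a multiple
eigenphase the surviving product vanishes as well, so simplicity is not needed for the formula. -/
theorem gradCoeff_eq_of_unique (h : G.IsEigensystem κ θ a) {n : Fin (2 * Fintype.card E)}
    (hn : θ n = 0) (e : E) :
    G.gradCoeff κ e =
      (∏ m ∈ Finset.univ.erase n, (1 - ((θ m).toCircle : ℂ))) * (edgeMass (a n) e : ℂ) := by
  rw [h.gradCoeff_eq, Finset.sum_eq_single n]
  · simp [hn]
  · intro m _ hm
    rw [Finset.prod_eq_zero (i := n) (by simp [hm.symm]) (by simp [hn])]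
    simp
  · simp

theorem star_one_sub_toCircle_mul (t : AddCircle (2 * π)) :
    starRingEnd ℂ (1 - (t.toCircle : ℂ)) * (t.toCircle : ℂ) = (-1) * (1 - (t.toCircle : ℂ)) := by
  have : ‖(t.toCircle : ℂ)‖ = 1 := Circle.norm_coe _
  rw [map_sub, map_one, sub_mul, Complex.conj_mul', this]
  push_cast
  ring

/-- Each factor satisfies `conj (1 - u) * u = -(1 - u)`, and there are evenly many factors. This
functional equation fixes the phase of the secular function up to sign, so that `Σ` is locally cut
out by one real equation. -/
theorem star_secular_mul_det (h : G.IsEigensystem κ θ a) :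
    starRingEnd ℂ (G.secular κ) * (G.evolution κ).det = G.secular κ := by
  rw [h.secular_eq, h.det_evolution, map_prod, ← Finset.prod_mul_distrib]
  simp_rw [star_one_sub_toCircle_mul, Finset.prod_mul_distrib]
  simp [pow_mul]

/-- One factor fewer than in the functional equation, hence the opposite sign. It fixes the phase of
the gradient, where the extra factor `-i` absorbs the sign. -/
theorem star_prod_erase_mul_det (h : G.IsEigensystem κ θ a) {n : Fin (2 * Fintype.card E)}
    (hn : θ n = 0) :
    starRingEnd ℂ (∏ m ∈ Finset.univ.erase n, (1 - ((θ m).toCircle : ℂ))) * (G.evolution κ).det =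
      -∏ m ∈ Finset.univ.erase n, (1 - ((θ m).toCircle : ℂ)) := by
  have h0 : ((θ n).toCircle : ℂ) = 1 := by simp [hn]
  rw [h.det_evolution, map_prod, ← Finset.mul_prod_erase _ _ (Finset.mem_univ n), h0, one_mul,
    ← Finset.prod_mul_distrib]
  simp_rw [star_one_sub_toCircle_mul, Finset.prod_mul_distrib]
  have hodd : Odd (Finset.univ.erase n).card := by
    rw [Finset.card_erase_of_mem (Finset.mem_univ n), Finset.card_univ, Fintype.card_fin]
    have := n.pos
    exact Nat.Even.sub_odd (by omega) (even_two_mul _) odd_one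
  rw [Finset.prod_const, hodd.neg_one_pow, neg_one_mul]

theorem exists_phase_eq_zero (h : G.IsEigensystem κ θ a) (hκ : κ ∈ G.secularManifold) :
    ∃ n, θ n = 0 := by
  have : G.secular κ = 0 := hκ
  rw [h.secular_eq, Finset.prod_eq_zero_iff] at this
  obtain ⟨n, -, hn⟩ := this
  refine ⟨n, AddCircle.injective_toCircle (T := 2 * π) Real.two_pi_pos.ne' ?_⟩
  rw [AddCircle.toCircle_zero]
  ext
  simpa using (sub_eq_zero.mp hn).symm

end IsEigensystem
end QGraph

/-! ### The differential of the secular function and the regular part -/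

/-- Jacobi's formula: the derivative of the determinant of a matrix-valued function. -/
theorem HasFDerivAt.matrix_det {X n : Type*} [NormedAddCommGroup X] [NormedSpace ℝ X] [Fintype n]
    [DecidableEq n] {M : X → n → n → ℂ} {M' : X →L[ℝ] n → n → ℂ} {x : X}
    (hM : HasFDerivAt M M' x) (L : X →L[ℝ] ℂ)
    (hL : ∀ v, L v = ((of (M x)).adjugate * of (M' v)).trace) :
    HasFDerivAt (fun y => (of (M y)).det) L x := by
  -- The determinant is multilinear in the rows, so its derivative sums the determinants with one
  -- row replaced; cofactor expansion of these gives the adjugate.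
  let D : ContinuousMultilinearMap ℂ (fun _ : n => n → ℂ) ℂ :=
    { (detRowAlternating (R := ℂ) (n := n)).toMultilinearMap with
      cont := by
        change Continuous fun A : n → n → ℂ => (of A).det
        exact Continuous.matrix_det continuous_id }
  have hD : ∀ A, D.restrictScalars ℝ A = (of A).det := fun A => rfl
  have h := ((D.restrictScalars ℝ).hasFDerivAt (M x)).comp x hM
  have hL' : L = ((D.restrictScalars ℝ).linearDeriv (M x)).comp M' := by
    ext v
    rw [hL, ContinuousLinearMap.comp_apply, ContinuousMultilinearMap.linearDeriv_apply, trace]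
    have : ∀ i, (D.restrictScalars ℝ) (Function.update (M x) i (M' v i)) =
        ∑ k, (of (M x)).adjugate k i * M' v i k := by
      intro i
      rw [hD]
      change ((of (M x)).updateRow i (M' v i)).det = _
      rw [← cramer_transpose_apply, cramer_eq_adjugate_mulVec, ← adjugate_transpose]
      rfl
    simp only [this, diag_apply, Matrix.mul_apply, of_apply]
    rw [Finset.sum_comm]
  rw [hL']
  exact h

namespace Torus

variable {E : Type*} [Fintype E]

theorem toCircle_mk (x : EuclideanSpace ℝ E) (e : E) :
    ((mk x e).toCircle : ℂ) = Complex.exp (x e * Complex.I) := by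
  rw [mk, AddCircle.toCircle_apply_mk, div_self Real.two_pi_pos.ne', one_mul, Circle.coe_exp]

theorem continuous_mk : Continuous (mk : EuclideanSpace ℝ E → Torus E) :=
  continuous_pi fun e => (AddCircle.continuous_mk' _).comp (by fun_prop)

end Torus

namespace QGraph

variable {V E : Type*} {G : QGraph V E} [DecidableEq V] [Fintype E] [DecidableEq E]

theorem evolution_mk_apply (x : EuclideanSpace ℝ E) (i j : E ⊕ E) :
    G.evolution (Torus.mk x) i j =
      Complex.exp (x (i.elim id id) * Complex.I) * (G.scattering i j : ℂ) := by
  rcases i with i | i <;> simp [evolution, Torus.toCircle_mk]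

theorem analyticOnNhd_evolution_mk (i j : E ⊕ E) :
    AnalyticOnNhd ℝ (fun x : EuclideanSpace ℝ E => G.evolution (Torus.mk x) i j) Set.univ := by
  intro x _
  simp only [evolution_mk_apply]
  have h1 : AnalyticAt ℝ (fun x : EuclideanSpace ℝ E => ((x (i.elim id id) : ℝ) : ℂ)) x := by
    exact (Complex.ofRealCLM.comp (EuclideanSpace.proj (𝕜 := ℝ) (i.elim id id))).analyticAt x
  exact ((analyticAt_cexp.restrictScalars (𝕜 := ℝ)).comp (h1.mul analyticAt_const)).mul
    analyticAt_const

theorem contDiff_evolution_mk (i j : E ⊕ E) :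
    ContDiff ℝ ⊤ (fun x : EuclideanSpace ℝ E => G.evolution (Torus.mk x) i j) := by
  rw [← contDiffOn_univ]
  exact (analyticOnNhd_evolution_mk i j).contDiffOn uniqueDiffOn_univ

theorem contDiff_secular_mk : ContDiff ℝ ⊤ (fun x : EuclideanSpace ℝ E => G.secular (Torus.mk x)) := by
  simp only [secular, det_apply]
  refine ContDiff.sum fun σ _ => ContDiff.const_smul _ (contDiff_prod fun i _ => ?_)
  exact contDiff_const.sub (contDiff_evolution_mk _ _)

theorem gradCoeff_sum_trace (κ : Torus E) (v : E → ℂ) :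
    ((1 - G.evolution κ).adjugate * (diagonal (Sum.elim v v) * G.evolution κ)).trace =
      ∑ e, v e * G.gradCoeff κ e := by
  have : diagonal (Sum.elim v v) = ∑ e, v e • edgeProj e := by
    ext i j
    rw [Matrix.sum_apply]
    rcases i with i | i <;> by_cases hij : i = j.elim id id <;> rcases j with j | j <;>
      simp_all [edgeProj, Pi.single_apply]
  rw [this, Matrix.sum_mul, Matrix.mul_sum, trace_sum]
  refine Finset.sum_congr rfl fun e _ => ?_
  rw [gradCoeff, Matrix.smul_mul, Matrix.mul_smul, trace_smul, smul_eq_mul]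

variable (G) in
/-- The differential of the secular function at a point of the torus. -/
def gradCLM (κ : Torus E) : EuclideanSpace ℝ E →L[ℝ] ℂ :=
  ∑ e, (EuclideanSpace.proj (𝕜 := ℝ) e).smulRight (-Complex.I * G.gradCoeff κ e)

theorem gradCLM_apply (κ : Torus E) (v : EuclideanSpace ℝ E) :
    G.gradCLM κ v = -Complex.I * ∑ e, (v e : ℂ) * G.gradCoeff κ e := by
  simp only [gradCLM, _root_.sum_apply, ContinuousLinearMap.smulRight_apply,
    PiLp.proj_apply, Complex.real_smul, Finset.mul_sum]
  exact Finset.sum_congr rfl fun e _ => by ring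

theorem hasFDerivAt_secular_mk (x : EuclideanSpace ℝ E) :
    HasFDerivAt (fun y => G.secular (Torus.mk y)) (G.gradCLM (Torus.mk x)) x := by
  let M : EuclideanSpace ℝ E → (E ⊕ E) → (E ⊕ E) → ℂ := fun y i j =>
    (1 - G.evolution (Torus.mk y)) i j
  let M' : EuclideanSpace ℝ E →L[ℝ] (E ⊕ E) → (E ⊕ E) → ℂ :=
    ContinuousLinearMap.pi fun i => ContinuousLinearMap.pi fun j =>
      (EuclideanSpace.proj (𝕜 := ℝ) (i.elim id id : E)).smulRight
        (-Complex.I * G.evolution (Torus.mk x) i j)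
  have hM : HasFDerivAt M M' x := by
    rw [hasFDerivAt_pi']
    intro i
    rw [hasFDerivAt_pi']
    intro j
    have h1 : HasFDerivAt (fun x : EuclideanSpace ℝ E => ((x (i.elim id id) : ℝ) : ℂ))
        (Complex.ofRealCLM.comp (EuclideanSpace.proj (𝕜 := ℝ) (i.elim id id : E))) x :=
      (Complex.ofRealCLM.comp (EuclideanSpace.proj (𝕜 := ℝ) (i.elim id id : E))).hasFDerivAt
    have h2 := (((h1.mul_const Complex.I).cexp).mul_const (G.scattering i j : ℂ)).const_sub
      ((1 : Matrix (E ⊕ E) (E ⊕ E) ℂ) i j)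
    refine (h2.congr_fderiv ?_).congr_of_eventuallyEq (Filter.Eventually.of_forall fun y => ?_)
    · ext v
      simp [M', evolution_mk_apply]
      ring
    · simp only [M, Matrix.sub_apply, evolution_mk_apply]
  have hM2 : ∀ y, of (M y) = 1 - G.evolution (Torus.mk y) := fun y => rfl
  have hdet : (fun y => G.secular (Torus.mk y)) = fun y => (of (M y)).det := rfl
  rw [hdet]
  refine hM.matrix_det _ fun v => ?_
  have h3 : of (M' v) = (-Complex.I) •
      (diagonal (Sum.elim (fun e => (v e : ℂ)) fun e => (v e : ℂ)) * G.evolution (Torus.mk x)) := by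
    ext i j
    rcases i with i | i <;> simp [M'] <;> ring
  rw [h3, Matrix.mul_smul, trace_smul, gradCLM_apply, smul_eq_mul, ← gradCoeff_sum_trace, hM2]

theorem fderiv_secular_mk (x : EuclideanSpace ℝ E) :
    fderiv ℝ (fun y => G.secular (Torus.mk y)) x = G.gradCLM (Torus.mk x) :=
  (hasFDerivAt_secular_mk x).fderiv

theorem exists_mk_eq (κ : Torus E) : ∃ x : EuclideanSpace ℝ E, Torus.mk x = κ := by
  choose f hf using fun e => QuotientAddGroup.mk_surjective (κ e)
  exact ⟨WithLp.toLp 2 f, funext hf⟩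

theorem gradCLM_eq_zero_iff (κ : Torus E) : G.gradCLM κ = 0 ↔ ∀ e, G.gradCoeff κ e = 0 := by
  constructor
  · intro h e
    have := congrArg (fun L => L (EuclideanSpace.single e 1)) h
    simpa [gradCLM_apply, Pi.single_apply, apply_ite] using this
  · intro h
    ext v
    simp [gradCLM_apply, h]

theorem mem_regularPart_iff (κ : Torus E) :
    κ ∈ G.regularPart ↔ G.secular κ = 0 ∧ ∃ e, G.gradCoeff κ e ≠ 0 := by
  constructor
  · rintro ⟨h1, x, rfl, hx⟩
    refine ⟨h1, ?_⟩
    rw [fderiv_secular_mk, Ne, gradCLM_eq_zero_iff] at hx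
    push Not at hx
    exact hx
  · rintro ⟨h1, h2⟩
    obtain ⟨x, rfl⟩ := exists_mk_eq κ
    refine ⟨h1, x, rfl, ?_⟩
    rw [fderiv_secular_mk, Ne, gradCLM_eq_zero_iff]
    push Not
    exact h2

/-- A second vanishing eigenphase would put a zero factor into every gradient coefficient. -/
theorem IsEigensystem.exists_unique_of_mem_regularPart {κ : Torus E}
    {θ : Fin (2 * Fintype.card E) → AddCircle (2 * π)}
    {a : OrthonormalBasis (Fin (2 * Fintype.card E)) ℂ (EuclideanSpace ℂ (E ⊕ E))}
    (h : G.IsEigensystem κ θ a) (hκ : κ ∈ G.regularPart) :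
    ∃ n, θ n = 0 ∧ ∀ m, θ m = 0 → m = n := by
  obtain ⟨n, hn⟩ := h.exists_phase_eq_zero hκ.1
  refine ⟨n, hn, fun m hm => ?_⟩
  by_contra hne
  obtain ⟨e, he⟩ := ((mem_regularPart_iff κ).mp hκ).2
  apply he
  rw [h.gradCoeff_eq_of_unique hn, Finset.prod_eq_zero (i := m) (by simp [hne]) (by simp [hm]),
    zero_mul]

theorem toCircle_eq_one_iff (t : AddCircle (2 * π)) : (t.toCircle : ℂ) = 1 ↔ t = 0 := by
  constructor
  · intro h
    refine AddCircle.injective_toCircle (T := 2 * π) Real.two_pi_pos.ne' ?_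
    rw [AddCircle.toCircle_zero]
    ext
    simpa using h
  · rintro rfl; simp

theorem IsEigensystem.prod_erase_ne_zero
    {θ : Fin (2 * Fintype.card E) → AddCircle (2 * π)}
    {n : Fin (2 * Fintype.card E)} (hn : ∀ m, θ m = 0 → m = n) :
    ∏ m ∈ Finset.univ.erase n, (1 - ((θ m).toCircle : ℂ)) ≠ 0 := by
  rw [Finset.prod_ne_zero_iff]
  intro m hm h0
  exact (Finset.mem_erase.mp hm).1 (hn m ((toCircle_eq_one_iff _).mp (sub_eq_zero.mp h0).symm))

/-- The gradient coefficients are a nonzero constant times the edge masses, which sum to one and so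
cannot all vanish. -/
theorem IsEigensystem.mem_regularPart {κ : Torus E}
    {θ : Fin (2 * Fintype.card E) → AddCircle (2 * π)}
    {a : OrthonormalBasis (Fin (2 * Fintype.card E)) ℂ (EuclideanSpace ℂ (E ⊕ E))}
    (h : G.IsEigensystem κ θ a) {n : Fin (2 * Fintype.card E)} (hn0 : θ n = 0)
    (hn : ∀ m, θ m = 0 → m = n) : κ ∈ G.regularPart := by
  rw [mem_regularPart_iff]
  refine ⟨?_, ?_⟩
  · rw [h.secular_eq]
    exact Finset.prod_eq_zero (Finset.mem_univ n) (by simp [hn0])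
  · by_contra! hcon
    have hs := sum_edgeMass (a n)
    rw [a.orthonormal.1 n] at hs
    have : ∀ e, edgeMass (a n) e = 0 := by
      intro e
      have := hcon e
      rw [h.gradCoeff_eq_of_unique hn0] at this
      exact_mod_cast (mul_eq_zero.mp this).resolve_left (prod_erase_ne_zero hn)
    simp [this] at hs

end QGraph

/-! ### Zero sets of real-analytic functions -/

theorem ae_ne_zero_of_analyticOnNhd_real {f : ℝ → ℂ} (hf : AnalyticOnNhd ℝ f Set.univ) {x₀ : ℝ}
    (h₀ : f x₀ ≠ 0) : ∀ᵐ x, f x ≠ 0 := by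
  rcases hf.eqOn_zero_or_eventually_ne_zero_of_preconnected isPreconnected_univ with h | h
  · exact absurd (h (Set.mem_univ x₀)) h₀
  · have h2 := ae_restrict_le_codiscreteWithin (μ := (volume : Measure ℝ)) MeasurableSet.univ h
    rwa [Measure.restrict_univ] at h2

/-- Induction on the dimension with Fubini. Freezing the first coordinate at that of `x₀` leaves a
nonzero analytic function of the others, so almost every line in the first direction meets a point
where `F ≠ 0`; the one-variable case applies on these lines. -/
theorem ae_ne_zero_of_analyticOnNhd_fin : ∀ {n : ℕ} {F : (Fin n → ℝ) → ℂ},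
    AnalyticOnNhd ℝ F Set.univ → ∀ {x₀ : Fin n → ℝ}, F x₀ ≠ 0 → ∀ᵐ x, F x ≠ 0 := by
  intro n
  induction n with
  | zero =>
    intro F hF x₀ h₀
    exact Filter.Eventually.of_forall fun x => by rwa [Subsingleton.elim x x₀]
  | succ n ih =>
    intro F hF x₀ h₀
    have hmp := (volume_preserving_piFinSuccAbove (fun _ : Fin (n + 1) => ℝ) 0).symm
    have hcont : Continuous F := continuous_iff_continuousAt.mpr fun x => (hF x trivial).continuousAt
    have hms : MeasurableSet {x | F x ≠ 0} :=
      (isClosed_singleton.preimage hcont).isOpen_compl.measurableSet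
    rw [← hmp.map_eq, ae_map_iff hmp.measurable.aemeasurable hms]
    have hms' : MeasurableSet {p : ℝ × (Fin n → ℝ) |
        F ((MeasurableEquiv.piFinSuccAbove (fun _ : Fin (n + 1) => ℝ) 0).symm p) ≠ 0} :=
      hmp.measurable hms
    have hcons : ∀ p : ℝ × (Fin n → ℝ),
        (MeasurableEquiv.piFinSuccAbove (fun _ : Fin (n + 1) => ℝ) 0).symm p =
          Fin.cons p.1 p.2 := fun p => by simp [Fin.insertNthEquiv]
    rw [Measure.volume_eq_prod, ← Measure.prod_swap, ae_map_iff measurable_swap.aemeasurable hms',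
      Measure.ae_prod_iff_ae_ae]
    · have h1 : ∀ᵐ y : Fin n → ℝ, F (Fin.cons (x₀ 0) y) ≠ 0 := by
        refine ih (F := fun y => F (Fin.cons (x₀ 0) y)) ?_ (x₀ := Fin.tail x₀) (by simpa using h₀)
        intro y _
        refine (hF _ trivial).comp (g := F) (f := fun y : Fin n → ℝ => Fin.cons (x₀ 0) y) ?_
        rw [analyticAt_pi_iff]
        intro i
        refine Fin.cases ?_ (fun j => ?_) i
        · simpa using analyticAt_const
        · simp only [Fin.cons_succ]
          exact (ContinuousLinearMap.proj (R := ℝ) (φ := fun _ : Fin n => ℝ) j).analyticAt y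
      filter_upwards [h1] with y hy
      have := ae_ne_zero_of_analyticOnNhd_real (f := fun t => F (Fin.cons t y)) ?_ hy
      · filter_upwards [this] with t ht
        simpa [hcons] using ht
      · intro t _
        refine (hF _ trivial).comp (g := F) (f := fun t : ℝ => (Fin.cons t y : Fin (n+1) → ℝ)) ?_
        rw [analyticAt_pi_iff]
        intro i
        refine Fin.cases ?_ (fun j => ?_) i
        · simp only [Fin.cons_zero]
          exact analyticAt_id
        · simpa using analyticAt_const
    · exact measurable_swap hms'

/-- The zero set of a nonzero real-analytic function on `ℝ^E` is a null set. -/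
theorem ae_ne_zero_of_analyticOnNhd {E : Type*} [Fintype E] {F : EuclideanSpace ℝ E → ℂ}
    (hF : AnalyticOnNhd ℝ F Set.univ) {x₀ : EuclideanSpace ℝ E} (h₀ : F x₀ ≠ 0) :
    ∀ᵐ x, F x ≠ 0 := by
  have hcont : Continuous F := continuous_iff_continuousAt.mpr fun x => (hF x trivial).continuousAt
  have hms : MeasurableSet {x | F x ≠ 0} :=
    (isClosed_singleton.preimage hcont).isOpen_compl.measurableSet
  let e := Fintype.equivFin E
  have hmp := (PiLp.volume_preserving_toLp E).comp
    (volume_measurePreserving_piCongrLeft (fun _ : E => ℝ) e.symm)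
  rw [← hmp.map_eq, ae_map_iff hmp.measurable.aemeasurable hms]
  have heq : ∀ x : Fin (Fintype.card E) → ℝ,
      MeasurableEquiv.piCongrLeft (fun _ : E => ℝ) e.symm x = fun i => x (e i) := by
    intro x
    ext i
    rw [MeasurableEquiv.coe_piCongrLeft]
    simpa using Equiv.piCongrLeft_apply_apply (P := fun _ : E => ℝ) e.symm x (e i)
  simp only [Function.comp_apply, heq]
  refine ae_ne_zero_of_analyticOnNhd_fin (F := fun x => F (WithLp.toLp 2 fun i => x (e i))) ?_
    (x₀ := fun i => x₀ (e.symm i)) ?_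
  · intro x _
    refine (hF _ trivial).comp (g := F)
      (f := fun x : Fin (Fintype.card E) → ℝ => WithLp.toLp 2 fun i => x (e i)) ?_
    exact (((EuclideanSpace.equiv E ℝ).symm : (E → ℝ) →L[ℝ] EuclideanSpace ℝ E).comp
      (ContinuousLinearMap.pi fun i => ContinuousLinearMap.proj (e i))).analyticAt x
  · simpa using h₀

/-! ### Lebesgue measure on the torus through fundamental boxes -/

namespace Torus

variable {E : Type*} [Fintype E]

/-- The fundamental box `∏ (t_e, t_e + 2π]`. -/
def box (t : E → ℝ) : Set (EuclideanSpace ℝ E) := {x | ∀ e, x e ∈ Set.Ioc (t e) (t e + 2 * π)}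

theorem measurableSet_box (t : E → ℝ) : MeasurableSet (box t) := by
  have : box t = ⋂ e, (fun x : EuclideanSpace ℝ E => x e) ⁻¹' Set.Ioc (t e) (t e + 2 * π) := by
    ext; simp [box]
  rw [this]
  exact MeasurableSet.iInter fun e =>
    measurableSet_Ioc.preimage ((EuclideanSpace.proj (𝕜 := ℝ) e).continuous.measurable)

theorem measurePreserving_mk (t : E → ℝ) :
    MeasurePreserving (mk : EuclideanSpace ℝ E → Torus E) (volume.restrict (box t)) volume := by
  have h1 : MeasurePreserving (fun (x : E → ℝ) e => (x e : AddCircle (2 * π)))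
      (Measure.pi fun e => volume.restrict (Set.Ioc (t e) (t e + 2 * π))) volume :=
    measurePreserving_pi _ _ fun e => AddCircle.measurePreserving_mk (2 * π) (t e)
  rw [← Measure.restrict_pi_pi] at h1
  have h2 := (PiLp.volume_preserving_ofLp E).restrict_preimage
    (s := Set.pi Set.univ fun e => Set.Ioc (t e) (t e + 2 * π))
    (MeasurableSet.univ_pi fun e => measurableSet_Ioc)
  have h3 := h1.comp h2
  have : (@WithLp.ofLp 2 (E → ℝ) ⁻¹' Set.pi Set.univ fun e => Set.Ioc (t e) (t e + 2 * π)) = box t := by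
    ext; simp [box]
  rw [this] at h3
  exact h3

theorem ae_of_ae_mk {p : Torus E → Prop} (hp : MeasurableSet {κ | p κ})
    (h : ∀ᵐ x : EuclideanSpace ℝ E, p (mk x)) : ∀ᵐ κ, p κ := by
  rw [← (measurePreserving_mk (0 : E → ℝ)).map_eq,
    ae_map_iff (measurePreserving_mk 0).measurable.aemeasurable hp]
  exact ae_restrict_of_ae h

end Torus

theorem analyticOnNhd_matrix_det {X n : Type*} [NormedAddCommGroup X] [NormedSpace ℝ X] [Fintype n]
    [DecidableEq n] {M : X → Matrix n n ℂ}
    (hM : ∀ i j, AnalyticOnNhd ℝ (fun x => M x i j) Set.univ) :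
    AnalyticOnNhd ℝ (fun x => (M x).det) Set.univ := by
  intro x _
  simp only [det_apply']
  refine Finset.analyticAt_fun_sum _ fun σ _ => analyticAt_const.mul ?_
  exact Finset.analyticAt_fun_prod _ fun i _ => hM _ _ x trivial

/-! ### The discriminant and generic points of the torus -/

namespace QGraph

variable {V E : Type*} {G : QGraph V E} [DecidableEq V] [Fintype E] [DecidableEq E]

variable (G) in
/-- The discriminant of the characteristic polynomial of `U_κ`, as the Hankel determinant of the
traces of the powers of `U_κ`. -/
def discr (κ : Torus E) : ℂ :=
  (of fun i j : Fin (2 * Fintype.card E) => (G.evolution κ ^ ((i : ℕ) + j)).trace).det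

/-- The Hankel matrix of power sums is `Vᵀ V` for the Vandermonde matrix `V` of the eigenvalues. -/
theorem IsEigensystem.discr_ne_zero_iff {κ : Torus E}
    {θ : Fin (2 * Fintype.card E) → AddCircle (2 * π)}
    {a : OrthonormalBasis (Fin (2 * Fintype.card E)) ℂ (EuclideanSpace ℂ (E ⊕ E))}
    (h : G.IsEigensystem κ θ a) : G.discr κ ≠ 0 ↔ Function.Injective θ := by
  have h1 : (of fun i j : Fin (2 * Fintype.card E) => (G.evolution κ ^ ((i : ℕ) + j)).trace) =
      (vandermonde fun n => ((θ n).toCircle : ℂ))ᵀ * vandermonde fun n => ((θ n).toCircle : ℂ) := by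
    ext i j
    rw [vandermonde_transpose_mul_vandermonde, of_apply, h.trace_evolution_pow]
  rw [discr, h1, det_mul, det_transpose, mul_self_ne_zero, det_vandermonde_ne_zero_iff]
  have hinj : Function.Injective fun t : AddCircle (2 * π) => (t.toCircle : ℂ) :=
    Circle.coe_injective.comp (AddCircle.injective_toCircle (T := 2 * π) Real.two_pi_pos.ne')
  exact ⟨fun hh => Function.Injective.of_comp (f := fun t : AddCircle (2 * π) => (t.toCircle : ℂ)) hh,
    fun hh => hinj.comp hh⟩

theorem continuous_discr : Continuous G.discr := by
  refine Continuous.matrix_det (continuous_matrix fun i j => ?_)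
  exact (continuous_evolution.pow _).matrix_trace

theorem analyticOnNhd_discr_mk :
    AnalyticOnNhd ℝ (fun x : EuclideanSpace ℝ E => G.discr (Torus.mk x)) Set.univ := by
  have hpow : ∀ (k : ℕ) (i j : E ⊕ E), AnalyticOnNhd ℝ
      (fun x : EuclideanSpace ℝ E => (G.evolution (Torus.mk x) ^ k) i j) Set.univ := by
    intro k
    induction k with
    | zero => intro i j x _; simpa using analyticAt_const
    | succ k ih =>
      intro i j x _
      simp only [pow_succ, Matrix.mul_apply]
      exact Finset.analyticAt_fun_sum _ fun l _ =>
        (ih i l x trivial).mul (analyticOnNhd_evolution_mk l j x trivial)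
  refine analyticOnNhd_matrix_det fun i j => ?_
  intro x _
  simp only [of_apply, trace, diag_apply]
  exact Finset.analyticAt_fun_sum _ fun l _ => hpow _ _ _ x trivial

/-- A generic point of the torus satisfies no non-trivial integer relation. -/
theorem ae_no_integer_relation :
    ∀ᵐ κ : Torus E, ∀ m : E → ℤ, m ≠ 0 → ∑ e, m e • κ e ≠ 0 := by
  rw [ae_all_iff]
  intro m
  by_cases hm : m = 0
  · simp [hm]
  obtain ⟨e₀, he₀⟩ := Function.ne_iff.mp hm
  have hclosed : IsClosed {κ : Torus E | ∑ e, m e • κ e = 0} :=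
    isClosed_singleton.preimage
      (continuous_finsetSum _ fun e _ => (continuous_zsmul (m e)).comp (continuous_apply e))
  have : ∀ᵐ κ : Torus E, ∑ e, m e • κ e ≠ 0 := by
    refine Torus.ae_of_ae_mk hclosed.measurableSet.compl ?_
    have hF : AnalyticOnNhd ℝ (fun x : EuclideanSpace ℝ E =>
        Complex.exp ((∑ e, m e * x e : ℝ) * Complex.I) - 1) Set.univ := by
      intro x _
      have h1 : AnalyticAt ℝ (fun x : EuclideanSpace ℝ E => ((∑ e, m e * x e : ℝ) : ℂ)) x := by
        have := (Complex.ofRealCLM.comp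
          (∑ e, (m e : ℝ) • EuclideanSpace.proj (𝕜 := ℝ) e)).analyticAt x
        refine this.congr (Filter.Eventually.of_forall fun y => ?_)
        simp
      exact ((analyticAt_cexp.restrictScalars (𝕜 := ℝ)).comp (h1.mul analyticAt_const)).sub
        analyticAt_const
    -- At this point the character of the torus defined by `m` takes the value `e^{iπ} = -1`.
    have hx₀ : Complex.exp ((∑ e, m e * (EuclideanSpace.single e₀ (π / m e₀) :
        EuclideanSpace ℝ E) e : ℝ) * Complex.I) - 1 ≠ 0 := by
      have : ∑ e, (m e : ℝ) * (EuclideanSpace.single e₀ (π / m e₀) : EuclideanSpace ℝ E) e = π := by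
        have h0 : (m e₀ : ℝ) ≠ 0 := by exact_mod_cast he₀
        simp
        field_simp
      rw [this, Complex.exp_pi_mul_I]
      norm_num
    filter_upwards [ae_ne_zero_of_analyticOnNhd hF hx₀] with x hx h0
    apply hx
    have h1 : ((∑ e, m e * x e : ℝ) : AddCircle (2 * π)) = 0 := by
      rw [← h0]
      simp [Torus.mk, ← zsmul_eq_mul]
    have h2 := congrArg (fun t : AddCircle (2 * π) => (t.toCircle : ℂ)) h1
    simp only [AddCircle.toCircle_apply_mk, div_self Real.two_pi_pos.ne', one_mul,
      Circle.coe_exp, AddCircle.toCircle_zero, Circle.coe_one] at h2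
    rw [h2, sub_self]
  filter_upwards [this] with κ hκ _ using hκ

end QGraph

/-! ### Time reversal, travelling waves and integer relations on a multiple eigenspace -/

namespace QGraph

open ComplexConjugate

variable {V E : Type*} {G : QGraph V E} [DecidableEq V] [Fintype E] [DecidableEq E]

/-- The undirected edge underlying a directed edge. -/
def undirected : E ⊕ E → E := Sum.elim id id

@[simp] theorem undirected_swap (j : E ⊕ E) : undirected j.swap = undirected j := by
  cases j <;> rfl

variable (G) in
@[simp] theorem origin_swap (j : E ⊕ E) : G.origin j.swap = G.terminus j := by
  cases j <;> rfl

variable (G) in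
@[simp] theorem terminus_swap (j : E ⊕ E) : G.terminus j.swap = G.origin j := by
  cases j <;> rfl

variable (G) in
/-- The common value at the vertex `v` of the waves described by the amplitudes `a`. -/
def vertexValue (a : E ⊕ E → ℂ) (v : V) : ℂ :=
  2 / (G.deg v : ℂ) * ∑ j with G.origin j = v, a j.swap

theorem sum_swap (f : E ⊕ E → ℂ) : ∑ j : E ⊕ E, f j.swap = ∑ j, f j :=
  (Equiv.sumComm E E).sum_comp f

/-- The rank-one part of `S` at a vertex sees the incoming amplitudes only through their sum; the
remaining part is reflection. Eigenvectors thereby become solutions of a relation involving a single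
number per vertex. -/
theorem scattering_mulVec (a : E ⊕ E → ℂ) (j : E ⊕ E) :
    (G.scattering.map Complex.ofReal *ᵥ a) j = G.vertexValue a (G.origin j) - a j.swap := by
  have h1 : ∀ i, (G.scattering.map Complex.ofReal) j i * a i =
      (if G.terminus i = G.origin j then 2 / (G.deg (G.origin j) : ℂ) * a i else 0) -
        (if i = j.swap then a i else 0) := by
    intro i
    simp only [Matrix.map_apply, scattering]
    by_cases h : i = j.swap
    · subst h
      simp only [terminus_swap, if_true]
      push_cast
      ring
    · by_cases h' : G.terminus i = G.origin j <;> simp [h, h']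
  rw [mulVec, dotProduct, Finset.sum_congr rfl fun i _ => h1 i, Finset.sum_sub_distrib,
    Finset.sum_ite_eq' Finset.univ j.swap a, if_pos (Finset.mem_univ _), ← Finset.sum_filter,
    ← Finset.mul_sum, vertexValue, Finset.sum_filter, Finset.sum_filter,
    ← sum_swap (fun i => if G.terminus i = G.origin j then a i else 0)]
  simp

theorem evolution_mulVec_eq_iff (κ : Torus E) (z : ℂ) (a : E ⊕ E → ℂ) :
    G.evolution κ *ᵥ a = z • a ↔
      ∀ j, z * a j = ((κ (undirected j)).toCircle : ℂ) *
        (G.vertexValue a (G.origin j) - a j.swap) := by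
  rw [funext_iff]
  refine forall_congr' fun j => ?_
  rw [evolution, ← mulVec_mulVec, mulVec_diagonal, scattering_mulVec, eq_comm]
  rcases j with j | j <;> simp [undirected]

theorem toCircle_mul_conj (t : AddCircle (2 * π)) : (t.toCircle : ℂ) * conj (t.toCircle : ℂ) = 1 := by
  rw [Complex.mul_conj']
  simp [show ‖(t.toCircle : ℂ)‖ = 1 from Circle.norm_coe _]

/-- The time reversal of the amplitudes `a` at the eigenphase `θ`. -/
def timeReversal (κ : Torus E) (θ : AddCircle (2 * π)) (a : E ⊕ E → ℂ) : E ⊕ E → ℂ := fun j =>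
  conj (θ.toCircle : ℂ) * ((κ (undirected j)).toCircle : ℂ) * conj (a j.swap)

theorem deg_origin_ne_zero (j : E ⊕ E) : G.deg (G.origin j) ≠ 0 := by
  rw [deg, Finset.card_ne_zero]
  exact ⟨j, by simp⟩

/-- Conjugating the eigenvalue equation expresses the reversed amplitudes by the conjugate vertex
value `w` minus the conjugate incoming amplitude. Summed over the vertex this is `deg · w - (deg /
2) · w`, so the reversed wave has vertex value `w`, and its eigenvalue equation is the conjugated
one. -/
theorem evolution_timeReversal {κ : Torus E} {θ : AddCircle (2 * π)} {a : E ⊕ E → ℂ}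
    (h : G.evolution κ *ᵥ a = (θ.toCircle : ℂ) • a) :
    G.evolution κ *ᵥ timeReversal κ θ a = (θ.toCircle : ℂ) • timeReversal κ θ a := by
  rw [evolution_mulVec_eq_iff] at h ⊢
  have hc : ∀ j, conj (θ.toCircle : ℂ) * ((κ (undirected j)).toCircle : ℂ) * conj (a j) =
      conj (G.vertexValue a (G.origin j)) - conj (a j.swap) := by
    intro j
    have := congrArg conj (h j)
    simp only [map_mul, map_sub] at this
    linear_combination ((κ (undirected j)).toCircle : ℂ) * this +
      (conj (G.vertexValue a (G.origin j)) - conj (a j.swap)) *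
        toCircle_mul_conj (κ (undirected j))
  have hv : ∀ j, G.vertexValue (timeReversal κ θ a) (G.origin j) =
      conj (G.vertexValue a (G.origin j)) := by
    intro j
    have hd : (G.deg (G.origin j) : ℂ) ≠ 0 := by exact_mod_cast deg_origin_ne_zero (G := G) j
    have h1 : ∑ i with G.origin i = G.origin j, timeReversal κ θ a i.swap =
        G.deg (G.origin j) * conj (G.vertexValue a (G.origin j)) -
          ∑ i with G.origin i = G.origin j, conj (a i.swap) := by
      rw [deg, ← nsmul_eq_mul, ← Finset.sum_const, ← Finset.sum_sub_distrib]
      refine Finset.sum_congr rfl fun i hi => ?_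
      rw [← (Finset.mem_filter.mp hi).2, ← hc i]
      simp [timeReversal]
    have h2 : conj (G.vertexValue a (G.origin j)) = 2 / (G.deg (G.origin j) : ℂ) *
        ∑ i with G.origin i = G.origin j, conj (a i.swap) := by
      rw [vertexValue, map_mul, map_sum, map_div₀, Complex.conj_natCast, Complex.conj_ofNat]
    rw [vertexValue, h1, mul_sub, ← h2]
    field_simp
    ring
  intro j
  rw [hv]
  have := hc j
  simp only [timeReversal, Sum.swap_swap, undirected_swap]
  linear_combination ((κ (undirected j)).toCircle : ℂ) * conj (a j.swap) * toCircle_mul_conj θ +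
    ((κ (undirected j)).toCircle : ℂ) * this

/-- A complex quadratic form in two variables has a nontrivial zero. -/
theorem exists_isotropic (p q r : ℂ) : ∃ x y : ℂ, (x ≠ 0 ∨ y ≠ 0) ∧
    x * x * p + 2 * x * y * q + y * y * r = 0 := by
  by_cases hr : r = 0
  · exact ⟨0, 1, Or.inr one_ne_zero, by simp [hr]⟩
  · obtain ⟨s, hs⟩ := IsAlgClosed.exists_pow_nat_eq (discrim r (2 * q) p) (n := 2) (by norm_num)
    obtain ⟨y, hy⟩ := exists_quadratic_eq_zero hr ⟨s, by rw [← hs, sq]⟩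
    exact ⟨1, y, Or.inl one_ne_zero, by linear_combination hy⟩

section Degenerate

variable {κ : Torus E} {θ : AddCircle (2 * π)} {c : E → ℂ} {a₁ a₂ : E ⊕ E → ℂ}

theorem sum_conj_mul_self_ne_zero {a : E ⊕ E → ℂ} (ha : a ≠ 0) : ∑ j, conj (a j) * a j ≠ 0 := by
  intro h
  apply ha
  simp only [Complex.conj_mul'] at h
  have h' : ∑ j, ‖a j‖ ^ 2 = 0 := by exact_mod_cast h
  rw [Finset.sum_eq_zero_iff_of_nonneg fun _ _ => by positivity] at h'
  ext j
  simpa using h' j (Finset.mem_univ j)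

theorem eq_zero_of_conj_mul_add {x y : ℂ} (h : conj x * x + conj y * y = 0) : x = 0 ∧ y = 0 := by
  rw [Complex.conj_mul', Complex.conj_mul'] at h
  have h' : ‖x‖ ^ 2 + ‖y‖ ^ 2 = 0 := by exact_mod_cast h
  constructor
  · exact norm_eq_zero.mp (by nlinarith [sq_nonneg ‖x‖, sq_nonneg ‖y‖])
  · exact norm_eq_zero.mp (by nlinarith [sq_nonneg ‖x‖, sq_nonneg ‖y‖])

/-- On an eigenspace of dimension at least two to which every edge projection compresses to a
scalar, none of these scalars vanishes. -/
theorem compression_ne_zero (hG : G.IsAdmissible)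
    (h₁ : G.evolution κ *ᵥ a₁ = (θ.toCircle : ℂ) • a₁)
    (h₂ : G.evolution κ *ᵥ a₂ = (θ.toCircle : ℂ) • a₂)
    (hind : ∀ x y : ℂ, x • a₁ + y • a₂ = 0 → x = 0 ∧ y = 0)
    (hc : ∀ a b : E ⊕ E → ℂ, G.evolution κ *ᵥ a = (θ.toCircle : ℂ) • a →
      G.evolution κ *ᵥ b = (θ.toCircle : ℂ) • b → ∀ e,
      conj (a (.inl e)) * b (.inl e) + conj (a (.inr e)) * b (.inr e) =
        c e * ∑ j, conj (a j) * b j) (e : E) : c e ≠ 0 := by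
  intro hce
  have hvan : ∀ e, c e = 0 → ∀ a, G.evolution κ *ᵥ a = (θ.toCircle : ℂ) • a →
      ∀ j, undirected j = e → a j = 0 := by
    intro e he a ha j hj
    have h := hc a a ha ha e
    rw [he, zero_mul] at h
    have h' := eq_zero_of_conj_mul_add h
    rcases j with j | j
    · rw [← (show j = e from hj)] at h'; exact h'.1
    · rw [← (show j = e from hj)] at h'; exact h'.2
  have hne : ∀ x y : ℂ, (x ≠ 0 ∨ y ≠ 0) → x • a₁ + y • a₂ ≠ 0 := by
    intro x y hxy h
    have := hind x y h
    tauto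
  have hcomb : ∀ x y : ℂ, G.evolution κ *ᵥ (x • a₁ + y • a₂) =
      (θ.toCircle : ℂ) • (x • a₁ + y • a₂) := by
    intro x y
    rw [mulVec_add, mulVec_smul, mulVec_smul, h₁, h₂, smul_add, smul_comm x, smul_comm y]
  -- Vanishing spreads across a vertex. If all eigenvectors vanish on the edge of `i`, the vertex
  -- value is zero. Dimension two leaves a nonzero eigenvector with `a j = 0`; its reversed
  -- amplitude is then zero too, so the scalar at that edge must vanish.
  have hprop : ∀ i j : E ⊕ E, G.origin i = G.origin j → c (undirected i) = 0 →
      c (undirected j) = 0 := by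
    intro i j hij hi
    have hσ : ∀ a, G.evolution κ *ᵥ a = (θ.toCircle : ℂ) • a →
        G.vertexValue a (G.origin j) = 0 := by
      intro a ha
      have h := (evolution_mulVec_eq_iff _ _ _).mp ha i
      rw [hvan _ hi a ha i rfl, hvan _ hi a ha i.swap (by simp), hij] at h
      simpa using h
    obtain ⟨a, ha, ha0, haj⟩ : ∃ a, G.evolution κ *ᵥ a = (θ.toCircle : ℂ) • a ∧ a ≠ 0 ∧
        a j = 0 := by
      by_cases hz : a₁ j = 0
      · exact ⟨a₁, h₁, by simpa using hne 1 0 (Or.inl one_ne_zero), hz⟩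
      · exact ⟨a₂ j • a₁ + (-a₁ j) • a₂, hcomb _ _, hne _ _ (Or.inr (neg_ne_zero.mpr hz)), by
          simp; ring⟩
    have haj' : a j.swap = 0 := by
      have h := (evolution_mulVec_eq_iff _ _ _).mp ha j
      rw [hσ a ha, haj] at h
      simpa using h
    have h := hc a a ha ha (undirected j)
    have hl : conj (a (.inl (undirected j))) * a (.inl (undirected j)) +
        conj (a (.inr (undirected j))) * a (.inr (undirected j)) = 0 := by
      rcases j with j | j
      · have : a (.inr j) = 0 := haj'
        simp [undirected, haj, this]
      · have : a (.inl j) = 0 := haj'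
        simp [undirected, haj, this]
    rw [hl] at h
    exact (mul_eq_zero.mp h.symm).resolve_right (sum_conj_mul_self_ne_zero ha0)
  have hwalk : ∀ {v w : V} (_ : G.toSimpleGraph.Walk v w),
      (∀ j, G.origin j = v → c (undirected j) = 0) → ∀ j, G.origin j = w → c (undirected j) = 0 := by
    intro v w p
    induction p with
    | nil => exact id
    | @cons v u w hadj p ih =>
      intro hv
      apply ih
      intro j hj
      have hadj' := (SimpleGraph.fromRel_adj _ _ _).mp hadj
      rcases hadj'.2 with ⟨e, he1, he2⟩ | ⟨e, he1, he2⟩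
      · exact hprop (.inr e) j (by rw [hj, ← he2]; rfl) (hv (.inl e) he1)
      · exact hprop (.inl e) j (by rw [hj, ← he1]; rfl) (hv (.inr e) he2)
  have hall : ∀ j, c (undirected j) = 0 := by
    intro j
    obtain ⟨p⟩ := hG.connected.preconnected (G.tail e) (G.origin j)
    exact hwalk p (fun i hi => hprop (.inl e) i hi.symm hce) j rfl
  refine hne 1 0 (Or.inl one_ne_zero) ?_
  ext j
  simpa using hvan _ (hall j) a₁ h₁ j rfl

/-- Connectedness together with the existence of an edge excludes isolated vertices. -/
theorem exists_origin_eq (hG : G.IsAdmissible) (v : V) : ∃ j, G.origin j = v := by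
  obtain ⟨e⟩ := hG.nonempty_edges
  obtain ⟨p⟩ := hG.connected.preconnected v (G.tail e)
  cases p with
  | nil => exact ⟨.inl e, rfl⟩
  | cons hadj p =>
    rcases ((SimpleGraph.fromRel_adj _ _ _).mp hadj).2 with ⟨e, he1, he2⟩ | ⟨e, he1, he2⟩
    · exact ⟨.inl e, he1⟩
    · exact ⟨.inr e, he2⟩

/-- Such an eigenspace contains a vector which travels along each edge in one direction only. -/
theorem exists_travelling_wave (hG : G.IsAdmissible)
    (h₁ : G.evolution κ *ᵥ a₁ = (θ.toCircle : ℂ) • a₁)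
    (h₂ : G.evolution κ *ᵥ a₂ = (θ.toCircle : ℂ) • a₂)
    (hind : ∀ x y : ℂ, x • a₁ + y • a₂ = 0 → x = 0 ∧ y = 0)
    (hc : ∀ a b : E ⊕ E → ℂ, G.evolution κ *ᵥ a = (θ.toCircle : ℂ) • a →
      G.evolution κ *ᵥ b = (θ.toCircle : ℂ) • b → ∀ e,
      conj (a (.inl e)) * b (.inl e) + conj (a (.inr e)) * b (.inr e) =
        c e * ∑ j, conj (a j) * b j) :
    ∃ F : E ⊕ E → ℂ, G.evolution κ *ᵥ F = (θ.toCircle : ℂ) • F ∧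
      ∀ e, ∃ j, undirected j = e ∧ F j ≠ 0 ∧ F j.swap = 0 := by
  -- Pairing with the time reversal turns the Hermitian product into a symmetric complex bilinear
  -- form, which has an isotropic vector on any plane.
  let B : (E ⊕ E → ℂ) → (E ⊕ E → ℂ) → ℂ := fun a b => ∑ j, conj (timeReversal κ θ a j) * b j
  have hB : ∀ a b, B a b = ∑ j, (θ.toCircle : ℂ) * conj ((κ (undirected j)).toCircle : ℂ) *
      (a j.swap * b j) := fun a b => Finset.sum_congr rfl fun j _ => by
    simp [timeReversal]; ring
  have hBs : B a₂ a₁ = B a₁ a₂ := by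
    rw [hB, hB, ← sum_swap]
    exact Finset.sum_congr rfl fun j _ => by simp; ring
  obtain ⟨x, y, hxy, h0⟩ := exists_isotropic (B a₁ a₁) (B a₁ a₂) (B a₂ a₂)
  have hF : G.evolution κ *ᵥ (x • a₁ + y • a₂) = (θ.toCircle : ℂ) • (x • a₁ + y • a₂) := by
    rw [mulVec_add, mulVec_smul, mulVec_smul, h₁, h₂, smul_add, smul_comm x, smul_comm y]
  have hF0 : x • a₁ + y • a₂ ≠ 0 := by
    intro h
    have := hind x y h
    tauto
  have hBF : B (x • a₁ + y • a₂) (x • a₁ + y • a₂) = 0 := by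
    rw [← h0]
    have e1 : B (x • a₁ + y • a₂) (x • a₁ + y • a₂) =
        x * x * B a₁ a₁ + x * y * B a₁ a₂ + x * y * B a₂ a₁ + y * y * B a₂ a₂ := by
      simp only [hB, Finset.mul_sum, ← Finset.sum_add_distrib]
      exact Finset.sum_congr rfl fun j _ => by simp; ring
    rw [e1, hBs]; ring
  refine ⟨x • a₁ + y • a₂, hF, fun e => ?_⟩
  generalize x • a₁ + y • a₂ = F at hF hF0 hBF
  -- Since `F` is orthogonal to its time reversal and `P_e` compresses to a scalar, the pairing
  -- vanishes edge by edge. On the edge `e` it is a unimodular multiple of `2 F(e) F(ê)`.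
  have h3 := hc _ _ (evolution_timeReversal hF) hF e
  rw [show ∑ j, conj (timeReversal κ θ F j) * F j = 0 from hBF, mul_zero] at h3
  have h4 : F (.inl e) * F (.inr e) = 0 := by
    have hu : ((κ e).toCircle : ℂ) ≠ 0 := Circle.coe_ne_zero _
    have hl : (θ.toCircle : ℂ) ≠ 0 := Circle.coe_ne_zero _
    have h5 : (2 * (θ.toCircle : ℂ) * conj ((κ e).toCircle : ℂ)) * (F (.inl e) * F (.inr e)) = 0 := by
      rw [← h3]
      simp [timeReversal, undirected]
      ring
    refine (mul_eq_zero.mp h5).resolve_left ?_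
    simp [hu, hl]
  have h6 := hc _ _ hF hF e
  have hce := compression_ne_zero hG h₁ h₂ hind hc e
  rcases mul_eq_zero.mp h4 with h7 | h7
  · refine ⟨.inr e, rfl, fun h8 => ?_, h7⟩
    rw [h7, h8] at h6
    simp only [mul_zero, add_zero] at h6
    exact (mul_ne_zero hce (sum_conj_mul_self_ne_zero hF0)) h6.symm
  · refine ⟨.inl e, rfl, fun h8 => ?_, h7⟩
    rw [h7, h8] at h6
    simp only [mul_zero, add_zero] at h6
    exact (mul_ne_zero hce (sum_conj_mul_self_ne_zero hF0)) h6.symm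

/-- The phases of the vertex values of a travelling wave express the torus coordinates. -/
theorem exists_integer_relation [Fintype V] (hG : G.IsAdmissible) {F : E ⊕ E → ℂ}
    (hF : G.evolution κ *ᵥ F = (θ.toCircle : ℂ) • F)
    (hF' : ∀ e, ∃ j, undirected j = e ∧ F j ≠ 0 ∧ F j.swap = 0) :
    ∃ m : E → ℤ, m ≠ 0 ∧ ∑ e, m e • κ e = 0 := by
  rw [evolution_mulVec_eq_iff] at hF
  choose J hJ hJ1 hJ2 using hF'
  -- The eigenvalue equation at the reversed edge, where the wave is zero.
  have hterm : ∀ e, F (J e) = G.vertexValue F (G.terminus (J e)) := by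
    intro e
    have h := hF (J e).swap
    rw [hJ2, mul_zero, origin_swap, Sum.swap_swap] at h
    have := (mul_eq_zero.mp h.symm).resolve_left (Circle.coe_ne_zero _)
    exact (sub_eq_zero.mp this).symm
  have horig : ∀ e, (θ.toCircle : ℂ) * F (J e) =
      ((κ e).toCircle : ℂ) * G.vertexValue F (G.origin (J e)) := by
    intro e
    have h := hF (J e)
    rwa [hJ2, sub_zero, hJ] at h
  have hcase : ∀ j, j = J (undirected j) ∨ j = (J (undirected j)).swap := by
    intro j
    have := hJ (undirected j)
    rcases j with j | j <;> rcases h : J (undirected _) with k | k <;>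
      · rw [h] at this
        simp [undirected] at this
        simp [this]
  have hσ0 : ∀ v, G.vertexValue F v ≠ 0 := by
    intro v
    obtain ⟨j, rfl⟩ := exists_origin_eq hG v
    rcases hcase j with h | h
    · rw [h]
      intro h0
      have := horig (undirected j)
      rw [h0, mul_zero] at this
      exact mul_ne_zero (Circle.coe_ne_zero _) (hJ1 _) this
    · rw [h, origin_swap, ← hterm]
      exact hJ1 _
  have hdeg : ∀ v, 3 ≤ G.deg v := by
    intro v
    obtain ⟨j, rfl⟩ := exists_origin_eq hG v
    have h0 := deg_origin_ne_zero (G := G) j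
    have h2 := hG.deg_ne_two (G.origin j)
    -- A leaf reflects totally, giving both directions of its edge the same modulus; a one-way wave
    -- excludes this. With degree two excluded by hypothesis, all degrees are at least three.
    have h1 : G.deg (G.origin j) ≠ 1 := by
      intro h1
      have hv : G.vertexValue F (G.origin j) = 2 * F j.swap := by
        rw [vertexValue, h1]
        rw [deg, Finset.card_eq_one] at h1
        obtain ⟨i, hi⟩ := h1
        have hj : j ∈ ({i} : Finset (E ⊕ E)) := by rw [← hi]; simp
        rw [hi, Finset.sum_singleton, Finset.mem_singleton.mp hj]
        simp
      have hj := hF j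
      rw [hv] at hj
      have hj' : (θ.toCircle : ℂ) * F j = ((κ (undirected j)).toCircle : ℂ) * F j.swap := by
        rw [hj]; ring
      rcases hcase j with h | h
      · have e1 : F j.swap = 0 := by rw [h]; exact hJ2 _
        rw [e1, mul_zero] at hj'
        exact mul_ne_zero (Circle.coe_ne_zero _) (by rw [h]; exact hJ1 _) hj'
      · have e1 : F j = 0 := by rw [h]; exact hJ2 _
        rw [e1, mul_zero] at hj'
        refine mul_ne_zero (Circle.coe_ne_zero _) ?_ hj'.symm
        rw [h, Sum.swap_swap]; exact hJ1 _
    omega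
  -- Handshake: `2|E| = ∑ deg ≥ 3|V|`.
  have hcard : Fintype.card V < Fintype.card E := by
    have h1 : Fintype.card (E ⊕ E) = ∑ v, G.deg v := by
      rw [← Finset.card_univ]
      exact Finset.card_eq_sum_card_fiberwise fun j _ => Finset.mem_univ (G.origin j)
    have h2 : ∑ _v : V, 3 ≤ ∑ v, G.deg v := Finset.sum_le_sum fun v _ => hdeg v
    have h3 : 0 < Fintype.card E := by
      obtain ⟨e⟩ := hG.nonempty_edges
      exact Fintype.card_pos_iff.mpr ⟨e⟩
    rw [Finset.sum_const, Finset.card_univ, smul_eq_mul, ← h1, Fintype.card_sum] at h2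
    omega
  obtain ⟨v₀⟩ := hG.connected.nonempty
  let D : V → E → ℤ := fun v e =>
    (if G.terminus (J e) = v then 1 else 0) - (if G.origin (J e) = v then 1 else 0)
  have hD : ∀ e, ∑ v, D v e = 0 := by intro e; simp [D, Finset.sum_sub_distrib]
  -- The rows of the incidence matrix `D` add up to zero, so the one at `v₀` is redundant. Replacing
  -- it by ones imposes `∑ m_e = 0` with still only `|V|` equations in `|E| > |V|` unknowns, and
  -- Siegel's lemma gives an integer solution. The relation kills both the coboundary of the vertex
  -- phases and the constant `θ`.
  let M : Matrix V E ℤ := fun v e => if v = v₀ then 1 else D v e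
  obtain ⟨m, hm0, hm, -⟩ := Int.Matrix.exists_ne_zero_int_vec_norm_le M hcard
    (Fintype.card_pos_iff.mpr ⟨v₀⟩)
  have hsum : ∑ e, m e = 0 := by
    have := congrFun hm v₀
    simpa [mulVec, dotProduct, M] using this
  have hne : ∀ v, v ≠ v₀ → ∑ e, D v e * m e = 0 := by
    intro v hv
    have := congrFun hm v
    simpa [mulVec, dotProduct, M, hv] using this
  have hall : ∀ v, ∑ e, D v e * m e = 0 := by
    intro v
    by_cases hv : v = v₀
    · subst hv
      have h1 : ∑ w, ∑ e, D w e * m e = 0 := by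
        rw [Finset.sum_comm]
        refine Finset.sum_eq_zero fun e _ => ?_
        rw [← Finset.sum_mul, hD, zero_mul]
      rwa [Finset.sum_eq_single v (fun w _ hw => hne w hw) (by simp)] at h1
    · exact hne v hv
  choose φ hφ using fun v => (AddCircle.homeomorphCircle (T := 2 * π) Real.two_pi_pos.ne').surjective
    (⟨G.vertexValue F v / ‖G.vertexValue F v‖, by
      simp [Submonoid.unitSphere, hσ0 v]⟩ : Circle)
  have hκ : ∀ e, κ e = θ + (φ (G.terminus (J e)) - φ (G.origin (J e))) := by
    intro e
    rw [← add_sub_assoc, eq_sub_iff_add_eq]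
    apply AddCircle.injective_toCircle (T := 2 * π) Real.two_pi_pos.ne'
    rw [AddCircle.toCircle_add, AddCircle.toCircle_add]
    ext
    have hφ' : ∀ v, ((φ v).toCircle : ℂ) = G.vertexValue F v / ‖G.vertexValue F v‖ := by
      intro v
      have := hφ v
      rw [AddCircle.homeomorphCircle_apply] at this
      rw [this]
    -- The wave keeps its modulus along an edge, so normalizing the two end values by their moduli
    -- preserves their relation.
    have hn : ‖G.vertexValue F (G.terminus (J e))‖ = ‖G.vertexValue F (G.origin (J e))‖ := by
      have := congrArg norm (horig e)
      rw [norm_mul, norm_mul, hterm] at this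
      simpa [show ∀ t : AddCircle (2 * π), ‖(t.toCircle : ℂ)‖ = 1 from fun t => Circle.norm_coe _]
        using this
    push_cast
    rw [hφ', hφ', hn, ← hterm, ← mul_div_assoc, ← mul_div_assoc, horig]
  refine ⟨m, hm0, ?_⟩
  have hdiff : ∀ e, φ (G.terminus (J e)) - φ (G.origin (J e)) = ∑ v, D v e • φ v := by
    intro e
    simp [D, sub_smul, Finset.sum_sub_distrib, ite_smul]
  calc ∑ e, m e • κ e = (∑ e, m e) • θ + ∑ v, (∑ e, D v e * m e) • φ v := by
        simp_rw [hκ, hdiff, smul_add, Finset.sum_add_distrib, Finset.sum_smul, Finset.smul_sum]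
        congr 1
        rw [Finset.sum_comm]
        refine Finset.sum_congr rfl fun v _ => Finset.sum_congr rfl fun e _ => ?_
        rw [smul_smul, mul_comm (m e)]
    _ = 0 := by simp [hsum, hall]

end Degenerate

end QGraph

/-! ### Limits of eigensystems and the number of distinct eigenphases -/

/-- The first hypothesis makes `f = k ∘ g`, and the cardinalities force `k` to be injective on the
image of `g`. Applied with `f` the limiting and `g` the nearby eigenphases: no eigenphase splits at
a maximal point. -/
theorem eq_of_eq_of_card_image_le {ι α : Type*} [Fintype ι] [DecidableEq α] {f g : ι → α}
    (h : ∀ n m, f n ≠ f m → g n ≠ g m)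
    (hcard : (Finset.univ.image g).card ≤ (Finset.univ.image f).card) {n m : ι} (hf : f n = f m) :
    g n = g m := by
  classical
  have hfac : Function.FactorsThrough f g := fun a b hab => by
    by_contra hne
    exact h a b hne hab
  obtain ⟨k, hk⟩ : ∃ k : α → α, f = k ∘ g :=
    ⟨Function.extend g f id, (hfac.extend_comp id).symm⟩
  have hinj : Set.InjOn k (Finset.univ.image g) := by
    rw [← Finset.card_image_iff]
    refine le_antisymm Finset.card_image_le ?_
    rw [Finset.image_image, ← hk]
    exact hcard
  exact hinj (by simp) (by simp) (by simpa [hk] using hf)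

namespace QGraph

open Filter Topology

variable {V E : Type*} {G : QGraph V E} [DecidableEq V] [Fintype E] [DecidableEq E]

theorem IsEigensystem.mem_range_iff {κ : Torus E}
    {θ : Fin (2 * Fintype.card E) → AddCircle (2 * π)}
    {a : OrthonormalBasis (Fin (2 * Fintype.card E)) ℂ (EuclideanSpace ℂ (E ⊕ E))}
    (h : G.IsEigensystem κ θ a) (t : AddCircle (2 * π)) :
    (∃ n, θ n = t) ↔
      ((t.toCircle : ℂ) • (1 : Matrix (E ⊕ E) (E ⊕ E) ℂ) - G.evolution κ).det = 0 := by
  have hinj : Function.Injective fun t : AddCircle (2 * π) => (t.toCircle : ℂ) :=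
    Circle.coe_injective.comp (AddCircle.injective_toCircle (T := 2 * π) Real.two_pi_pos.ne')
  rw [h.det_sub, Finset.prod_eq_zero_iff]
  simp only [Finset.mem_univ, true_and, sub_eq_zero]
  exact exists_congr fun n => ⟨fun hn => by rw [hn], fun hn => (hinj hn).symm⟩

open Classical in
/-- The number of distinct values of a family of eigenphases. -/
def numPhases (θ : Fin (2 * Fintype.card E) → AddCircle (2 * π)) : ℕ := (Finset.univ.image θ).card

theorem IsEigensystem.numPhases_eq {κ : Torus E}
    {θ θ' : Fin (2 * Fintype.card E) → AddCircle (2 * π)}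
    {a a' : OrthonormalBasis (Fin (2 * Fintype.card E)) ℂ (EuclideanSpace ℂ (E ⊕ E))}
    (h : G.IsEigensystem κ θ a) (h' : G.IsEigensystem κ θ' a') : numPhases θ = numPhases θ' := by
  classical
  unfold numPhases
  congr 1
  ext t
  simp only [Finset.mem_image, Finset.mem_univ, true_and]
  rw [h.mem_range_iff, h'.mem_range_iff]

theorem tendsto_mulVec {M : ℕ → Matrix (E ⊕ E) (E ⊕ E) ℂ} {M₀ : Matrix (E ⊕ E) (E ⊕ E) ℂ}
    {v : ℕ → E ⊕ E → ℂ} {v₀ : E ⊕ E → ℂ} (hM : Tendsto M atTop (𝓝 M₀))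
    (hv : Tendsto v atTop (𝓝 v₀)) : Tendsto (fun k => M k *ᵥ v k) atTop (𝓝 (M₀ *ᵥ v₀)) := by
  refine tendsto_pi_nhds.mpr fun i => tendsto_finsetSum _ fun j _ => Tendsto.mul ?_ ?_
  · exact tendsto_pi_nhds.mp (tendsto_pi_nhds.mp hM i) j
  · exact tendsto_pi_nhds.mp hv j

theorem continuous_toCircle_coe : Continuous fun t : AddCircle (2 * π) => (t.toCircle : ℂ) :=
  continuous_subtype_val.comp AddCircle.continuous_toCircle

/-- Eigensystems along a convergent sequence subconverge to an eigensystem of the limit. -/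
theorem exists_subseq_eigensystem {θ : ℕ → Fin (2 * Fintype.card E) → AddCircle (2 * π)}
    {a : ℕ → OrthonormalBasis (Fin (2 * Fintype.card E)) ℂ (EuclideanSpace ℂ (E ⊕ E))}
    {x : ℕ → Torus E} {x₀ : Torus E} (h : ∀ k, G.IsEigensystem (x k) (θ k) (a k))
    (hx : Tendsto x atTop (𝓝 x₀)) :
    ∃ (ψ : ℕ → ℕ) (θ₀ : Fin (2 * Fintype.card E) → AddCircle (2 * π))
      (a₀ : OrthonormalBasis (Fin (2 * Fintype.card E)) ℂ (EuclideanSpace ℂ (E ⊕ E))),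
      StrictMono ψ ∧ G.IsEigensystem x₀ θ₀ a₀ ∧
      (∀ n, Tendsto (fun k => θ (ψ k) n) atTop (𝓝 (θ₀ n))) ∧
      ∀ n, Tendsto (fun k => a (ψ k) n) atTop (𝓝 (a₀ n)) := by
  have hcpt : IsCompact ((Set.univ : Set (Fin (2 * Fintype.card E) → AddCircle (2 * π))) ×ˢ
      Set.pi Set.univ fun _ : Fin (2 * Fintype.card E) =>
        Metric.closedBall (0 : EuclideanSpace ℂ (E ⊕ E)) 1) :=
    isCompact_univ.prod (isCompact_univ_pi fun _ => isCompact_closedBall _ _)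
  obtain ⟨⟨θ₀, b⟩, -, ψ, hψ, hlim⟩ := hcpt.tendsto_subseq
    (x := fun k => (θ k, fun n => a k n)) (fun k => by
      refine ⟨trivial, fun n _ => ?_⟩
      simp [(a k).orthonormal.1 n])
  have hθ : ∀ n, Tendsto (fun k => θ (ψ k) n) atTop (𝓝 (θ₀ n)) :=
    tendsto_pi_nhds.mp ((continuous_fst.tendsto _).comp hlim)
  have hb : ∀ n, Tendsto (fun k => a (ψ k) n) atTop (𝓝 (b n)) :=
    tendsto_pi_nhds.mp ((continuous_snd.tendsto _).comp hlim)
  have hon : Orthonormal ℂ b := by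
    rw [orthonormal_iff_ite]
    intro n m
    refine tendsto_nhds_unique ((hb n).inner (hb m)) ?_
    simp only [orthonormal_iff_ite.mp (a _).orthonormal n m]
    exact tendsto_const_nhds
  obtain ⟨a₀, ha₀⟩ : ∃ a₀ : OrthonormalBasis (Fin (2 * Fintype.card E)) ℂ
      (EuclideanSpace ℂ (E ⊕ E)), ∀ n, a₀ n = b n :=
    ⟨OrthonormalBasis.mk hon
      (hon.linearIndependent.span_eq_top_of_card_eq_finrank' (by simp [two_mul])).ge,
      fun n => by simp⟩
  refine ⟨ψ, θ₀, a₀, hψ, fun n => ?_, hθ, fun n => by rw [ha₀]; exact hb n⟩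
  rw [ha₀]
  have hb' : Tendsto (fun k => (a (ψ k) n).ofLp) atTop (𝓝 (b n).ofLp) :=
    ((PiLp.continuous_ofLp 2 _).tendsto _).comp (hb n)
  have h1 : Tendsto (fun k => G.evolution (x (ψ k)) *ᵥ (a (ψ k) n).ofLp) atTop
      (𝓝 (G.evolution x₀ *ᵥ (b n).ofLp)) :=
    tendsto_mulVec ((continuous_evolution.tendsto _).comp (hx.comp hψ.tendsto_atTop)) hb'
  have h2 : Tendsto (fun k => ((θ (ψ k) n).toCircle : ℂ)) atTop (𝓝 ((θ₀ n).toCircle : ℂ)) :=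
    (continuous_toCircle_coe.tendsto _).comp (hθ n)
  exact tendsto_nhds_unique h1 ((h2.smul hb').congr fun k => (h (ψ k) n).symm)

theorem eventually_ne_of_tendsto {θ : ℕ → Fin (2 * Fintype.card E) → AddCircle (2 * π)}
    {θ₀ : Fin (2 * Fintype.card E) → AddCircle (2 * π)}
    (hθ : ∀ n, Tendsto (fun k => θ k n) atTop (𝓝 (θ₀ n))) :
    ∀ᶠ k in atTop, ∀ n m, θ₀ n ≠ θ₀ m → θ k n ≠ θ k m := by
  rw [eventually_all]
  intro n
  rw [eventually_all]
  intro m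
  by_cases h : θ₀ n = θ₀ m
  · simp [h]
  · filter_upwards [((hθ n).sub (hθ m)).eventually_ne (sub_ne_zero.mpr h)] with k hk _
    exact sub_ne_zero.mp hk

theorem IsEigensystem.conjTranspose_mul_evolution {κ : Torus E}
    {θ : Fin (2 * Fintype.card E) → AddCircle (2 * π)}
    {a : OrthonormalBasis (Fin (2 * Fintype.card E)) ℂ (EuclideanSpace ℂ (E ⊕ E))}
    (h : G.IsEigensystem κ θ a) : (G.evolution κ)ᴴ * G.evolution κ = 1 := by
  have h1 : (G.evolution κ)ᴴ = (of fun j n => a n j) *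
      diagonal (fun n => star ((θ n).toCircle : ℂ)) * (of fun j n => a n j)ᴴ := by
    rw [h.evolution_eq, conjTranspose_mul, conjTranspose_mul, conjTranspose_conjTranspose,
      diagonal_conjTranspose, Matrix.mul_assoc]
    rfl
  rw [h1, h.evolution_eq, conj_diagonal_mul]
  have : (fun n => star ((θ n).toCircle : ℂ) * ((θ n).toCircle : ℂ)) = fun _ => 1 := by
    ext n
    rw [mul_comm]
    exact toCircle_mul_conj _
  rw [this, diagonal_one, Matrix.mul_one, mul_conjTranspose_self]

/-- By unitarity `b` is also an eigenvector of the adjoint, with the conjugate eigenvalue. So `b^*`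
is a left eigenvector and may be paired with vectors that are not eigenvectors. -/
theorem IsEigensystem.star_dotProduct_evolution_mulVec {κ : Torus E}
    {θ : Fin (2 * Fintype.card E) → AddCircle (2 * π)}
    {a : OrthonormalBasis (Fin (2 * Fintype.card E)) ℂ (EuclideanSpace ℂ (E ⊕ E))}
    (h : G.IsEigensystem κ θ a) {t : AddCircle (2 * π)} {b : E ⊕ E → ℂ}
    (hb : G.evolution κ *ᵥ b = (t.toCircle : ℂ) • b) (w : E ⊕ E → ℂ) :
    star b ⬝ᵥ (G.evolution κ *ᵥ w) = (t.toCircle : ℂ) * (star b ⬝ᵥ w) := by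
  have h1 : (G.evolution κ)ᴴ *ᵥ b = star (t.toCircle : ℂ) • b := by
    have h2 := congrArg (fun v => (G.evolution κ)ᴴ *ᵥ v) hb
    simp only [mulVec_mulVec, h.conjTranspose_mul_evolution, one_mulVec, mulVec_smul] at h2
    conv_rhs => rw [h2]
    rw [smul_smul, mul_comm, show (t.toCircle : ℂ) * star (t.toCircle : ℂ) = 1 from
      toCircle_mul_conj t, one_smul]
  have h3 : star b ᵥ* G.evolution κ = star ((G.evolution κ)ᴴ *ᵥ b) := by
    rw [mulVec_conjTranspose, star_star]
  rw [dotProduct_mulVec, h3, h1, star_smul, star_star, smul_dotProduct, smul_eq_mul]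

end QGraph

/-! ### First-order perturbation and generic simplicity of the spectrum -/

namespace QGraph

open Filter Topology ComplexConjugate

variable {V E : Type*} {G : QGraph V E} [DecidableEq V] [Fintype E] [DecidableEq E]

/-- Moving one coordinate multiplies the two corresponding rows by a common phase. The formula is
exact, so the perturbation argument has no remainder to estimate. -/
theorem evolution_add_single (κ : Torus E) (e : E) (s : AddCircle (2 * π)) :
    G.evolution (κ + Pi.single e s) =
      G.evolution κ + ((s.toCircle : ℂ) - 1) • (edgeProj e * G.evolution κ) := by
  have key : ∀ e', (((κ + Pi.single e s : Torus E) e').toCircle : ℂ) =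
      (1 + ((s.toCircle : ℂ) - 1) * (Pi.single e 1 : E → ℂ) e') * ((κ e').toCircle : ℂ) := by
    intro e'
    by_cases h : e' = e
    · subst h
      rw [Pi.add_apply, Pi.single_eq_same, Pi.single_eq_same, AddCircle.toCircle_add]
      push_cast
      ring
    · simp [h]
  ext i j
  rcases i with i | i <;>
  · simp only [evolution, edgeProj, Matrix.add_apply, Matrix.smul_apply, diagonal_mul,
      Sum.elim_inl, Sum.elim_inr, key, smul_eq_mul]
    ring

theorem star_dotProduct_edgeProj_mulVec (a b : E ⊕ E → ℂ) (e : E) :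
    star a ⬝ᵥ (edgeProj e *ᵥ b) =
      conj (a (.inl e)) * b (.inl e) + conj (a (.inr e)) * b (.inr e) := by
  simp [edgeProj, mulVec_diagonal, dotProduct, Fintype.sum_sum_type, Pi.single_apply]

/-- Where the number of distinct eigenphases is maximal, the edge projections compress to scalars on
each eigenspace. -/
theorem exists_compression_scalar {θ : Torus E → Fin (2 * Fintype.card E) → AddCircle (2 * π)}
    {a : Torus E → OrthonormalBasis (Fin (2 * Fintype.card E)) ℂ (EuclideanSpace ℂ (E ⊕ E))}
    (hθa : ∀ κ, G.IsEigensystem κ (θ κ) (a κ)) {x : Torus E}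
    (hmax : ∀ y, numPhases (θ y) ≤ numPhases (θ x)) (n : Fin (2 * Fintype.card E)) (e : E) :
    ∃ c : ℂ, ∀ b b' : E ⊕ E → ℂ, G.evolution x *ᵥ b = ((θ x n).toCircle : ℂ) • b →
      G.evolution x *ᵥ b' = ((θ x n).toCircle : ℂ) • b' →
      conj (b (.inl e)) * b' (.inl e) + conj (b (.inr e)) * b' (.inr e) =
        c * ∑ j, conj (b j) * b' j := by
  classical
  set t := θ x n with ht
  -- The shifts lie in `(0, 1]`, inside one period, so their circle values differ from `1` and the
  -- difference quotients below are defined.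
  let s : ℕ → ℝ := fun k => 1 / ((k : ℝ) + 1)
  let s' : ℕ → AddCircle (2 * π) := fun k => (s k : AddCircle (2 * π))
  have hs0 : Tendsto s atTop (𝓝 0) := tendsto_one_div_add_atTop_nhds_zero_nat
  have hs1 : ∀ k, ((s' k).toCircle : ℂ) - 1 ≠ 0 := by
    intro k h
    have h0 : 0 < s k := by positivity
    have h1 : s k ≤ 1 := by
      rw [div_le_one (by positivity)]
      linarith [(Nat.cast_nonneg k : (0 : ℝ) ≤ k)]
    have h2 := (toCircle_eq_one_iff _).mp (sub_eq_zero.mp h)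
    rw [AddCircle.coe_eq_zero_iff] at h2
    obtain ⟨m, hm⟩ := h2
    have hpi := Real.pi_gt_three
    rw [zsmul_eq_mul] at hm
    have hm0 : (0 : ℝ) < m := by
      by_contra hcon
      push Not at hcon
      nlinarith
    have hm1 : (1 : ℝ) ≤ m := by exact_mod_cast (by exact_mod_cast hm0 : (0 : ℤ) < m)
    nlinarith
  let y : ℕ → Torus E := fun k => x + Pi.single e (s' k)
  have hy : Tendsto y atTop (𝓝 x) := by
    have h1 : Tendsto s' atTop (𝓝 0) :=
      ((AddCircle.continuous_mk' (2 * π)).tendsto 0).comp hs0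
    have h2 : Continuous fun r : AddCircle (2 * π) => x + (Pi.single e r : Torus E) :=
      continuous_const.add (continuous_single (A := fun _ : E => AddCircle (2 * π)) e)
    have := (h2.tendsto 0).comp h1
    rwa [Pi.single_zero, add_zero] at this
  obtain ⟨ψ, θ₀, a₀, hψ, hsys, hθ, ha⟩ := exists_subseq_eigensystem (fun k => hθa (y k)) hy
  have hnum : numPhases θ₀ = numPhases (θ x) := hsys.numPhases_eq (hθa x)
  -- Distinct limiting eigenphases stay distinct nearby, and maximality leaves no room for more:
  -- eigenphases with a common limit already coincide.
  have hpat : ∀ᶠ k in atTop, ∀ n m, θ₀ n = θ₀ m → θ (y (ψ k)) n = θ (y (ψ k)) m := by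
    filter_upwards [eventually_ne_of_tendsto hθ] with k hk n m hnm
    refine eq_of_eq_of_card_image_le hk ?_ hnm
    have := hmax (y (ψ k))
    rw [← hnum] at this
    unfold numPhases at this
    convert this
  obtain ⟨n₀, hn₀⟩ : ∃ n₀, θ₀ n₀ = t := by
    rw [hsys.mem_range_iff, ← (hθa x).mem_range_iff]
    exact ⟨n, rfl⟩
  -- eigenvectors of the limit are limits of eigenvectors
  have happrox : ∀ b : E ⊕ E → ℂ, G.evolution x *ᵥ b = (t.toCircle : ℂ) • b →
      ∃ b' : ℕ → E ⊕ E → ℂ, Tendsto b' atTop (𝓝 b) ∧ ∀ᶠ k in atTop,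
        G.evolution (y (ψ k)) *ᵥ b' k = ((θ (y (ψ k)) n₀).toCircle : ℂ) • b' k := by
    intro b hb
    let r : Fin (2 * Fintype.card E) → ℂ := fun n => inner ℂ (a₀ n) (WithLp.toLp 2 b)
    have hr : ∀ n, θ₀ n ≠ t → r n = 0 := by
      intro n hn
      have hrn : r n = star (a₀ n).ofLp ⬝ᵥ b := by
        rw [dotProduct_comm]
        exact EuclideanSpace.inner_eq_star_dotProduct _ _
      have h1 := hsys.star_dotProduct_evolution_mulVec (hsys n) b
      rw [hb, dotProduct_smul, ← hrn, smul_eq_mul] at h1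
      have h2 : ((t.toCircle : ℂ) - ((θ₀ n).toCircle : ℂ)) * r n = 0 := by
        rw [sub_mul, h1, sub_self]
      refine (mul_eq_zero.mp h2).resolve_left fun h3 => hn ?_
      exact (Circle.coe_injective.comp
        (AddCircle.injective_toCircle (T := 2 * π) Real.two_pi_pos.ne') (sub_eq_zero.mp h3)).symm
    refine ⟨fun k => ∑ n, r n • (a (y (ψ k)) n).ofLp, ?_, ?_⟩
    · have hsum : b = ∑ n, r n • (a₀ n).ofLp := by
        have := congrArg WithLp.ofLp (a₀.sum_repr' (WithLp.toLp 2 b))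
        simpa [r] using this.symm
      conv => rhs; rw [hsum]
      refine tendsto_finsetSum _ fun n _ => tendsto_const_nhds.smul ?_
      exact ((PiLp.continuous_ofLp 2 _).tendsto _).comp (ha n)
    · filter_upwards [hpat] with k hk
      rw [mulVec_sum, Finset.smul_sum]
      refine Finset.sum_congr rfl fun n _ => ?_
      by_cases hn : θ₀ n = t
      · rw [mulVec_smul, hθa (y (ψ k)) n, hk n n₀ (hn.trans hn₀.symm), smul_comm]
      · rw [hr n hn]
        simp
  let ρ : ℕ → ℂ := fun k => (((θ (y (ψ k)) n₀).toCircle : ℂ) - (t.toCircle : ℂ)) /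
    (((s' (ψ k)).toCircle : ℂ) - 1)
  -- Pair the perturbed eigenvalue equation of `w` with the unperturbed left eigenvector `b^*`. The
  -- quotient `ρ k` is the same for all `b` and `w`, because the whole eigenspace moves with one
  -- eigenphase.
  have hpert : ∀ (b : E ⊕ E → ℂ) (w : E ⊕ E → ℂ) (k : ℕ),
      G.evolution x *ᵥ b = (t.toCircle : ℂ) • b →
      G.evolution (y (ψ k)) *ᵥ w = ((θ (y (ψ k)) n₀).toCircle : ℂ) • w →
      star b ⬝ᵥ (edgeProj e *ᵥ (G.evolution x *ᵥ w)) = ρ k * (star b ⬝ᵥ w) := by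
    intro b w k hb hw
    rw [evolution_add_single, add_mulVec, smul_mulVec] at hw
    have h1 := congrArg (fun v => star b ⬝ᵥ v) hw
    simp only [dotProduct_add, dotProduct_smul, smul_eq_mul] at h1
    rw [(hθa x).star_dotProduct_evolution_mulVec hb] at h1
    rw [mulVec_mulVec]
    have h2 := hs1 (ψ k)
    simp only [ρ]
    rw [div_mul_eq_mul_div, eq_div_iff h2]
    linear_combination h1
  have hdot : ∀ (b : E ⊕ E → ℂ) (w : ℕ → E ⊕ E → ℂ) (w₀ : E ⊕ E → ℂ),
      Tendsto w atTop (𝓝 w₀) → Tendsto (fun k => star b ⬝ᵥ w k) atTop (𝓝 (star b ⬝ᵥ w₀)) := by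
    intro b w w₀ hw
    exact tendsto_finsetSum _ fun j _ => tendsto_const_nhds.mul (tendsto_pi_nhds.mp hw j)
  have hdot' : ∀ (b : E ⊕ E → ℂ) (w : ℕ → E ⊕ E → ℂ) (w₀ : E ⊕ E → ℂ),
      Tendsto w atTop (𝓝 w₀) →
      Tendsto (fun k => star b ⬝ᵥ (edgeProj e *ᵥ (G.evolution x *ᵥ w k))) atTop
        (𝓝 (star b ⬝ᵥ (edgeProj e *ᵥ (G.evolution x *ᵥ w₀)))) := by
    intro b w w₀ hw
    exact hdot b _ _ (tendsto_mulVec tendsto_const_nhds (tendsto_mulVec tendsto_const_nhds hw))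
  -- Differentiability of the eigenphase is not presupposed: testing with one unit eigenvector,
  -- whose pairing with its approximants tends to `1`, shows that the quotients converge.
  obtain ⟨ρ₀, hρ⟩ : ∃ ρ₀, Tendsto ρ atTop (𝓝 ρ₀) := by
    have hv : G.evolution x *ᵥ (a₀ n₀).ofLp = (t.toCircle : ℂ) • (a₀ n₀).ofLp := by
      rw [← hn₀]; exact hsys n₀
    obtain ⟨w, hw, hw'⟩ := happrox _ hv
    have h1 : star (a₀ n₀).ofLp ⬝ᵥ (a₀ n₀).ofLp = 1 := by
      have := orthonormal_iff_ite.mp a₀.orthonormal n₀ n₀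
      rw [EuclideanSpace.inner_eq_star_dotProduct, dotProduct_comm] at this
      simpa using this
    have h2 := hdot (a₀ n₀).ofLp w _ hw
    rw [h1] at h2
    refine ⟨_, ((hdot' (a₀ n₀).ofLp w _ hw).div h2 one_ne_zero).congr' ?_⟩
    filter_upwards [hw', h2.eventually_ne one_ne_zero] with k hk hk'
    rw [Pi.div_apply, hpert _ _ k hv hk, mul_div_cancel_right₀ _ hk']
  -- The limit concerns `P_e U`; on the eigenspace `U` is multiplication by the unimodular number
  -- `t.toCircle`, and its conjugate removes it.
  refine ⟨conj (t.toCircle : ℂ) * ρ₀, fun b b' hb hb' => ?_⟩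
  obtain ⟨w, hw, hw'⟩ := happrox b' hb'
  have h1 : star b ⬝ᵥ (edgeProj e *ᵥ (G.evolution x *ᵥ b')) = ρ₀ * (star b ⬝ᵥ b') := by
    refine tendsto_nhds_unique (hdot' b w _ hw) ((hρ.mul (hdot b w _ hw)).congr' ?_)
    filter_upwards [hw'] with k hk
    rw [hpert _ _ k hb hk]
  rw [hb', mulVec_smul, dotProduct_smul, star_dotProduct_edgeProj_mulVec, smul_eq_mul] at h1
  have h3 : star b ⬝ᵥ b' = ∑ j, conj (b j) * b' j := rfl
  rw [h3] at h1
  linear_combination conj (t.toCircle : ℂ) * h1 -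
    (conj (b (.inl e)) * b' (.inl e) + conj (b (.inr e)) * b' (.inr e)) * toCircle_mul_conj t

/-- The number of distinct eigenphases is lower semicontinuous. -/
theorem eventually_numPhases_le {θ : Torus E → Fin (2 * Fintype.card E) → AddCircle (2 * π)}
    {a : Torus E → OrthonormalBasis (Fin (2 * Fintype.card E)) ℂ (EuclideanSpace ℂ (E ⊕ E))}
    (hθa : ∀ κ, G.IsEigensystem κ (θ κ) (a κ)) (x : Torus E) :
    ∀ᶠ y in 𝓝 x, numPhases (θ x) ≤ numPhases (θ y) := by
  classical
  by_contra hcon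
  obtain ⟨y, hy, hlt⟩ := exists_seq_forall_of_frequently (not_eventually.mp hcon)
  obtain ⟨ψ, θ₀, a₀, hψ, hsys, hθ, -⟩ := exists_subseq_eigensystem (fun k => hθa (y k)) hy
  obtain ⟨k, hk⟩ := (eventually_ne_of_tendsto hθ).exists
  apply hlt (ψ k)
  rw [← hsys.numPhases_eq (hθa x)]
  have hfac : Function.FactorsThrough θ₀ (θ (y (ψ k))) := fun n m hnm => by
    by_contra hne
    exact hk n m hne hnm
  have himg : Finset.univ.image θ₀ = (Finset.univ.image (θ (y (ψ k)))).image
      (Function.extend (θ (y (ψ k))) θ₀ id) := by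
    rw [Finset.image_image, hfac.extend_comp id]
  unfold numPhases
  convert (congrArg Finset.card himg).trans_le Finset.card_image_le

/-- For a generic point of the torus all eigenphases are simple. -/
theorem ae_injective_phases [Fintype V] (hG : G.IsAdmissible)
    {θ : Torus E → Fin (2 * Fintype.card E) → AddCircle (2 * π)}
    {a : Torus E → OrthonormalBasis (Fin (2 * Fintype.card E)) ℂ (EuclideanSpace ℂ (E ⊕ E))}
    (hθa : ∀ κ, G.IsEigensystem κ (θ κ) (a κ)) : ∀ᵐ κ, Function.Injective (θ κ) := by
  classical
  obtain ⟨κ₁, hκ₁⟩ : ∃ κ, Function.Injective (θ κ) := by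
    obtain ⟨κ₀, hκ₀⟩ : ∃ κ₀, ∀ y, numPhases (θ y) ≤ numPhases (θ κ₀) := by
      have hfin : (Set.range fun κ => numPhases (θ κ)).Finite := by
        refine (Set.finite_Iic (2 * Fintype.card E)).subset ?_
        rintro _ ⟨κ, rfl⟩
        exact Finset.card_image_le.trans (by simp)
      obtain ⟨_, ⟨κ₀, rfl⟩, h⟩ := Set.exists_max_image _ id hfin ⟨_, 0, rfl⟩
      exact ⟨κ₀, fun y => h _ ⟨y, rfl⟩⟩
    -- By lower semicontinuity, the points with the maximal number of eigenphases contain an open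
    -- neighbourhood of `κ₀`, which a point without integer relations must meet.
    have hdense := Measure.dense_of_ae (ae_no_integer_relation (E := E))
    obtain ⟨κ₁, hgen, hκ₁⟩ := hdense.exists_mem_open isOpen_interior
      ⟨κ₀, mem_interior_iff_mem_nhds.mpr (eventually_numPhases_le hθa κ₀)⟩
    have hmax : ∀ y, numPhases (θ y) ≤ numPhases (θ κ₁) := fun y => by
      have := interior_subset hκ₁
      exact (hκ₀ y).trans this
    refine ⟨κ₁, fun n m hnm => ?_⟩
    by_contra hne
    choose c hc using fun e => exists_compression_scalar hθa hmax n e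
    have h₂ : G.evolution κ₁ *ᵥ (a κ₁ m).ofLp = ((θ κ₁ n).toCircle : ℂ) • (a κ₁ m).ofLp := by
      rw [hnm]; exact hθa κ₁ m
    have hind : ∀ x y : ℂ, x • (a κ₁ n).ofLp + y • (a κ₁ m).ofLp = 0 → x = 0 ∧ y = 0 := by
      intro x y hxy
      have hxy' : x • a κ₁ n + y • a κ₁ m = 0 := by
        ext j
        simpa using congrFun hxy j
      have hon := orthonormal_iff_ite.mp (a κ₁).orthonormal
      have h1 := congrArg (fun v => inner ℂ (a κ₁ n) v) hxy'
      have h2 := congrArg (fun v => inner ℂ (a κ₁ m) v) hxy'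
      simp only [inner_add_right, inner_smul_right, hon, inner_zero_right] at h1 h2
      exact ⟨by simpa [hne] using h1, by simpa [Ne.symm hne] using h2⟩
    obtain ⟨F, hF, hF'⟩ := exists_travelling_wave hG (hθa κ₁ n) h₂ hind
      (fun b b' hb hb' e => hc e b b' hb hb')
    obtain ⟨m, hm0, hm⟩ := exists_integer_relation hG hF hF'
    exact hgen m hm0 hm
  obtain ⟨x₁, rfl⟩ := exists_mk_eq κ₁
  have hae : ∀ᵐ κ : Torus E, G.discr κ ≠ 0 := by
    refine Torus.ae_of_ae_mk
      (isClosed_singleton.preimage continuous_discr).measurableSet.compl ?_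
    exact ae_ne_zero_of_analyticOnNhd analyticOnNhd_discr_mk
      ((hθa (Torus.mk x₁)).discr_ne_zero_iff.mpr hκ₁)
  filter_upwards [hae] with κ hκ
  exact (hθa κ).discr_ne_zero_iff.mp hκ

end QGraph

/-! ### Spectral measures as a kernel, and their flux onto `Σ` -/

namespace QGraph

open Filter Topology ProbabilityTheory

variable {V E : Type*} {G : QGraph V E} [DecidableEq V] [Fintype E] [DecidableEq E]

/-- The spectral measure of `U_κ` on the circle of eigenphases, with weights `a_n^* diag(q, q) a_n`. -/
def phaseMeasure (θ : Torus E → Fin (2 * Fintype.card E) → AddCircle (2 * π))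
    (a : Torus E → OrthonormalBasis (Fin (2 * Fintype.card E)) ℂ (EuclideanSpace ℂ (E ⊕ E)))
    (q : E → ℝ) (κ : Torus E) : Measure (AddCircle (2 * π)) :=
  ∑ n, ENNReal.ofReal (∑ e, q e * edgeMass (a κ n) e) • Measure.dirac (θ κ n)

section Kernel

variable {θ : Torus E → Fin (2 * Fintype.card E) → AddCircle (2 * π)}
  {a : Torus E → OrthonormalBasis (Fin (2 * Fintype.card E)) ℂ (EuclideanSpace ℂ (E ⊕ E))}

theorem lintegral_phaseMeasure (q : E → ℝ) (κ : Torus E) {f : AddCircle (2 * π) → ℝ≥0∞}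
    (hf : Measurable f) : ∫⁻ t, f t ∂phaseMeasure θ a q κ =
      ∑ n, ENNReal.ofReal (∑ e, q e * edgeMass (a κ n) e) * f (θ κ n) := by
  rw [phaseMeasure, lintegral_finsetSum_measure]
  refine Finset.sum_congr rfl fun n _ => ?_
  rw [lintegral_smul_measure, lintegral_dirac' _ hf, smul_eq_mul]

theorem integral_phaseMeasure {q : E → ℝ} (hq : ∀ e, 0 ≤ q e) (κ : Torus E)
    (f : AddCircle (2 * π) → ℂ) : ∫ t, f t ∂phaseMeasure θ a q κ =
      ∑ n, f (θ κ n) * ((∑ e, q e * edgeMass (a κ n) e : ℝ) : ℂ) := by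
  rw [phaseMeasure, integral_finsetSum_measure]
  · refine Finset.sum_congr rfl fun n _ => ?_
    rw [integral_smul_measure, integral_dirac, ENNReal.toReal_ofReal, Complex.real_smul, mul_comm]
    exact Finset.sum_nonneg fun e _ => mul_nonneg (hq e) (edgeMass_nonneg _ _)
  · intro n _
    exact (integrable_dirac (by simp)).smul_measure ENNReal.ofReal_ne_top

/-- For `k ≥ 0` the sum is a combination of the traces of `U_κ^k P_e`, which are continuous in `κ`
whatever the choice of eigenbasis; negative `k` follow by conjugation. -/
theorem measurable_sum_fourier (hθa : ∀ κ, G.IsEigensystem κ (θ κ) (a κ)) (q : E → ℝ) (k : ℤ) :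
    Measurable fun κ => ∑ n, (fourier k (θ κ n) : ℂ) * ((∑ e, q e * edgeMass (a κ n) e : ℝ) : ℂ) := by
  have hnat : ∀ k : ℕ, Measurable fun κ => ∑ n, ((θ κ n).toCircle : ℂ) ^ k *
      ((∑ e, q e * edgeMass (a κ n) e : ℝ) : ℂ) := by
    intro k
    have h1 : (fun κ => ∑ n, ((θ κ n).toCircle : ℂ) ^ k *
        ((∑ e, q e * edgeMass (a κ n) e : ℝ) : ℂ)) =
        fun κ => ∑ e, (q e : ℂ) * (G.evolution κ ^ k * edgeProj e).trace := by
      ext κ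
      simp_rw [(hθa κ).trace_evolution_pow_mul_edgeProj, Finset.mul_sum]
      push_cast
      simp_rw [Finset.mul_sum]
      rw [Finset.sum_comm]
      exact Finset.sum_congr rfl fun e _ => Finset.sum_congr rfl fun n _ => by ring
    rw [h1]
    refine Continuous.measurable (continuous_finsetSum _ fun e _ => continuous_const.mul ?_)
    exact ((continuous_evolution.pow k).matrix_mul continuous_const).matrix_trace
  obtain ⟨m, rfl | rfl⟩ := k.eq_nat_or_neg
  · simpa [fourier_apply, AddCircle.toCircle_nsmul] using hnat m
  · have := (Complex.continuous_conj.measurable).comp (hnat m)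
    convert this using 1
    ext κ
    rw [Function.comp_apply, map_sum]
    refine Finset.sum_congr rfl fun n _ => ?_
    rw [map_mul, Complex.conj_ofReal, fourier_neg, fourier_apply, natCast_zsmul,
      AddCircle.toCircle_nsmul]
    simp

/-- Trigonometric polynomials are uniformly dense, and measurability survives pointwise limits. -/
theorem measurable_sum_continuous (hθa : ∀ κ, G.IsEigensystem κ (θ κ) (a κ)) (q : E → ℝ)
    (g : C(AddCircle (2 * π), ℂ)) :
    Measurable fun κ => ∑ n, g (θ κ n) * ((∑ e, q e * edgeMass (a κ n) e : ℝ) : ℂ) := by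
  let M : Submodule ℂ C(AddCircle (2 * π), ℂ) :=
    { carrier := {g | Measurable fun κ => ∑ n, g (θ κ n) *
        ((∑ e, q e * edgeMass (a κ n) e : ℝ) : ℂ)}
      add_mem' := by
        intro f g hf hg
        have := Measurable.add (f := fun κ => ∑ n, f (θ κ n) *
          ((∑ e, q e * edgeMass (a κ n) e : ℝ) : ℂ)) hf hg
        rw [Set.mem_ofPred_eq]
        convert this using 1
        ext κ
        simp [add_mul, Finset.sum_add_distrib]
      zero_mem' := by simp
      smul_mem' := by
        intro c f hf
        simpa [mul_assoc, Finset.mul_sum] using Measurable.const_mul hf c }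
  have hspan : Submodule.span ℂ (Set.range (@fourier (2 * π))) ≤ M := by
    rw [Submodule.span_le]
    rintro _ ⟨k, rfl⟩
    exact measurable_sum_fourier hθa q k
  have hg : g ∈ (Submodule.span ℂ (Set.range (@fourier (2 * π)))).topologicalClosure := by
    rw [span_fourier_closure_eq_top]
    trivial
  obtain ⟨u, hu, hlim⟩ := mem_closure_iff_seq_limit.mp hg
  refine measurable_of_tendsto_metrizable (fun k => hspan (hu k)) ?_
  rw [tendsto_pi_nhds]
  intro κ
  refine tendsto_finsetSum _ fun n _ => Tendsto.mul ?_ tendsto_const_nhds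
  exact ((continuous_eval_const (θ κ n)).tendsto g).comp hlim

theorem measurable_phaseMeasure_isClosed (hθa : ∀ κ, G.IsEigensystem κ (θ κ) (a κ)) {q : E → ℝ}
    (hq : ∀ e, 0 ≤ q e) {A : Set (AddCircle (2 * π))} (hA : IsClosed A) :
    Measurable fun κ => phaseMeasure θ a q κ A := by
  let δ : ℕ → ℝ := fun k => 1 / ((k : ℝ) + 1)
  have hδ : ∀ k, 0 < δ k := fun k => by positivity
  have hδ0 : Tendsto δ atTop (𝓝 0) := tendsto_one_div_add_atTop_nhds_zero_nat
  let g : ℕ → C(AddCircle (2 * π), ℂ) := fun k =>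
    ⟨fun t => (((thickenedIndicator (hδ k) A t : NNReal) : ℝ) : ℂ), by fun_prop⟩
  have h1 : ∀ k, Measurable fun κ => ENNReal.ofReal (∑ n, g k (θ κ n) *
      ((∑ e, q e * edgeMass (a κ n) e : ℝ) : ℂ)).re := fun k =>
    (Complex.measurable_re.comp (measurable_sum_continuous hθa q (g k))).ennreal_ofReal
  refine measurable_of_tendsto_metrizable h1 ?_
  rw [tendsto_pi_nhds]
  intro κ
  have hlim := thickenedIndicator_tendsto_indicator_closure hδ hδ0 A
  rw [hA.closure_eq, tendsto_pi_nhds] at hlim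
  have h2 : phaseMeasure θ a q κ A = ENNReal.ofReal (∑ n, ((A.indicator (fun _ => 1) (θ κ n) :
      NNReal) : ℝ) * ∑ e, q e * edgeMass (a κ n) e) := by
    rw [← lintegral_indicator_one hA.measurableSet, lintegral_phaseMeasure _ _
      (measurable_one.indicator hA.measurableSet), ENNReal.ofReal_sum_of_nonneg]
    · refine Finset.sum_congr rfl fun n _ => ?_
      by_cases hn : θ κ n ∈ A <;> simp [hn]
    · intro n _
      exact mul_nonneg (NNReal.coe_nonneg _)
        (Finset.sum_nonneg fun e _ => mul_nonneg (hq e) (edgeMass_nonneg _ _))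
  rw [h2]
  refine (ENNReal.continuous_ofReal.tendsto _).comp ?_
  have h3 : ∀ k, (∑ n, g k (θ κ n) * ((∑ e, q e * edgeMass (a κ n) e : ℝ) : ℂ)).re =
      ∑ n, ((thickenedIndicator (hδ k) A (θ κ n) : NNReal) : ℝ) *
        ∑ e, q e * edgeMass (a κ n) e := by
    intro k
    rw [Complex.re_sum]
    refine Finset.sum_congr rfl fun n _ => ?_
    simp only [g, ContinuousMap.coe_mk, ← Complex.ofReal_mul, Complex.ofReal_re]
  simp_rw [h3]
  refine tendsto_finsetSum _ fun n _ => Tendsto.mul ?_ tendsto_const_nhds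
  exact (NNReal.continuous_coe.tendsto _).comp (hlim (θ κ n))

/-- Each `P_e` has trace two, so the total mass does not depend on `κ`. This yields a finite kernel
and supplies the total-mass condition of the π-system argument from closed sets. -/
theorem phaseMeasure_univ {q : E → ℝ} (hq : ∀ e, 0 ≤ q e) (κ : Torus E) :
    phaseMeasure θ a q κ Set.univ = ENNReal.ofReal (2 * ∑ e, q e) := by
  have h := lintegral_phaseMeasure (θ := θ) (a := a) q κ (f := 1) measurable_one
  simp only [Pi.one_apply, lintegral_one, mul_one] at h
  rw [h, ← ENNReal.ofReal_sum_of_nonneg, Finset.sum_comm]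
  · simp_rw [← Finset.mul_sum, IsEigensystem.sum_edgeMass_eq_two, ← Finset.sum_mul]
    rw [mul_comm]
  · intro n _
    exact Finset.sum_nonneg fun e _ => mul_nonneg (hq e) (edgeMass_nonneg _ _)

theorem measurable_phaseMeasure (hθa : ∀ κ, G.IsEigensystem κ (θ κ) (a κ)) {q : E → ℝ}
    (hq : ∀ e, 0 ≤ q e) : Measurable (phaseMeasure θ a q) := by
  have hfin : ∀ κ, IsFiniteMeasure (phaseMeasure θ a q κ) := fun κ =>
    ⟨by rw [phaseMeasure_univ hq]; exact ENNReal.ofReal_lt_top⟩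
  refine Measurable.measure_of_isPiSystem (S := {s | IsClosed s}) ?_ isPiSystem_isClosed
    (fun s hs => measurable_phaseMeasure_isClosed hθa hq hs) ?_
  · rw [← borel_eq_generateFrom_isClosed]
    exact BorelSpace.measurable_eq
  · simp_rw [phaseMeasure_univ hq]
    exact measurable_const

/-- The family of spectral measures as a Markov-type kernel. -/
def phaseKernel (hθa : ∀ κ, G.IsEigensystem κ (θ κ) (a κ)) {q : E → ℝ} (hq : ∀ e, 0 ≤ q e) :
    Kernel (Torus E) (AddCircle (2 * π)) :=
  ⟨phaseMeasure θ a q, measurable_phaseMeasure hθa hq⟩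

instance isFiniteKernel_phaseKernel (hθa : ∀ κ, G.IsEigensystem κ (θ κ) (a κ)) {q : E → ℝ}
    (hq : ∀ e, 0 ≤ q e) : IsFiniteKernel (phaseKernel hθa hq) :=
  ⟨⟨ENNReal.ofReal (2 * ∑ e, q e), ENNReal.ofReal_lt_top, fun κ =>
    (phaseMeasure_univ hq κ).le⟩⟩

theorem continuous_subDiag :
    Continuous fun p : Torus E × AddCircle (2 * π) => p.1.subDiag p.2 :=
  continuous_pi fun e => ((continuous_apply e).comp continuous_fst).sub continuous_snd

/-- The image on the secular manifold of the spectral measures, integrated over the torus. -/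
def phaseFlux (hθa : ∀ κ, G.IsEigensystem κ (θ κ) (a κ)) {q : E → ℝ} (hq : ∀ e, 0 ≤ q e) :
    Measure (Torus E) :=
  (volume ⊗ₘ phaseKernel hθa hq).map fun p => p.1.subDiag p.2

theorem measurable_sum_phase (hθa : ∀ κ, G.IsEigensystem κ (θ κ) (a κ)) {q : E → ℝ}
    (hq : ∀ e, 0 ≤ q e) {f : Torus E → ℝ≥0∞} (hf : Measurable f) :
    Measurable fun κ => ∑ n, ENNReal.ofReal (∑ e, q e * edgeMass (a κ n) e) *
      f (κ.subDiag (θ κ n)) := by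
  have hm := (hf.comp continuous_subDiag.measurable).lintegral_kernel_prod_right'
    (κ := phaseKernel hθa hq)
  convert hm using 2 with κ
  exact (lintegral_phaseMeasure q κ (f := fun t => f (κ.subDiag t))
    ((hf.comp continuous_subDiag.measurable).comp measurable_prodMk_left)).symm

theorem lintegral_phaseFlux (hθa : ∀ κ, G.IsEigensystem κ (θ κ) (a κ)) {q : E → ℝ}
    (hq : ∀ e, 0 ≤ q e) {f : Torus E → ℝ≥0∞} (hf : Measurable f) :
    ∫⁻ x, f x ∂phaseFlux hθa hq = ∫⁻ κ, ∑ n, ENNReal.ofReal (∑ e, q e * edgeMass (a κ n) e) *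
      f (κ.subDiag (θ κ n)) := by
  rw [phaseFlux, lintegral_map hf continuous_subDiag.measurable]
  refine (Measure.lintegral_compProd (hf.comp continuous_subDiag.measurable)).trans ?_
  refine lintegral_congr fun κ => ?_
  exact lintegral_phaseMeasure q κ (f := fun t => f (κ.subDiag t))
    ((hf.comp continuous_subDiag.measurable).comp measurable_prodMk_left)

theorem measurable_sum_phase_complex (hθa : ∀ κ, G.IsEigensystem κ (θ κ) (a κ)) {q : E → ℝ}
    (hq : ∀ e, 0 ≤ q e) {f : Torus E → ℂ} (hf : Measurable f) :
    Measurable fun κ => ∑ n, f (κ.subDiag (θ κ n)) *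
      ((∑ e, q e * edgeMass (a κ n) e : ℝ) : ℂ) := by
  have hm := ((hf.comp continuous_subDiag.measurable).stronglyMeasurable.integral_kernel_prod_right'
    (κ := phaseKernel hθa hq)).measurable
  convert hm using 2 with κ
  exact (integral_phaseMeasure hq κ (fun t => f (κ.subDiag t))).symm

/-- Fubini for kernels: the sum over `n` is the fibre integral over the phase circle. Its norm is at
most the fibre integral of the norm, which gives integrability. -/
theorem integral_phaseFlux (hθa : ∀ κ, G.IsEigensystem κ (θ κ) (a κ)) {q : E → ℝ}
    (hq : ∀ e, 0 ≤ q e) {f : Torus E → ℂ} (hf : Measurable f)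
    (hfi : Integrable f (phaseFlux hθa hq)) :
    Integrable (fun κ => ∑ n, f (κ.subDiag (θ κ n)) *
      ((∑ e, q e * edgeMass (a κ n) e : ℝ) : ℂ)) ∧
    ∫ x, f x ∂phaseFlux hθa hq = ∫ κ, ∑ n, f (κ.subDiag (θ κ n)) *
      ((∑ e, q e * edgeMass (a κ n) e : ℝ) : ℂ) := by
  have hfi' := (integrable_map_measure hf.aestronglyMeasurable
    continuous_subDiag.measurable.aemeasurable).mp hfi
  have heq : ∀ κ, ∫ t, (f ∘ fun p : Torus E × AddCircle (2 * π) => p.1.subDiag p.2) (κ, t)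
      ∂phaseKernel hθa hq κ = ∑ n, f (κ.subDiag (θ κ n)) *
      ((∑ e, q e * edgeMass (a κ n) e : ℝ) : ℂ) := fun κ =>
    integral_phaseMeasure hq κ (fun t => f (κ.subDiag t))
  constructor
  · have h1 := ((Measure.integrable_compProd_iff hfi'.aestronglyMeasurable).mp hfi').2
    refine h1.mono (measurable_sum_phase_complex hθa hq hf).aestronglyMeasurable
      (Filter.Eventually.of_forall fun κ => ?_)
    rw [← heq, Real.norm_of_nonneg (integral_nonneg fun _ => norm_nonneg _)]
    exact norm_integral_le_integral_norm _
  · rw [phaseFlux, integral_map continuous_subDiag.measurable.aemeasurable hf.aestronglyMeasurable]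
    refine (Measure.integral_compProd hfi').trans ?_
    exact integral_congr_ae (Filter.Eventually.of_forall heq)

end Kernel
end QGraph

/-! ### Charts and unit normal of the regular part -/

namespace Torus

variable {E : Type*} [Fintype E]

theorem eq_of_mk_eq_mk {x y : EuclideanSpace ℝ E} (h : mk x = mk y)
    (hxy : ∀ e, |x e - y e| < 2 * π) : x = y := by
  ext e
  have h1 : ((x e - y e : ℝ) : AddCircle (2 * π)) = 0 := by
    have := congrFun h e
    simp only [mk] at this
    rw [AddCircle.coe_sub, this, sub_self]
  obtain ⟨m, hm⟩ := (AddCircle.coe_eq_zero_iff _).mp h1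
  rw [zsmul_eq_mul] at hm
  have h2 := hxy e
  rw [← hm, abs_mul, abs_of_pos Real.two_pi_pos] at h2
  have h3 : |(m : ℝ)| < 1 := by
    by_contra hcon
    push Not at hcon
    nlinarith [Real.two_pi_pos]
  have h4 : m = 0 := by
    rw [← Int.abs_lt_one_iff]
    exact_mod_cast h3
  rw [h4] at hm
  simp at hm
  linarith

end Torus

namespace QGraph

open Filter Topology ComplexConjugate

variable {V E : Type*} {G : QGraph V E} [DecidableEq V] [Fintype E] [DecidableEq E]

variable (G) in
/-- The normalized absolute values of the components of the gradient of the secular function. -/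
def edgeShare (κ : Torus E) (e : E) : ℝ := ‖G.gradCoeff κ e‖ / ∑ e', ‖G.gradCoeff κ e'‖

variable (G) in
/-- The vector of the edge shares. -/
def shareVec (κ : Torus E) : EuclideanSpace ℝ E := WithLp.toLp 2 (G.edgeShare κ)

theorem edgeShare_nonneg (κ : Torus E) (e : E) : 0 ≤ G.edgeShare κ e := by
  unfold edgeShare; positivity

theorem measurable_edgeShare (e : E) : Measurable fun κ => G.edgeShare κ e :=
  (continuous_gradCoeff e).norm.measurable.div
    (Finset.measurable_fun_sum _ fun e' _ => (continuous_gradCoeff e').norm.measurable)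

theorem measurable_shareVec : Measurable G.shareVec :=
  (PiLp.continuous_toLp 2 _).measurable.comp (measurable_pi_lambda _ measurable_edgeShare)

theorem sum_edgeShare {κ : Torus E} (hκ : κ ∈ G.regularPart) : ∑ e, G.edgeShare κ e = 1 := by
  obtain ⟨e, he⟩ := ((mem_regularPart_iff κ).mp hκ).2
  simp only [edgeShare]
  rw [← Finset.sum_div, div_self]
  have : 0 < ∑ e', ‖G.gradCoeff κ e'‖ :=
    Finset.sum_pos' (fun _ _ => norm_nonneg _) ⟨e, Finset.mem_univ e, norm_pos_iff.mpr he⟩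
  exact this.ne'

theorem shareVec_ne_zero {κ : Torus E} (hκ : κ ∈ G.regularPart) : G.shareVec κ ≠ 0 := by
  intro h
  have h1 := sum_edgeShare hκ
  have h2 : ∀ e, G.edgeShare κ e = 0 := fun e => congrArg (fun v : EuclideanSpace ℝ E => v e) h
  simp [h2] at h1

theorem measurableSet_regularPart : MeasurableSet G.regularPart := by
  have : G.regularPart = {κ | G.secular κ = 0} ∩ ⋃ e, {κ | G.gradCoeff κ e ≠ 0} := by
    ext κ
    rw [mem_regularPart_iff]
    simp
  rw [this]
  refine (isClosed_singleton.preimage continuous_secular).measurableSet.inter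
    (MeasurableSet.iUnion fun e => ?_)
  exact (isClosed_singleton.preimage (continuous_gradCoeff e)).measurableSet.compl

/-- The common complex factor of the gradient coefficients cancels in the quotient, and the masses
of a unit vector sum to one. Thus the masses of the zero-phase eigenvector become an intrinsic
measurable function of the point. -/
theorem IsEigensystem.edgeShare_eq {κ : Torus E}
    {θ : Fin (2 * Fintype.card E) → AddCircle (2 * π)}
    {a : OrthonormalBasis (Fin (2 * Fintype.card E)) ℂ (EuclideanSpace ℂ (E ⊕ E))}
    (h : G.IsEigensystem κ θ a) (hκ : κ ∈ G.regularPart) {n : Fin (2 * Fintype.card E)}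
    (hn : θ n = 0) (e : E) : G.edgeShare κ e = edgeMass (a n) e := by
  obtain ⟨m, hm, huniq⟩ := h.exists_unique_of_mem_regularPart hκ
  obtain rfl := huniq n hn
  have hc := prod_erase_ne_zero huniq
  simp only [edgeShare, h.gradCoeff_eq_of_unique hn, norm_mul, Complex.norm_real, Real.norm_eq_abs,
    abs_of_nonneg (edgeMass_nonneg _ _)]
  rw [← Finset.mul_sum, sum_edgeMass, a.orthonormal.1 n, one_pow, mul_one,
    mul_div_cancel_left₀ _ (norm_ne_zero_iff.mpr hc)]

/-- At a regular point the gradient of the secular function is a complex multiple of the vector of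
edge shares. -/
theorem IsEigensystem.exists_gradCLM_eq {κ : Torus E}
    {θ : Fin (2 * Fintype.card E) → AddCircle (2 * π)}
    {a : OrthonormalBasis (Fin (2 * Fintype.card E)) ℂ (EuclideanSpace ℂ (E ⊕ E))}
    (h : G.IsEigensystem κ θ a) (hκ : κ ∈ G.regularPart) :
    ∃ z : ℂ, z ≠ 0 ∧ conj z * (G.evolution κ).det = z ∧
      ∀ v, G.gradCLM κ v = z * ((inner ℝ (G.shareVec κ) v : ℝ) : ℂ) := by
  obtain ⟨n, hn, huniq⟩ := h.exists_unique_of_mem_regularPart hκ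
  have hc := prod_erase_ne_zero huniq
  refine ⟨-Complex.I * ∏ m ∈ Finset.univ.erase n, (1 - ((θ m).toCircle : ℂ)),
    mul_ne_zero (by simp) hc, ?_, fun v => ?_⟩
  · have := h.star_prod_erase_mul_det hn
    rw [map_mul, mul_assoc, this, map_neg, Complex.conj_I]
    ring
  · rw [gradCLM_apply, mul_assoc]
    congr 1
    rw [PiLp.inner_apply]
    push_cast
    rw [Finset.mul_sum]
    refine Finset.sum_congr rfl fun e _ => ?_
    rw [h.gradCoeff_eq_of_unique hn, ← h.edgeShare_eq hκ hn]
    simp [shareVec]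
    ring

/-- Around each of its points the regular part of the secular manifold has a local
parametrization. -/
theorem exists_isLocalParam (hsys : ∀ κ, ∃ θ a, G.IsEigensystem κ θ a) (x₀ : EuclideanSpace ℝ E)
    (hx₀ : Torus.mk x₀ ∈ G.regularPart) :
    ∃ O φ, Torus.IsLocalParam (Fintype.card E - 1) G.regularPart O φ ∧
      (∃ z₀ ∈ O, φ z₀ = x₀) ∧
      ∀ᶠ y in 𝓝 x₀, Torus.mk y ∈ G.regularPart → ∃ z ∈ O, φ z = y := by
  obtain ⟨θ, a, h⟩ := hsys (Torus.mk x₀)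
  obtain ⟨z, hz0, hzdet, hz⟩ := h.exists_gradCLM_eq hx₀
  obtain ⟨e₀, he₀⟩ := ((mem_regularPart_iff _).mp hx₀).2
  set s := G.shareVec (Torus.mk x₀) with hs
  have hs0 : s ≠ 0 := shareVec_ne_zero hx₀
  have hcardpos : 0 < Fintype.card E := Fintype.card_pos_iff.mpr ⟨e₀⟩
  let d := Fintype.card E - 1
  have hd : d + 1 = Fintype.card E := by omega
  let K : Submodule ℝ (EuclideanSpace ℝ E) := (ℝ ∙ s)ᗮ
  have hK : Module.finrank ℝ K = Module.finrank ℝ (EuclideanSpace ℝ (Fin d)) := by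
    have h1 := (ℝ ∙ s).finrank_add_finrank_orthogonal
    rw [finrank_span_singleton hs0, finrank_euclideanSpace] at h1
    rw [finrank_euclideanSpace_fin]
    change Module.finrank ℝ (ℝ ∙ s)ᗮ = d
    omega
  let L : K ≃L[ℝ] EuclideanSpace ℝ (Fin d) := ContinuousLinearEquiv.ofFinrankEq hK
  let Λ : EuclideanSpace ℝ E →L[ℝ] EuclideanSpace ℝ (Fin d) :=
    (L : K →L[ℝ] EuclideanSpace ℝ (Fin d)).comp K.orthogonalProjectionOnto
  -- Multiplying by the conjugate of the gradient's phase makes the differential at `x₀` the real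
  -- form `‖z‖² ⟪s, ·⟫`. With the projection to `s⊥` it gives an invertible map, whose local inverse
  -- at height zero is the chart.
  let f : EuclideanSpace ℝ E → ℝ := fun y => (conj z * G.secular (Torus.mk y)).re
  have hf : ContDiff ℝ 1 f :=
    Complex.reCLM.contDiff.comp ((contDiff_const.mul contDiff_secular_mk).of_le le_top)
  let f' : EuclideanSpace ℝ E →L[ℝ] ℝ := (‖z‖ ^ 2) • innerSL ℝ s
  have hf' : HasFDerivAt f f' x₀ := by
    have h1 := (hasFDerivAt_secular_mk (G := G) x₀).const_mul (conj z)
    have h2 := Complex.reCLM.hasFDerivAt.comp x₀ h1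
    refine h2.congr_fderiv ?_
    ext v
    simp only [f', ContinuousLinearMap.comp_apply, _root_.smul_apply, smul_eq_mul,
      Complex.reCLM_apply, innerSL_apply_apply]
    rw [hz v, ← mul_assoc, Complex.conj_mul', ← Complex.ofReal_pow, ← Complex.ofReal_mul,
      Complex.ofReal_re]
  have hf0 : f x₀ = 0 := by
    have : G.secular (Torus.mk x₀) = 0 := hx₀.1
    simp [f, this]
  let Ψ : EuclideanSpace ℝ E → EuclideanSpace ℝ (Fin d) × ℝ := fun y => (Λ y, f y)
  have hΨ : ContDiff ℝ 1 Ψ := Λ.contDiff.prodMk hf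
  have hΨinj : Function.Injective (Λ.prod f') := by
    rw [injective_iff_map_eq_zero]
    intro v hv
    have h1 : Λ v = 0 := congrArg Prod.fst hv
    have h2 : f' v = 0 := congrArg Prod.snd hv
    have h3 : inner ℝ s v = 0 := by
      have : ‖z‖ ^ 2 * inner ℝ s v = 0 := h2
      exact (mul_eq_zero.mp this).resolve_left (by simpa using hz0)
    have h4 : v ∈ K := Submodule.mem_orthogonal_singleton_iff_inner_right.mpr h3
    have h5 : K.orthogonalProjectionOnto v = 0 := L.injective (h1.trans (map_zero L).symm)
    rw [Submodule.orthogonalProjectionOnto_eq_zero_iff] at h5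
    exact inner_self_eq_zero.mp (h5 v h4)
  let Ψ' : EuclideanSpace ℝ E ≃L[ℝ] EuclideanSpace ℝ (Fin d) × ℝ :=
    (LinearMap.linearEquivOfInjective (Λ.prod f').toLinearMap hΨinj
      (by simp [hd])).toContinuousLinearEquiv
  have hΨ' : HasFDerivAt Ψ (Ψ' : EuclideanSpace ℝ E →L[ℝ] EuclideanSpace ℝ (Fin d) × ℝ) x₀ :=
    (Λ.hasFDerivAt.prodMk hf').congr_fderiv (by ext v <;> rfl)
  let e := hΨ.contDiffAt.toOpenPartialHomeomorph Ψ hΨ' one_ne_zero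
  have he : ∀ y, e y = Ψ y := fun y => rfl
  have hx₀s : x₀ ∈ e.source :=
    hΨ.contDiffAt.mem_toOpenPartialHomeomorph_source hΨ' one_ne_zero
  have hsymm : ContDiffAt ℝ 1 e.symm (Ψ x₀) := hΨ.contDiffAt.to_localInverse hΨ' one_ne_zero
  -- The three conditions serve, in order, injectivity modulo `2πℤ^E`, regularity of the image
  -- points, and the passage from `f = 0` to the full complex secular equation.
  have hW : ∀ᶠ y in 𝓝 x₀, (y ∈ Metric.ball x₀ 1) ∧ (G.gradCoeff (Torus.mk y) e₀ ≠ 0) ∧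
      (conj z * (G.evolution (Torus.mk y)).det + z ≠ 0) := by
    refine Filter.Eventually.and (Metric.ball_mem_nhds x₀ one_pos) (Filter.Eventually.and ?_ ?_)
    · exact (((continuous_gradCoeff e₀).comp Torus.continuous_mk).continuousAt).eventually_ne he₀
    · have hc : Continuous fun y => conj z * (G.evolution (Torus.mk y)).det + z :=
        (continuous_const.mul
          ((continuous_evolution.comp Torus.continuous_mk).matrix_det)).add continuous_const
      refine hc.continuousAt.eventually_ne ?_
      rw [hzdet, ← two_mul]
      exact mul_ne_zero two_ne_zero hz0
  -- A vanishing real part means `conj z * F = -z * conj F`. Together with the functional equation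
  -- this gives `conj F * (conj z * det U + z) = 0`.
  have hsec : ∀ y, conj z * (G.evolution (Torus.mk y)).det + z ≠ 0 → f y = 0 →
      G.secular (Torus.mk y) = 0 := by
    intro y hy hfy
    obtain ⟨θ', a', h'⟩ := hsys (Torus.mk y)
    have h1 := h'.star_secular_mul_det
    have h2 : conj z * G.secular (Torus.mk y) + conj (conj z * G.secular (Torus.mk y)) = 0 := by
      rw [Complex.add_conj]
      have : (conj z * G.secular (Torus.mk y)).re = 0 := hfy
      rw [this]; simp
    rw [map_mul, Complex.conj_conj] at h2
    have h3 : conj (G.secular (Torus.mk y)) *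
        (conj z * (G.evolution (Torus.mk y)).det + z) = 0 := by
      linear_combination h2 + conj z * h1
    have h4 := (mul_eq_zero.mp h3).resolve_right hy
    simpa using h4
  -- a good open neighbourhood of the image point
  have hN : ∀ᶠ p in 𝓝 (Ψ x₀), p ∈ e.target ∧ ContDiffAt ℝ 1 e.symm p ∧
      ((e.symm p ∈ Metric.ball x₀ 1) ∧ (G.gradCoeff (Torus.mk (e.symm p)) e₀ ≠ 0) ∧
      (conj z * (G.evolution (Torus.mk (e.symm p))).det + z ≠ 0)) := by
    refine Filter.Eventually.and (e.open_target.mem_nhds (e.map_source hx₀s))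
      ((hsymm.eventually (by simp)).and ?_)
    have hcont : Tendsto e.symm (𝓝 (Ψ x₀)) (𝓝 x₀) := by
      have := e.continuousAt_symm (e.map_source hx₀s)
      rw [ContinuousAt, e.left_inv hx₀s] at this
      exact this
    exact hcont.eventually hW
  obtain ⟨N, hNsub, hNopen, hNmem⟩ := eventually_nhds_iff.mp hN
  let ι : EuclideanSpace ℝ (Fin d) → EuclideanSpace ℝ (Fin d) × ℝ := fun z => (z, 0)
  have hι : ContDiff ℝ 1 ι := contDiff_id.prodMk contDiff_const
  let O : Set (EuclideanSpace ℝ (Fin d)) := ι ⁻¹' N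
  let φ : EuclideanSpace ℝ (Fin d) → EuclideanSpace ℝ E := fun z => e.symm (ι z)
  have hO : IsOpen O := hNopen.preimage hι.continuous
  have hΨφ : ∀ z ∈ O, Ψ (φ z) = (z, 0) := fun z hz => e.right_inv (hNsub _ hz).1
  have hΛφ : ∀ z ∈ O, Λ (φ z) = z := fun z hz => congrArg Prod.fst (hΨφ z hz)
  have hcd : ∀ z ∈ O, ContDiffAt ℝ 1 φ z := fun z hz =>
    (hNsub _ hz).2.1.comp z hι.contDiffAt
  refine ⟨O, φ, ⟨hO, fun z hz => (hcd z hz).contDiffWithinAt, ?_, ?_, ?_⟩, ⟨Λ x₀, ?_, ?_⟩, ?_⟩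
  · intro w hw
    have h1 : HasFDerivAt (fun z => Λ (φ z)) (Λ.comp (fderiv ℝ φ w)) w :=
      Λ.hasFDerivAt.comp w ((hcd w hw).differentiableAt one_ne_zero).hasFDerivAt
    have h2 : HasFDerivAt (fun z => Λ (φ z)) (ContinuousLinearMap.id ℝ _) w :=
      (hasFDerivAt_id w).congr_of_eventuallyEq
        (Filter.eventually_of_mem (hO.mem_nhds hw) hΛφ)
    have h3 := h1.unique h2
    refine Function.LeftInverse.injective (g := Λ) fun v => ?_
    exact congrArg (fun T => T v) h3
  · intro w hw
    rw [mem_regularPart_iff]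
    exact ⟨hsec _ (hNsub _ hw).2.2.2.2 (congrArg Prod.snd (hΨφ w hw)), e₀, (hNsub _ hw).2.2.2.1⟩
  · intro w hw w' hw' hww
    have h1 : φ w = φ w' := by
      refine Torus.eq_of_mk_eq_mk hww fun i => ?_
      have h2 : ‖φ w - φ w'‖ < 2 := by
        have := dist_triangle_right (φ w) (φ w') x₀
        rw [dist_eq_norm] at this
        have := Metric.mem_ball.mp (hNsub _ hw).2.2.1
        have := Metric.mem_ball.mp (hNsub _ hw').2.2.1
        simp only [φ] at *
        linarith
      have h3 := (PiLp.norm_apply_le (φ w - φ w') i).trans_lt h2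
      rw [Real.norm_eq_abs] at h3
      have := Real.pi_gt_three
      exact h3.trans (by linarith)
    rw [← hΛφ w hw, h1, hΛφ w' hw']
  · change (Λ x₀, (0 : ℝ)) ∈ N
    rw [← hf0]
    exact hNmem
  · change e.symm (Λ x₀, (0 : ℝ)) = x₀
    rw [← hf0]
    exact e.left_inv hx₀s
  · filter_upwards [e.open_source.mem_nhds hx₀s,
      hΨ.continuous.continuousAt.preimage_mem_nhds (hNopen.mem_nhds hNmem)] with y hy hyN hyR
    have hfy : f y = 0 := by
      have : G.secular (Torus.mk y) = 0 := hyR.1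
      simp [f, this]
    have hΨy : ι (Λ y) = Ψ y := by simp [ι, Ψ, hfy]
    refine ⟨Λ y, ?_, ?_⟩
    · change ι (Λ y) ∈ N
      rw [hΨy]; exact hyN
    · change e.symm (ι (Λ y)) = y
      rw [hΨy]; exact e.left_inv hy

/-- The secular function vanishes identically along a chart, so its differential, a nonzero multiple
of `⟪s, ·⟫`, annihilates the tangent vectors. -/
theorem inner_shareVec_fderiv (hsys : ∀ κ, ∃ θ a, G.IsEigensystem κ θ a) {d : ℕ}
    {O : Set (EuclideanSpace ℝ (Fin d))} {φ : EuclideanSpace ℝ (Fin d) → EuclideanSpace ℝ E}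
    (hφ : Torus.IsLocalParam d G.regularPart O φ) {x : EuclideanSpace ℝ (Fin d)} (hx : x ∈ O)
    (v : EuclideanSpace ℝ (Fin d)) :
    inner ℝ (G.shareVec (Torus.mk (φ x))) (fderiv ℝ φ x v) = 0 := by
  obtain ⟨θ, a, h⟩ := hsys (Torus.mk (φ x))
  obtain ⟨z, hz0, -, hz⟩ := h.exists_gradCLM_eq (hφ.mapsTo x hx)
  have hdiff : HasFDerivAt φ (fderiv ℝ φ x) x :=
    ((hφ.contDiffOn.contDiffAt (hφ.isOpen.mem_nhds hx)).differentiableAt one_ne_zero).hasFDerivAt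
  have h1 := (hasFDerivAt_secular_mk (G := G) (φ x)).comp x hdiff
  have h2 : HasFDerivAt (fun y => G.secular (Torus.mk (φ y)))
      (0 : EuclideanSpace ℝ (Fin d) →L[ℝ] ℂ) x :=
    (hasFDerivAt_const (0 : ℂ) x).congr_of_eventuallyEq
      (Filter.eventually_of_mem (hφ.isOpen.mem_nhds hx) fun y hy => (hφ.mapsTo y hy).1)
  have h3 := congrArg (fun T => T v) (h1.unique h2)
  have h4 : G.gradCLM (Torus.mk (φ x)) (fderiv ℝ φ x v) = 0 := h3
  rw [hz] at h4
  exact_mod_cast (mul_eq_zero.mp h4).resolve_left hz0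

/-- A vector which is orthogonal to the image of the differential of a parametrization of the
regular part is a multiple of the vector of edge shares. -/
theorem exists_eq_smul_shareVec (hsys : ∀ κ, ∃ θ a, G.IsEigensystem κ θ a)
    {O : Set (EuclideanSpace ℝ (Fin (Fintype.card E - 1)))}
    {φ : EuclideanSpace ℝ (Fin (Fintype.card E - 1)) → EuclideanSpace ℝ E}
    (hφ : Torus.IsLocalParam (Fintype.card E - 1) G.regularPart O φ)
    {x : EuclideanSpace ℝ (Fin (Fintype.card E - 1))} (hx : x ∈ O) {w : EuclideanSpace ℝ E}
    (hw : ∀ v, inner ℝ w (fderiv ℝ φ x v) = 0) :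
    ∃ r : ℝ, r • G.shareVec (Torus.mk (φ x)) = w := by
  set s := G.shareVec (Torus.mk (φ x)) with hs
  have hs0 : s ≠ 0 := shareVec_ne_zero (hφ.mapsTo x hx)
  obtain ⟨e₀, -⟩ := ((mem_regularPart_iff _).mp (hφ.mapsTo x hx)).2
  have hcardpos : 0 < Fintype.card E := Fintype.card_pos_iff.mpr ⟨e₀⟩
  let T : Submodule ℝ (EuclideanSpace ℝ E) := (fderiv ℝ φ x).toLinearMap.range
  have hT : Module.finrank ℝ T = Fintype.card E - 1 := by
    rw [LinearMap.finrank_range_of_inj (hφ.immersion x hx), finrank_euclideanSpace_fin]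
  have hTo : Module.finrank ℝ Tᗮ = 1 := by
    have := T.finrank_add_finrank_orthogonal
    rw [hT, finrank_euclideanSpace] at this
    omega
  have hmem : ∀ u : EuclideanSpace ℝ E, (∀ v, inner ℝ u (fderiv ℝ φ x v) = 0) → u ∈ Tᗮ := by
    intro u hu
    rw [Submodule.mem_orthogonal']
    rintro _ ⟨v, rfl⟩
    exact hu v
  have hsT : s ∈ Tᗮ := hmem s (inner_shareVec_fderiv hsys hφ hx)
  obtain ⟨r, hr⟩ := (finrank_eq_one_iff_of_nonzero' (⟨s, hsT⟩ : Tᗮ)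
    (fun h => hs0 (congrArg Subtype.val h))).mp hTo ⟨w, hmem w hw⟩
  exact ⟨r, congrArg Subtype.val hr⟩

/-- The normal is a chosen vector, so both existence and uniqueness are needed. The differential of
the secular function kills the tangent cone, because it maps that cone into the cone of a single
point. Conversely the cone contains the tangent hyperplane of a chart, which leaves one line of
normals, and nonnegative entries fix the sign. -/
theorem normal_eq (hsys : ∀ κ, ∃ θ a, G.IsEigensystem κ θ a) {κ : Torus E}
    (hκ : κ ∈ G.regularPart) : G.normal κ = ‖G.shareVec κ‖⁻¹ • G.shareVec κ := by
  have hs0 := shareVec_ne_zero hκ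
  have hex : G.IsPositiveNormal κ (‖G.shareVec κ‖⁻¹ • G.shareVec κ) := by
    refine ⟨norm_smul_inv_norm hs0, fun e => ?_, ?_⟩
    · exact mul_nonneg (inv_nonneg.mpr (norm_nonneg _)) (edgeShare_nonneg κ e)
    · intro x hx v hv
      obtain ⟨θ, a, h⟩ := hsys κ
      obtain ⟨z, hz0, -, hz⟩ := h.exists_gradCLM_eq hκ
      have h1 := ((hasFDerivAt_secular_mk (G := G) x).hasFDerivWithinAt
        (s := Torus.mk ⁻¹' G.regularPart)).mapsTo_tangent_cone hv
      have h2 : (fun y => G.secular (Torus.mk y)) '' (Torus.mk ⁻¹' G.regularPart) ⊆ {0} := by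
        rintro _ ⟨y, hy, rfl⟩
        exact hy.1
      have h3 := tangentConeAt_mono h2 h1
      have hx0 : G.secular (Torus.mk x) = 0 := by rw [hx]; exact hκ.1
      have h4 : G.gradCLM κ v = 0 := by
        rw [hx] at h3
        have hacc : ¬AccPt (G.secular κ) (𝓟 ({0} : Set ℂ)) := fun hacc => by
          obtain ⟨y, hy1, hy2⟩ := (accPt_iff_frequently.mp hacc).exists
          rw [hx] at hx0
          exact hy1 (hy2.trans hx0.symm)
        simpa using tangentConeAt_subset_zero hacc h3
      rw [hz] at h4
      have h5 : inner ℝ (G.shareVec κ) v = 0 := by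
        exact_mod_cast (mul_eq_zero.mp h4).resolve_left hz0
      rw [inner_smul_left, h5, mul_zero]
  have huniq : ∀ n, G.IsPositiveNormal κ n → n = ‖G.shareVec κ‖⁻¹ • G.shareVec κ := by
    intro n hn
    obtain ⟨x₀, rfl⟩ := exists_mk_eq κ
    obtain ⟨O, φ, hφ, ⟨z₀, hz₀, rfl⟩, -⟩ := exists_isLocalParam hsys x₀ hκ
    have hdiff : HasFDerivAt φ (fderiv ℝ φ z₀) z₀ :=
      ((hφ.contDiffOn.contDiffAt
        (hφ.isOpen.mem_nhds hz₀)).differentiableAt one_ne_zero).hasFDerivAt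
    obtain ⟨r, hr⟩ := exists_eq_smul_shareVec hsys hφ hz₀ (w := n) (fun v => by
      refine hn.orthogonal (φ z₀) rfl _ ?_
      have hv : v ∈ tangentConeAt ℝ O z₀ := by
        rw [tangentConeAt_of_mem_nhds (hφ.isOpen.mem_nhds hz₀)]
        trivial
      refine tangentConeAt_mono ?_ ((hdiff.hasFDerivWithinAt (s := O)).mapsTo_tangent_cone hv)
      rintro _ ⟨y, hy, rfl⟩
      exact hφ.mapsTo y hy)
    have hr0 : 0 ≤ r := by
      by_contra hneg
      push Not at hneg
      apply hs0
      ext e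
      have h1 := hn.nonneg e
      rw [← hr] at h1
      have h2 : 0 ≤ r * G.edgeShare (Torus.mk (φ z₀)) e := h1
      have h3 := edgeShare_nonneg (G := G) (Torus.mk (φ z₀)) e
      change G.edgeShare (Torus.mk (φ z₀)) e = 0
      nlinarith
    have hn1 := hn.norm_eq_one
    rw [← hr, norm_smul, Real.norm_of_nonneg hr0] at hn1
    rw [← hr, eq_inv_of_mul_eq_one_left hn1]
  have hh : κ ∈ G.regularPart ∧ ∃ n, G.IsPositiveNormal κ n := ⟨hκ, _, hex⟩
  rw [normal, dif_pos hh]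
  exact huniq _ hh.2.choose_spec

end QGraph

/-! ### The Jacobian of the suspension and change of variables into the torus -/

/-- The Jacobian of `(x, t) ↦ T x + t u` is the volume factor of `T` times the component of `u`
normal to the image of `T`. -/
theorem abs_det_eq_sqrt_det_gram_mul {Y : Type*} [NormedAddCommGroup Y] [InnerProductSpace ℝ Y]
    [FiniteDimensional ℝ Y] {d : ℕ}
    (I : Y ≃ₗᵢ[ℝ] WithLp 2 (EuclideanSpace ℝ (Fin d) × ℝ)) (T : EuclideanSpace ℝ (Fin d) →L[ℝ] Y)
    (u n : Y) (hn : ‖n‖ = 1) (hnT : ∀ v, inner ℝ n (T v) = 0)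
    (hperp : ∀ w, (∀ v, inner ℝ w (T v) = 0) → ∃ r : ℝ, r • n = w) (M : Y →L[ℝ] Y)
    (hM : ∀ y, M y = T (I y).fst + (I y).snd • u) :
    |M.det| = √(gram ℝ fun i : Fin d => T (EuclideanSpace.single i 1)).det * |inner ℝ n u| := by
  let b : OrthonormalBasis (Fin d ⊕ Unit) ℝ Y :=
    ((EuclideanSpace.basisFun (Fin d) ℝ).prod (OrthonormalBasis.singleton Unit ℝ)).map I.symm
  let v : Y → Fin d ⊕ Unit → Y := fun w => Sum.elim (fun i => T (EuclideanSpace.single i 1)) fun _ => w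
  let C : Y → Matrix (Fin d ⊕ Unit) (Fin d ⊕ Unit) ℝ := fun w => of fun i j => b.repr (v w j) i
  have hMb : ∀ j, M (b j) = v u j := by
    intro j
    rw [hM]
    rcases j with j | j <;> simp [b, v]
  have hdet : M.det = (C u).det := by
    rw [ContinuousLinearMap.det, ← LinearMap.det_toMatrix b.toBasis]
    congr 1
    ext i j
    simp [LinearMap.toMatrix_apply, C, ← hMb]
  have hn1 : inner ℝ n n = (1 : ℝ) := by rw [real_inner_self_eq_norm_sq, hn, one_pow]
  -- The normals form the line of `n`, so removing the normal component of `u` leaves a vector in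
  -- the image of `T`. Column operations then replace `u` by `⟪n, u⟫ n`.
  obtain ⟨w, hw⟩ : ∃ w, T w = u - (inner ℝ n u : ℝ) • n := by
    have hmem : u - (inner ℝ n u : ℝ) • n ∈ (T.toLinearMap.range)ᗮᗮ := by
      rw [Submodule.mem_orthogonal]
      intro w hw
      obtain ⟨r, rfl⟩ := hperp w fun v => by
        rw [Submodule.mem_orthogonal'] at hw
        exact hw _ ⟨v, rfl⟩
      rw [inner_smul_left, inner_sub_right, inner_smul_right, hn1]
      simp
    rw [Submodule.orthogonal_orthogonal] at hmem
    exact hmem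
  have hC : C u = C n * fromBlocks 1 (of fun i _ => w i) 0 (of fun _ _ => inner ℝ n u) := by
    ext i j
    rcases j with j | j
    · simp [Matrix.mul_apply, Fintype.sum_sum_type, C, v, one_apply]
    · have hwsum : w = ∑ i, w i • EuclideanSpace.single i (1 : ℝ) := by
        have := (EuclideanSpace.basisFun (Fin d) ℝ).sum_repr w
        simpa using this.symm
      have hu : u = ∑ i, w i • T (EuclideanSpace.single i 1) + (inner ℝ n u : ℝ) • n := by
        have h1 : T w = ∑ i, w i • T (EuclideanSpace.single i 1) := by
          conv_lhs => rw [hwsum]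
          simp
        rw [← h1, hw]; abel
      have h2 : (b.repr u) i = ∑ k, w k * (b.repr (T (EuclideanSpace.single k 1))) i +
          inner ℝ n u * (b.repr n) i := by
        conv_lhs => rw [hu]
        simp
      simp only [C, v, of_apply, Sum.elim_inr, Matrix.mul_apply, Fintype.sum_sum_type, Sum.elim_inl,
        fromBlocks_apply₁₂, fromBlocks_apply₂₂, Finset.univ_unique, Finset.sum_singleton]
      rw [h2]
      simp only [mul_comm]
  -- As `n` is a unit vector orthogonal to the image, the Gram matrix of the enlarged family is
  -- block diagonal with last block `1`.
  have hgram : (C n).det ^ 2 = (gram ℝ fun i : Fin d => T (EuclideanSpace.single i 1)).det := by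
    have h1 := gram_eq_conjTranspose_mul b (v n)
    have h2 : gram ℝ (v n) = fromBlocks (gram ℝ fun i : Fin d => T (EuclideanSpace.single i 1))
        0 0 1 := by
      ext i j
      rcases i with i | i <;> rcases j with j | j
      · simp [v, gram_apply]
      · simp [v, gram_apply, real_inner_comm, hnT]
      · simp [v, gram_apply, hnT]
      · simp [v, gram_apply, hn]
    have h3 := congrArg Matrix.det h1
    rw [h2, det_fromBlocks_zero₂₁, det_one, mul_one, det_mul, det_conjTranspose, star_trivial] at h3
    rw [h3, sq]
  rw [hdet, hC, det_mul, det_fromBlocks_zero₂₁, det_one, one_mul, abs_mul, ← hgram, Real.sqrt_sq_eq_abs]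
  congr 2
  simp

theorem ContinuousOn.measurableSet_inter_preimage_of_measurableSet {X Z : Type*} [TopologicalSpace X]
    [MeasurableSpace X] [OpensMeasurableSpace X] [TopologicalSpace Z] [MeasurableSpace Z]
    [BorelSpace Z] {f : X → Z} {O : Set X} (hf : ContinuousOn f O) (hO : MeasurableSet O) {A : Set Z}
    (hA : MeasurableSet A) : MeasurableSet (O ∩ f ⁻¹' A) := by
  have h1 : Measurable (O.domRestrict f) := (continuousOn_iff_continuous_domRestrict.mp hf).measurable
  have h2 := hO.subtype_image (h1 hA)
  convert h2 using 1
  ext x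
  simp [Set.domRestrict, and_comm]

namespace Torus

variable {E : Type*} [Fintype E]

theorem injOn_mk_box (t : E → ℝ) : Set.InjOn mk (box t) := by
  intro x hx y hy hxy
  refine eq_of_mk_eq_mk hxy fun e => ?_
  have h1 := hx e
  have h2 := hy e
  rw [abs_lt]
  constructor <;> linarith [h1.1, h1.2, h2.1, h2.2]

theorem volume_image_mk {t : E → ℝ} {S : Set (EuclideanSpace ℝ E)} (hS : MeasurableSet S)
    (hSt : S ⊆ box t) : MeasurableSet (mk '' S) ∧ volume (mk '' S) = volume S := by
  have hm : MeasurableSet (mk '' S) :=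
    hS.image_of_measurable_injOn continuous_mk.measurable ((injOn_mk_box t).mono hSt)
  refine ⟨hm, ?_⟩
  rw [← (measurePreserving_mk t).measure_preimage hm.nullMeasurableSet,
    Measure.restrict_apply (continuous_mk.measurable hm)]
  congr 1
  ext x
  constructor
  · rintro ⟨⟨y, hy, hxy⟩, hx⟩
    rwa [← injOn_mk_box t (hSt hy) hx hxy]
  · exact fun hx => ⟨⟨x, hx, rfl⟩, hSt hx⟩

theorem exists_mem_box (x : EuclideanSpace ℝ E) :
    ∃ k : E → ℤ, x ∈ box fun e => 2 * π * k e := by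
  have h : ∀ r : ℝ, ∃ k : ℤ, r ∈ Set.Ioc (2 * π * k) (2 * π * k + 2 * π) := by
    intro r
    refine ⟨⌈r / (2 * π)⌉ - 1, ?_⟩
    have h1 := Int.ceil_lt_add_one (r / (2 * π))
    have h2 := Int.le_ceil (r / (2 * π))
    have hp := Real.two_pi_pos
    rw [div_le_iff₀ hp] at h2
    rw [← sub_lt_iff_lt_add, lt_div_iff₀ hp] at h1
    push_cast
    constructor
    · linarith
    · linarith
  choose k hk using fun e => h (x e)
  exact ⟨k, hk⟩

theorem disjoint_box {k l : E → ℤ} (hkl : k ≠ l) :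
    Disjoint (box fun e => 2 * π * k e) (box fun e => 2 * π * l e) := by
  rw [Set.disjoint_left]
  intro x hx hy
  apply hkl
  ext e
  have h1 := hx e
  have h2 := hy e
  have hp := Real.two_pi_pos
  have e1 : (k e : ℝ) < l e + 1 := by nlinarith [h1.1, h2.2]
  have e2 : (l e : ℝ) < k e + 1 := by nlinarith [h1.2, h2.1]
  have e1' : k e < l e + 1 := by exact_mod_cast e1
  have e2' : l e < k e + 1 := by exact_mod_cast e2
  omega

/-- Decomposition of the domain of a local diffeomorphism into the torus into countably many pieces
on which it is injective and satisfies the change of variables formula. -/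
theorem exists_pieces [Nonempty E] {F : EuclideanSpace ℝ E → EuclideanSpace ℝ E}
    {F' : EuclideanSpace ℝ E → EuclideanSpace ℝ E →L[ℝ] EuclideanSpace ℝ E}
    {Z : Set (EuclideanSpace ℝ E)} (hZ : MeasurableSet Z)
    (hF : ∀ y ∈ Z, HasFDerivAt F (F' y) y) (hF' : ∀ y ∈ Z, (F' y).det ≠ 0)
    (hbox : ∀ k : E → ℤ, MeasurableSet (Z ∩ F ⁻¹' box fun e => 2 * π * k e)) :
    ∃ P : ℕ × (E → ℤ) → Set (EuclideanSpace ℝ E), Pairwise (Function.onFun Disjoint P) ∧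
      (⋃ i, P i) = Z ∧ ∀ i, MeasurableSet (P i) ∧ Set.InjOn (fun y => mk (F y)) (P i) ∧
      MeasurableSet ((fun y => mk (F y)) '' P i) ∧
      ∫⁻ y in P i, ENNReal.ofReal |(F' y).det| = volume ((fun y => mk (F y)) '' P i) := by
  classical
  -- Half the inverse norm of the inverse: approximation of `F` to this accuracy by an invertible
  -- map forces injectivity. The default `1` is irrelevant, since on a nonempty `Z` only derivatives
  -- at points of `Z` occur as approximants.
  let r : (EuclideanSpace ℝ E →L[ℝ] EuclideanSpace ℝ E) → NNReal := fun A =>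
    if h : ∃ B : EuclideanSpace ℝ E ≃L[ℝ] EuclideanSpace ℝ E,
      (B : EuclideanSpace ℝ E →L[ℝ] EuclideanSpace ℝ E) = A then
      ‖(h.choose.symm : EuclideanSpace ℝ E →L[ℝ] EuclideanSpace ℝ E)‖₊⁻¹ / 2 else 1
  have hpos : ∀ B : EuclideanSpace ℝ E ≃L[ℝ] EuclideanSpace ℝ E,
      0 < ‖(B.symm : EuclideanSpace ℝ E →L[ℝ] EuclideanSpace ℝ E)‖₊⁻¹ := fun B =>
    inv_pos.mpr B.nnnorm_symm_pos
  have hr : ∀ A, r A ≠ 0 := by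
    intro A
    by_cases h : ∃ B : EuclideanSpace ℝ E ≃L[ℝ] EuclideanSpace ℝ E,
      (B : EuclideanSpace ℝ E →L[ℝ] EuclideanSpace ℝ E) = A
    · simp only [r, dif_pos h]
      exact (half_pos (hpos _)).ne'
    · simp [r, dif_neg h]
  obtain ⟨t, A, htd, htm, htc, hta, htA⟩ := exists_partition_approximatesLinearOn_of_hasFDerivWithinAt
    F Z F' (fun y hy => (hF y hy).hasFDerivWithinAt) r hr
  have hinj : ∀ i, Set.InjOn F (Z ∩ t i) := by
    intro i
    rcases Z.eq_empty_or_nonempty with hZe | hZn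
    · simp [hZe]
    obtain ⟨y, hy, hAy⟩ := htA hZn i
    have hex : ∃ B : EuclideanSpace ℝ E ≃L[ℝ] EuclideanSpace ℝ E,
        (B : EuclideanSpace ℝ E →L[ℝ] EuclideanSpace ℝ E) = A i := by
      rw [hAy]
      exact ⟨ContinuousLinearMap.toContinuousLinearEquivOfDetNeZero (F' y) (hF' y hy),
        ContinuousLinearMap.coe_toContinuousLinearEquivOfDetNeZero _ _⟩
    have hap := hta i
    simp only [r, dif_pos hex] at hap
    have hap' : ApproximatesLinearOn F
        (hex.choose : EuclideanSpace ℝ E →L[ℝ] EuclideanSpace ℝ E) (Z ∩ t i)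
        (‖(hex.choose.symm : EuclideanSpace ℝ E →L[ℝ] EuclideanSpace ℝ E)‖₊⁻¹ / 2) := by
      intro x hx y hy
      have := hap x hx y hy
      have he := hex.choose_spec
      rw [he]
      exact this
    have hlt : ‖(hex.choose.symm : EuclideanSpace ℝ E →L[ℝ] EuclideanSpace ℝ E)‖₊⁻¹ / 2 <
        ‖(hex.choose.symm : EuclideanSpace ℝ E →L[ℝ] EuclideanSpace ℝ E)‖₊⁻¹ :=
      half_lt_self (hpos _)
    exact ApproximatesLinearOn.injOn hap' (Or.inr hlt)
  -- Cutting also along preimages of fundamental boxes keeps each piece injective, with the right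
  -- image volume, after projection to the torus.
  let P : ℕ × (E → ℤ) → Set (EuclideanSpace ℝ E) := fun i =>
    (Z ∩ t i.1) ∩ (Z ∩ F ⁻¹' box fun e => 2 * π * i.2 e)
  refine ⟨P, ?_, ?_, fun i => ?_⟩
  · rintro ⟨i, k⟩ ⟨j, l⟩ hne
    rw [Function.onFun, Set.disjoint_left]
    rintro y ⟨⟨-, h1⟩, -, h2⟩ ⟨⟨-, h3⟩, -, h4⟩
    by_cases hij : i = j
    · subst hij
      have hkl : k ≠ l := fun h => hne (by rw [h])
      exact Set.disjoint_left.mp (disjoint_box hkl) h2 h4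
    · exact Set.disjoint_left.mp (htd hij) h1 h3
  · ext y
    constructor
    · intro hy
      obtain ⟨i, hi⟩ := Set.mem_iUnion.mp hy
      exact hi.1.1
    · intro hy
      obtain ⟨i, hi⟩ := Set.mem_iUnion.mp (htc hy)
      obtain ⟨k, hk⟩ := exists_mem_box (F y)
      exact Set.mem_iUnion.mpr ⟨(i, k), ⟨hy, hi⟩, hy, hk⟩
  · have hPm : MeasurableSet (P i) := (hZ.inter (htm _)).inter (hbox _)
    have hPi : Set.InjOn F (P i) := (hinj i.1).mono Set.inter_subset_left
    have hd : ∀ y ∈ P i, HasFDerivWithinAt F (F' y) (P i) y := fun y hy =>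
      (hF y hy.1.1).hasFDerivWithinAt
    have hsub : F '' P i ⊆ box fun e => 2 * π * i.2 e := by
      rintro _ ⟨y, hy, rfl⟩
      exact hy.2.2
    have himg : (fun y => mk (F y)) '' P i = mk '' (F '' P i) := by
      rw [Set.image_image]
    have hFm := measurable_image_of_fderivWithin hPm hd hPi
    refine ⟨hPm, ?_, ?_, ?_⟩
    · intro x hx y hy hxy
      exact hPi hx hy (injOn_mk_box _ (hsub ⟨x, hx, rfl⟩) (hsub ⟨y, hy, rfl⟩) hxy)
    · rw [himg]
      exact (volume_image_mk hFm hsub).1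
    · rw [himg, (volume_image_mk hFm hsub).2]
      exact lintegral_abs_det_fderiv_eq_addHaar_image volume hPm hd hPi

end Torus

namespace Torus

variable {E : Type*} [Fintype E]

theorem continuousOn_gramDensity {d : ℕ} {O : Set (EuclideanSpace ℝ (Fin d))}
    {φ : EuclideanSpace ℝ (Fin d) → EuclideanSpace ℝ E} (hO : IsOpen O) (hφ : ContDiffOn ℝ 1 φ O) :
    ContinuousOn (gramDensity φ) O := by
  have h1 := hφ.continuousOn_fderiv_of_isOpen hO le_rfl
  have h2 : Continuous fun T : EuclideanSpace ℝ (Fin d) →L[ℝ] EuclideanSpace ℝ E =>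
      √(gram ℝ fun i : Fin d => T (EuclideanSpace.single i 1)).det := by
    refine Real.continuous_sqrt.comp (Continuous.matrix_det ?_)
    refine continuous_matrix fun i j => ?_
    simp only [gram_apply]
    exact (ContinuousLinearMap.apply ℝ _ (EuclideanSpace.single i (1 : ℝ))).continuous.inner
      (ContinuousLinearMap.apply ℝ _ (EuclideanSpace.single j (1 : ℝ))).continuous
  exact h2.comp_continuousOn h1

theorem mk_add_smul_one (x : EuclideanSpace ℝ E) (t : ℝ) :
    (mk (x + t • WithLp.toLp 2 1)).subDiag t = mk x := by
  ext e
  simp [mk, subDiag]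

/-- Chart coordinates and flow time are packed isometrically into `ℝ^E`, so that the suspension is a
self-map of one Euclidean space and its derivative has a determinant. -/
theorem exists_linearIsometryEquiv_prod [Nonempty E] : Nonempty (EuclideanSpace ℝ E ≃ₗᵢ[ℝ]
    WithLp 2 (EuclideanSpace ℝ (Fin (Fintype.card E - 1)) × ℝ)) := by
  have hc : Fintype.card E = Fintype.card (Fin (Fintype.card E - 1) ⊕ Unit) := by
    have := Fintype.card_pos (α := E)
    simp only [Fintype.card_sum, Fintype.card_fin, Fintype.card_unit]
    omega
  exact ⟨(EuclideanSpace.basisFun E ℝ).equiv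
    ((EuclideanSpace.basisFun (Fin (Fintype.card E - 1)) ℝ).prod
      (OrthonormalBasis.singleton Unit ℝ)) (Fintype.equivOfCardEq hc)⟩

theorem setLIntegral_linearIsometryEquiv_prod {Y X : Type*}
    [NormedAddCommGroup Y] [InnerProductSpace ℝ Y] [MeasurableSpace Y] [BorelSpace Y]
    [FiniteDimensional ℝ Y] [NormedAddCommGroup X] [InnerProductSpace ℝ X] [MeasurableSpace X]
    [BorelSpace X] [FiniteDimensional ℝ X] (I : Y ≃ₗᵢ[ℝ] WithLp 2 (X × ℝ)) {B : Set X}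
    {f : X → ℝ≥0∞} (hf : AEMeasurable f (volume.restrict B)) (C : Set ℝ) :
    ∫⁻ y in {y | (I y).fst ∈ B ∧ (I y).snd ∈ C}, f (I y).fst = (∫⁻ x in B, f x) * volume C := by
  have hmp : MeasurePreserving (fun y => WithLp.ofLp (I y)) (volume : Measure Y) volume :=
    (WithLp.volume_preserving_ofLp X ℝ).comp I.measurePreserving
  have hemb : MeasurableEmbedding fun y => WithLp.ofLp (I y) :=
    (MeasurableEquiv.toLp 2 (X × ℝ)).symm.measurableEmbedding.comp
      I.toMeasurableEquiv.measurableEmbedding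
  have h1 := hmp.setLIntegral_comp_preimage_emb hemb (fun p => f p.1) (B ×ˢ C)
  refine h1.trans ?_
  rw [Measure.volume_eq_prod, ← Measure.prod_restrict]
  have h2 := lintegral_prod_mul hf (aemeasurable_const (b := (1 : ℝ≥0∞)) (μ := volume.restrict C))
  simpa using h2

end Torus

/-! ### The area formula for suspended charts -/

namespace QGraph

variable {V E : Type*} {G : QGraph V E} [DecidableEq V] [Fintype E] [DecidableEq E]

/-- The pieces of a chart of the suspension of `A` that cover `κ` are counted by the eigenphases
`θ n` of `U_κ` with `κ - θ n ∈ A`. -/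
theorem IsEigensystem.tsum_indicator_image_eq {κ : Torus E}
    {θ : Fin (2 * Fintype.card E) → AddCircle (2 * π)}
    {a : OrthonormalBasis (Fin (2 * Fintype.card E)) ℂ (EuclideanSpace ℂ (E ⊕ E))}
    (h : G.IsEigensystem κ θ a) {A : Set (Torus E)} (hA : A ⊆ G.regularPart)
    {ι Y : Type*} [Nonempty Y] {Φ : Y → Torus E} {τ : Y → AddCircle (2 * π)} {Z : Set Y} {P : ι → Set Y}
    (hdisj : Pairwise (Function.onFun Disjoint P)) (hP : ⋃ i, P i = Z)
    (hinj : ∀ i, Set.InjOn Φ (P i)) (hmap : ∀ y ∈ Z, (Φ y).subDiag (τ y) ∈ A)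
    (huniq : ∀ y ∈ Z, ∀ y' ∈ Z, Φ y = Φ y' → τ y = τ y' → y = y')
    (hsurj : ∀ t, κ.subDiag t ∈ A → ∃ y ∈ Z, Φ y = κ ∧ τ y = t) :
    ∑' i, (Φ '' P i).indicator (1 : Torus E → ℝ≥0∞) κ =
      ∑ n, A.indicator (1 : Torus E → ℝ≥0∞) (κ.subDiag (θ n)) := by
  classical
  -- For each eigenphase whose point lies in `A`, select the preimage of `κ` with that phase; other
  -- indices get an unused value. Both sides then count the pairs of an index `n` and a piece
  -- containing its preimage.
  have hex : ∀ n, ∃ y, κ.subDiag (θ n) ∈ A → y ∈ Z ∧ Φ y = κ ∧ τ y = θ n := by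
    intro n
    by_cases hn : κ.subDiag (θ n) ∈ A
    · obtain ⟨y, hy⟩ := hsurj _ hn
      exact ⟨y, fun _ => hy⟩
    · exact ⟨Classical.arbitrary Y, fun h => absurd h hn⟩
  choose y hy using hex
  have hPZ : ∀ i, P i ⊆ Z := fun i => hP ▸ Set.subset_iUnion P i
  have hleft : ∀ n, A.indicator (1 : Torus E → ℝ≥0∞) (κ.subDiag (θ n)) =
      ∑' i, if κ.subDiag (θ n) ∈ A ∧ y n ∈ P i then 1 else 0 := by
    intro n
    by_cases hn : κ.subDiag (θ n) ∈ A
    · obtain ⟨i, hi⟩ := Set.mem_iUnion.mp (hP.symm ▸ (hy n hn).1)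
      rw [tsum_eq_single i]
      · simp [hn, hi]
      · intro j hj
        have : y n ∉ P j := fun h' => Set.disjoint_left.mp (hdisj hj) h' hi
        simp [this]
    · simp [hn]
  have hright : ∀ i, (Φ '' P i).indicator (1 : Torus E → ℝ≥0∞) κ =
      ∑ n, if κ.subDiag (θ n) ∈ A ∧ y n ∈ P i then 1 else 0 := by
    intro i
    by_cases hi : κ ∈ Φ '' P i
    · obtain ⟨z, hz, rfl⟩ := hi
      have hzA := hmap z (hPZ i hz)
      -- The shifted point is regular, so `0` is a simple eigenphase there and exactly one index `n`
      -- accounts for this sheet.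
      obtain ⟨n, hn, hnu⟩ := (h.subDiag (τ z)).exists_unique_of_mem_regularPart (hA hzA)
      rw [sub_eq_zero] at hn
      rw [Finset.sum_eq_single n]
      · have hnA : (Φ z).subDiag (θ n) ∈ A := by rwa [hn]
        obtain ⟨h1, h2, h3⟩ := hy n hnA
        have : y n = z := huniq _ h1 _ (hPZ i hz) h2 (h3.trans hn)
        have hmem : Φ z ∈ Φ '' P i := ⟨z, hz, rfl⟩
        rw [if_pos ⟨hnA, this.symm ▸ hz⟩, Set.indicator_of_mem hmem, Pi.one_apply]
      · intro m _ hm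
        rw [if_neg]
        rintro ⟨hmA, hmP⟩
        obtain ⟨h1, h2, h3⟩ := hy m hmA
        have : y m = z := hinj i hmP hz h2
        exact hm (hnu m (sub_eq_zero.mpr (h3.symm.trans (by rw [this]))))
      · simp
    · rw [Set.indicator_of_notMem hi]
      refine (Finset.sum_eq_zero fun n _ => if_neg ?_).symm
      rintro ⟨hnA, hnP⟩
      exact hi ⟨y n, hnP, (hy n hnA).2.1⟩
  simp_rw [hleft, hright]
  exact Summable.tsum_finsetSum fun _ _ => ENNReal.summable

/-- Area formula: a chart of the regular part, suspended along the diagonal direction, covers the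
torus as often as there are eigenphases. -/
theorem lintegral_gramDensity_eq [Nonempty E]
    {θ : Torus E → Fin (2 * Fintype.card E) → AddCircle (2 * π)}
    {a : Torus E → OrthonormalBasis (Fin (2 * Fintype.card E)) ℂ (EuclideanSpace ℂ (E ⊕ E))}
    (hθa : ∀ κ, G.IsEigensystem κ (θ κ) (a κ))
    {O : Set (EuclideanSpace ℝ (Fin (Fintype.card E - 1)))}
    {φ : EuclideanSpace ℝ (Fin (Fintype.card E - 1)) → EuclideanSpace ℝ E}
    (hφ : Torus.IsLocalParam (Fintype.card E - 1) G.regularPart O φ) {A : Set (Torus E)}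
    (hA : MeasurableSet A) (hAO : A ⊆ (fun x => Torus.mk (φ x)) '' O) :
    (∫⁻ x in O ∩ (fun x => Torus.mk (φ x)) ⁻¹' A,
      ENNReal.ofReal (Torus.gramDensity φ x * ‖G.shareVec (Torus.mk (φ x))‖⁻¹)) *
        ENNReal.ofReal (2 * π) =
      phaseFlux hθa (q := 1) (fun _ => zero_le_one) A := by
  have hsys : ∀ κ, ∃ θ a, G.IsEigensystem κ θ a := fun κ => ⟨_, _, hθa κ⟩
  obtain ⟨I⟩ := Torus.exists_linearIsometryEquiv_prod (E := E)
  set ψ : EuclideanSpace ℝ (Fin (Fintype.card E - 1)) → Torus E := fun x => Torus.mk (φ x) with hψ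
  set u : EuclideanSpace ℝ E := WithLp.toLp 2 1 with hu
  have hψc : ContinuousOn ψ O := Torus.continuous_mk.comp_continuousOn hφ.contDiffOn.continuousOn
  have hOm : MeasurableSet O := hφ.isOpen.measurableSet
  have hBm : MeasurableSet (O ∩ ψ ⁻¹' A) := hψc.measurableSet_inter_preimage_of_measurableSet hOm hA
  -- The suspension `(x, t) ↦ φ x + t (1, …, 1)`. The pairing of the edge shares with `(1, …, 1)` is
  -- one, so the flow is transverse to the chart.
  let F : EuclideanSpace ℝ E → EuclideanSpace ℝ E := fun y => φ (I y).fst + (I y).snd • u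
  let fstI : EuclideanSpace ℝ E →L[ℝ] EuclideanSpace ℝ (Fin (Fintype.card E - 1)) :=
    (WithLp.fstL 2 ℝ _ ℝ).comp (I.toContinuousLinearEquiv : _ →L[ℝ] _)
  let sndI : EuclideanSpace ℝ E →L[ℝ] ℝ :=
    (WithLp.sndL 2 ℝ (EuclideanSpace ℝ (Fin (Fintype.card E - 1))) ℝ).comp
      (I.toContinuousLinearEquiv : _ →L[ℝ] _)
  let F' : EuclideanSpace ℝ E → EuclideanSpace ℝ E →L[ℝ] EuclideanSpace ℝ E := fun y =>
    (fderiv ℝ φ (I y).fst).comp fstI + sndI.smulRight u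
  have hF'apply : ∀ y z, F' y z = fderiv ℝ φ (I y).fst (I z).fst + (I z).snd • u := fun _ _ => rfl
  have hF : ∀ y, (I y).fst ∈ O → HasFDerivAt F (F' y) y := by
    intro y hy
    have h1 : HasFDerivAt φ (fderiv ℝ φ (I y).fst) (fstI y) :=
      ((hφ.contDiffOn.contDiffAt (hφ.isOpen.mem_nhds hy)).differentiableAt one_ne_zero).hasFDerivAt
    exact (h1.comp y fstI.hasFDerivAt).add (sndI.hasFDerivAt.smul_const u)
  have hinner : ∀ x ∈ O, inner ℝ (G.shareVec (ψ x)) u = (1 : ℝ) := by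
    intro x hx
    rw [← sum_edgeShare (hφ.mapsTo x hx), PiLp.inner_apply]
    refine Finset.sum_congr rfl fun e _ => ?_
    simp [u, shareVec, hψ]
  have hdet0 : ∀ y, (I y).fst ∈ O → (F' y).det ≠ 0 := by
    intro y hy h0
    obtain ⟨z, hz, hz0⟩ := SetLike.exists_of_lt (LinearMap.bot_lt_ker_of_det_eq_zero h0)
    have hz : fderiv ℝ φ (I y).fst (I z).fst + (I z).snd • u = 0 := hz
    have h1 : (I z).snd = 0 := by
      have := congrArg (inner ℝ (G.shareVec (ψ (I y).fst))) hz
      rw [inner_add_right, inner_smul_right, inner_shareVec_fderiv hsys hφ hy, hinner _ hy,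
        inner_zero_right] at this
      simpa using this
    rw [h1, zero_smul, add_zero] at hz
    have h2 : (I z).fst = 0 := hφ.immersion _ hy (hz.trans (map_zero _).symm)
    refine hz0 ?_
    rw [Submodule.mem_bot, ← I.map_eq_zero_iff]
    exact WithLp.ofLp_injective 2 (Prod.ext h2 h1)
  have hdet : ∀ y, (I y).fst ∈ O → |(F' y).det| =
      Torus.gramDensity φ (I y).fst * ‖G.shareVec (ψ (I y).fst)‖⁻¹ := by
    intro y hy
    have hs0 : ‖G.shareVec (ψ (I y).fst)‖ ≠ 0 := norm_ne_zero_iff.mpr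
      (shareVec_ne_zero (hφ.mapsTo _ hy))
    rw [abs_det_eq_sqrt_det_gram_mul I (fderiv ℝ φ (I y).fst) u
      (‖G.shareVec (ψ (I y).fst)‖⁻¹ • G.shareVec (ψ (I y).fst)) _ _ _ _ (hF'apply y)]
    · rw [inner_smul_left, hinner _ hy, Torus.gramDensity]
      simp
    · rw [norm_smul, norm_inv, norm_norm, inv_mul_cancel₀ hs0]
    · intro v
      rw [inner_smul_left, inner_shareVec_fderiv hsys hφ hy, mul_zero]
    · intro w hw
      obtain ⟨r, hr⟩ := exists_eq_smul_shareVec hsys hφ hy hw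
      refine ⟨r * ‖G.shareVec (ψ (I y).fst)‖, ?_⟩
      rw [smul_smul, mul_assoc, mul_inv_cancel₀ hs0, mul_one, hr]
  -- One half-open turn of the phase circle: every phase has exactly one representative in `(0,
  -- 2π]`.
  let Z : Set (EuclideanSpace ℝ E) :=
    {y | (I y).fst ∈ O ∩ ψ ⁻¹' A ∧ (I y).snd ∈ Set.Ioc 0 (2 * π)}
  have hZm : MeasurableSet Z :=
    (fstI.continuous.measurable hBm).inter (sndI.continuous.measurable measurableSet_Ioc)
  have hbox : ∀ k : E → ℤ, MeasurableSet (Z ∩ F ⁻¹' Torus.box fun e => 2 * π * k e) := by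
    intro k
    refine ContinuousOn.measurableSet_inter_preimage_of_measurableSet ?_ hZm
      (Torus.measurableSet_box _)
    exact fun y hy => (hF y hy.1.1).continuousAt.continuousWithinAt
  obtain ⟨P, hPd, hPZ, hP⟩ := Torus.exists_pieces hZm (fun y hy => hF y hy.1.1)
    (fun y hy => hdet0 y hy.1.1) hbox
  have hf : AEMeasurable (fun x => ENNReal.ofReal
      (Torus.gramDensity φ x * ‖G.shareVec (ψ x)‖⁻¹)) (volume.restrict (O ∩ ψ ⁻¹' A)) := by
    refine AEMeasurable.ennreal_ofReal (AEMeasurable.mul ?_ (AEMeasurable.inv (AEMeasurable.norm ?_)))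
    · exact ((Torus.continuousOn_gramDensity hφ.isOpen hφ.contDiffOn).mono
        Set.inter_subset_left).aemeasurable hBm
    · exact measurable_shareVec.comp_aemeasurable
        ((hψc.mono Set.inter_subset_left).aemeasurable hBm)
  have hvol : volume (Set.Ioc (0 : ℝ) (2 * π)) = ENNReal.ofReal (2 * π) := by simp
  rw [← hvol, ← Torus.setLIntegral_linearIsometryEquiv_prod I hf]
  have h1 : ∫⁻ y in Z, ENNReal.ofReal
      (Torus.gramDensity φ (I y).fst * ‖G.shareVec (ψ (I y).fst)‖⁻¹) =
      ∫⁻ y in Z, ENNReal.ofReal |(F' y).det| :=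
    setLIntegral_congr_fun hZm fun y hy => by rw [hdet y hy.1.1]
  refine h1.trans ?_
  have h2 : ∀ i, ∫⁻ y in P i, ENNReal.ofReal |(F' y).det| =
      ∫⁻ κ, ((fun y => Torus.mk (F y)) '' P i).indicator 1 κ := by
    intro i
    rw [(hP i).2.2.2, lintegral_indicator_one (hP i).2.2.1]
  conv_lhs => rw [← hPZ]
  rw [lintegral_iUnion (fun i => (hP i).1) hPd]
  simp_rw [h2]
  rw [← lintegral_tsum fun i => (measurable_one.indicator (hP i).2.2.1).aemeasurable,
    ← lintegral_indicator_one hA, lintegral_phaseFlux hθa _ (measurable_one.indicator hA)]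
  refine lintegral_congr fun κ => ?_
  have hone : ∀ n, ENNReal.ofReal (∑ e, (1 : E → ℝ) e * edgeMass (a κ n) e) = 1 := by
    intro n
    simp [sum_edgeMass]
  simp_rw [hone, one_mul]
  have hsub : ∀ y, (Torus.mk (F y)).subDiag (((I y).snd : ℝ) : AddCircle (2 * π)) =
      ψ (I y).fst := fun y => Torus.mk_add_smul_one _ _
  refine (hθa κ).tsum_indicator_image_eq ?_ (τ := fun y => (((I y).snd : ℝ) : AddCircle (2 * π)))
    hPd hPZ (fun i => (hP i).2.1) ?_ ?_ ?_
  · intro κ hκ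
    obtain ⟨x, hx, rfl⟩ := hAO hκ
    exact hφ.mapsTo x hx
  · intro y hy
    rw [hsub]
    exact hy.1.2
  · intro y hy y' hy' h1 h2
    have h3 : (I y).fst = (I y').fst := by
      refine hφ.injOn hy.1.1 hy'.1.1 ?_
      have e1 := hsub y
      have e2 := hsub y'
      rw [h1, h2] at e1
      exact e1.symm.trans e2
    have h4 : (I y).snd = (I y').snd :=
      (AddCircle.coe_eq_coe_iff_of_mem_Ioc (a := (0 : ℝ)) (by simpa using hy.2)
        (by simpa using hy'.2)).mp h2
    exact I.injective (WithLp.ofLp_injective 2 (Prod.ext h3 h4))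
  · intro t ht
    obtain ⟨x, hx, hxt⟩ := hAO ht
    obtain ⟨r, hr, rfl⟩ : ∃ r ∈ Set.Ioc (0 : ℝ) (2 * π), (r : AddCircle (2 * π)) = t :=
      ⟨AddCircle.equivIoc (2 * π) 0 t, by simpa using (AddCircle.equivIoc (2 * π) 0 t).2,
        AddCircle.coe_equivIoc⟩
    refine ⟨I.symm (WithLp.toLp 2 (x, r)), ?_, ?_, ?_⟩
    · simp only [Z, Set.mem_ofPred_eq, LinearIsometryEquiv.apply_symm_apply]
      have hxA : ψ x ∈ A := by rwa [hxt]
      exact ⟨⟨hx, hxA⟩, hr⟩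
    · have e1 := hsub (I.symm (WithLp.toLp 2 (x, r)))
      simp only [LinearIsometryEquiv.apply_symm_apply] at e1
      have e2 := e1.trans hxt
      ext e
      have := congrFun e2 e
      simpa [Torus.subDiag] using this
    · simp

end QGraph

/-! ### Riemannian volume and Barra–Gaspard measure as fluxes -/

namespace Torus

open Topology

variable {E : Type*} [Fintype E]

theorem isOpenMap_mk : IsOpenMap (mk : EuclideanSpace ℝ E → Torus E) := by
  have h : IsOpenMap (Pi.map fun (_ : E) (r : ℝ) => (r : AddCircle (2 * π))) :=
    IsOpenMap.piMap (fun _ => QuotientAddGroup.isOpenMap_coe) (by simp)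
  exact h.comp (PiLp.homeomorph 2 fun _ : E => ℝ).isOpenMap

end Torus

/-- The two measures agree on each `S i`, hence on the countable union, and nothing lives outside.
This evaluates the supremum of chart measures that defines the Riemannian volume. -/
theorem MeasureTheory.Measure.eq_of_restrict_le_of_le {α : Type*} [MeasurableSpace α]
    {μ ν : Measure α} (hνμ : ν ≤ μ) {ι : Type*} [Countable ι] {S : ι → Set α}
    (hS : ∀ i, MeasurableSet (S i)) (h : ∀ i, μ.restrict (S i) ≤ ν) (hc : μ (⋃ i, S i)ᶜ = 0) :
    ν = μ := by
  have h1 : ν.restrict (⋃ i, S i) = μ.restrict (⋃ i, S i) := by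
    rw [Measure.restrict_iUnion_congr]
    intro i
    refine le_antisymm (Measure.restrict_mono subset_rfl hνμ) ?_
    have h2 := Measure.restrict_mono (subset_refl (S i)) (h i)
    rwa [Measure.restrict_restrict (hS i), Set.inter_self] at h2
  have h2 : μ.restrict (⋃ i, S i) = μ := Measure.restrict_eq_self_of_ae_mem (by
    rwa [← mem_ae_iff] at hc)
  have h3 : ν.restrict (⋃ i, S i) = ν := Measure.restrict_eq_self_of_ae_mem (by
    have h4 := Measure.absolutelyContinuous_of_le hνμ hc
    rwa [← mem_ae_iff] at h4)
  rw [← h3, h1, h2]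

namespace QGraph

open Topology

variable {V E : Type*} {G : QGraph V E} [DecidableEq V] [Fintype E] [DecidableEq E]
  {θ : Torus E → Fin (2 * Fintype.card E) → AddCircle (2 * π)}
  {a : Torus E → OrthonormalBasis (Fin (2 * Fintype.card E)) ℂ (EuclideanSpace ℂ (E ⊕ E))}

theorem ae_subDiag_mem_regularPart [Fintype V] (hG : G.IsAdmissible)
    (hθa : ∀ κ, G.IsEigensystem κ (θ κ) (a κ)) :
    ∀ᵐ κ : Torus E, ∀ n, κ.subDiag (θ κ n) ∈ G.regularPart := by
  filter_upwards [ae_injective_phases hG hθa] with κ hκ n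
  exact ((hθa κ).subDiag (θ κ n)).mem_regularPart (sub_self _)
    fun m hm => hκ (sub_eq_zero.mp hm)

theorem phaseFlux_compl_regularPart [Fintype V] (hG : G.IsAdmissible)
    (hθa : ∀ κ, G.IsEigensystem κ (θ κ) (a κ)) {q : E → ℝ} (hq : ∀ e, 0 ≤ q e) :
    phaseFlux hθa hq G.regularPartᶜ = 0 := by
  have hm : MeasurableSet G.regularPartᶜ := measurableSet_regularPart.compl
  rw [← lintegral_indicator_one hm, lintegral_phaseFlux hθa hq (measurable_one.indicator hm)]
  refine (lintegral_congr_ae ?_).trans lintegral_zero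
  filter_upwards [ae_subDiag_mem_regularPart hG hθa] with κ hκ
  simp [hκ]

/-- For almost every `κ` all points `κ - θ_n` are regular, and there the edge shares equal the
masses of `a_n`. Changing the weights thus multiplies the flux by a function on `Σ`. -/
theorem phaseFlux_eq_withDensity [Fintype V] (hG : G.IsAdmissible)
    (hθa : ∀ κ, G.IsEigensystem κ (θ κ) (a κ)) {q : E → ℝ} (hq : ∀ e, 0 ≤ q e) :
    phaseFlux hθa hq = (phaseFlux hθa (q := 1) fun _ => zero_le_one).withDensity
      fun κ => ENNReal.ofReal (∑ e, q e * G.edgeShare κ e) := by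
  have hD : Measurable fun κ => ENNReal.ofReal (∑ e, q e * G.edgeShare κ e) :=
    (Finset.measurable_fun_sum _ fun e _ => (measurable_edgeShare e).const_mul _).ennreal_ofReal
  refine Measure.ext_of_lintegral _ fun f hf => ?_
  rw [lintegral_withDensity_eq_lintegral_mul _ hD hf, lintegral_phaseFlux hθa hq hf,
    lintegral_phaseFlux hθa _ (hD.mul hf)]
  refine lintegral_congr_ae ?_
  filter_upwards [ae_subDiag_mem_regularPart hG hθa] with κ hκ
  refine Finset.sum_congr rfl fun n _ => ?_
  have h1 : ∀ e, G.edgeShare (κ.subDiag (θ κ n)) e = edgeMass (a κ n) e :=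
    ((hθa κ).subDiag (θ κ n)).edgeShare_eq (hκ n) (sub_self _)
  simp [h1, sum_edgeMass]

/-- On the image of a chart of the regular part, the Riemannian volume is given by the flux of the
eigenphases. -/
theorem map_gramDensity_eq_restrict [Nonempty E] (hθa : ∀ κ, G.IsEigensystem κ (θ κ) (a κ))
    {O : Set (EuclideanSpace ℝ (Fin (Fintype.card E - 1)))}
    {φ : EuclideanSpace ℝ (Fin (Fintype.card E - 1)) → EuclideanSpace ℝ E}
    (hφ : Torus.IsLocalParam (Fintype.card E - 1) G.regularPart O φ) :
    MeasurableSet ((fun x => Torus.mk (φ x)) '' O) ∧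
    Measure.map (fun x => Torus.mk (φ x))
        ((volume.restrict O).withDensity fun x => ENNReal.ofReal (Torus.gramDensity φ x)) =
      ((ENNReal.ofReal (2 * π))⁻¹ • (phaseFlux hθa (q := 1) fun _ => zero_le_one).withDensity
        fun κ => ENNReal.ofReal ‖G.shareVec κ‖).restrict ((fun x => Torus.mk (φ x)) '' O) := by
  set ψ : EuclideanSpace ℝ (Fin (Fintype.card E - 1)) → Torus E := fun x => Torus.mk (φ x) with hψ
  set σ := phaseFlux hθa (q := 1) fun _ => zero_le_one with hσ
  have hψc : ContinuousOn ψ O := Torus.continuous_mk.comp_continuousOn hφ.contDiffOn.continuousOn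
  have hOm : MeasurableSet O := hφ.isOpen.measurableSet
  have hSm : MeasurableSet (ψ '' O) := hOm.image_of_continuousOn_injOn hψc hφ.injOn
  refine ⟨hSm, ?_⟩
  have hψm : AEMeasurable ψ (volume.restrict O) := hψc.aemeasurable hOm
  have hg : AEMeasurable (fun x => Torus.gramDensity φ x) (volume.restrict O) :=
    (Torus.continuousOn_gramDensity hφ.isOpen hφ.contDiffOn).aemeasurable hOm
  have hs : Measurable fun κ => ENNReal.ofReal ‖G.shareVec κ‖ :=
    measurable_shareVec.norm.ennreal_ofReal
  let w : EuclideanSpace ℝ (Fin (Fintype.card E - 1)) → ℝ≥0∞ := fun x =>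
    ENNReal.ofReal (Torus.gramDensity φ x * ‖G.shareVec (ψ x)‖⁻¹)
  have hw : AEMeasurable w (volume.restrict O) :=
    (hg.mul (measurable_shareVec.comp_aemeasurable hψm).norm.inv).ennreal_ofReal
  have hψw : AEMeasurable ψ ((volume.restrict O).withDensity w) :=
    hψm.mono_ac (withDensity_absolutelyContinuous _ _)
  have hpi : ENNReal.ofReal (2 * π) ≠ 0 := by
    simpa using Real.pi_pos
  have hσw : σ.restrict (ψ '' O) =
      ENNReal.ofReal (2 * π) • Measure.map ψ ((volume.restrict O).withDensity w) := by
    ext A hA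
    have hset : O ∩ ψ ⁻¹' (A ∩ ψ '' O) = ψ ⁻¹' A ∩ O := by
      ext x
      constructor
      · rintro ⟨h1, h2, -⟩
        exact ⟨h2, h1⟩
      · rintro ⟨h1, h2⟩
        exact ⟨h2, h1, x, h2, rfl⟩
    rw [Measure.restrict_apply hA, hσ, ← lintegral_gramDensity_eq hθa hφ (hA.inter hSm)
      Set.inter_subset_right, Measure.smul_apply, Measure.map_apply_of_aemeasurable hψw hA,
      withDensity_apply', Measure.restrict_restrict' hOm, smul_eq_mul, mul_comm]
    simp only [← hψ]
    rw [hset]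
  rw [Measure.restrict_smul, restrict_withDensity hSm, hσw, withDensity_smul_measure, smul_smul,
    ENNReal.inv_mul_cancel hpi ENNReal.ofReal_ne_top, one_smul]
  have hψg : AEMeasurable ψ ((volume.restrict O).withDensity fun x =>
      ENNReal.ofReal (Torus.gramDensity φ x)) :=
    hψm.mono_ac (withDensity_absolutelyContinuous _ _)
  refine Measure.ext_of_lintegral _ fun f hf => ?_
  rw [lintegral_withDensity_eq_lintegral_mul _ hs hf, lintegral_map' hf.aemeasurable hψg,
    lintegral_map' (hs.mul hf).aemeasurable hψw,
    lintegral_withDensity_eq_lintegral_mul₀ hg.ennreal_ofReal (g := fun x => f (ψ x))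
      (hf.comp_aemeasurable hψm),
    lintegral_withDensity_eq_lintegral_mul₀ hw
      (g := fun x => ((fun κ => ENNReal.ofReal ‖G.shareVec κ‖) * f) (ψ x))
      ((hs.mul hf).comp_aemeasurable hψm)]
  refine setLIntegral_congr_fun hOm fun x hx => ?_
  have hs0 : ‖G.shareVec (ψ x)‖ ≠ 0 :=
    norm_ne_zero_iff.mpr (shareVec_ne_zero (hφ.mapsTo x hx))
  simp only [Pi.mul_apply, w]
  have hnn : 0 ≤ Torus.gramDensity φ x * ‖G.shareVec (ψ x)‖⁻¹ :=
    mul_nonneg (Real.sqrt_nonneg _) (by positivity)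
  rw [← mul_assoc, ← ENNReal.ofReal_mul hnn,
    mul_assoc (Torus.gramDensity φ x), inv_mul_cancel₀ hs0, mul_one]

/-- Every chart measure is a restriction of the right-hand side, which bounds the supremum from
above. Countably many charts cover the regular part by second countability, and its complement has
no flux by generic simplicity. -/
theorem riemannianVolume_regularPart [Fintype V] (hG : G.IsAdmissible)
    (hθa : ∀ κ, G.IsEigensystem κ (θ κ) (a κ)) :
    Torus.riemannianVolume (Fintype.card E - 1) G.regularPart =
      (ENNReal.ofReal (2 * π))⁻¹ • (phaseFlux hθa (q := 1) fun _ => zero_le_one).withDensity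
        fun κ => ENNReal.ofReal ‖G.shareVec κ‖ := by
  have hE := hG.nonempty_edges
  have hex : ∀ κ ∈ G.regularPart, ∃ O φ,
      Torus.IsLocalParam (Fintype.card E - 1) G.regularPart O φ ∧
      (fun x => Torus.mk (φ x)) '' O ∈ 𝓝[G.regularPart] κ := by
    intro κ hκ
    obtain ⟨x, rfl⟩ := exists_mk_eq κ
    obtain ⟨O, φ, hφ, -, hev⟩ := exists_isLocalParam (fun κ => ⟨_, _, hθa κ⟩) x hκ
    refine ⟨O, φ, hφ, ?_⟩
    rw [mem_nhdsWithin_iff_exists_mem_nhds_inter]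
    refine ⟨_, Torus.isOpenMap_mk.image_mem_nhds hev, ?_⟩
    rintro _ ⟨⟨y, hy, rfl⟩, hyR⟩
    obtain ⟨z, hz, rfl⟩ := hy hyR
    exact ⟨z, hz, rfl⟩
  choose! O φ hφ hnhds using hex
  obtain ⟨t, htR, htc, hcover⟩ := TopologicalSpace.countable_cover_nhdsWithin hnhds
  have := htc.to_subtype
  refine Measure.eq_of_restrict_le_of_le (ι := t)
    (S := fun κ => (fun x => Torus.mk (φ κ x)) '' O κ) ?_ ?_ ?_ ?_
  · refine sSup_le ?_
    rintro _ ⟨O, φ, hφ, rfl⟩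
    rw [(map_gramDensity_eq_restrict hθa hφ).2]
    exact Measure.restrict_le_self
  · exact fun κ => (map_gramDensity_eq_restrict hθa (hφ κ (htR κ.2))).1
  · intro κ
    rw [← (map_gramDensity_eq_restrict hθa (hφ κ (htR κ.2))).2]
    exact le_sSup ⟨_, _, hφ κ (htR κ.2), rfl⟩
  · have hsub : (⋃ κ : t, (fun x => Torus.mk (φ κ x)) '' O κ)ᶜ ⊆ G.regularPartᶜ := by
      rw [Set.compl_subset_compl, Set.iUnion_coe_set]
      exact hcover
    rw [Measure.smul_apply, withDensity_absolutelyContinuous _ _ (measure_mono_null hsub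
      (phaseFlux_compl_regularPart hG hθa _)), smul_zero]

/-- The factor `‖s‖` of the volume cancels against the normalization of `n̂`. The constants match
because `(π / L) (2π)^{-E} (2π)^{-1} = (2L)^{-1} (2π)^{-E}`. -/
theorem bgMeasure_eq_comap_phaseFlux [Fintype V] (hG : G.IsAdmissible)
    (hθa : ∀ κ, G.IsEigensystem κ (θ κ) (a κ)) {ℓ : E → ℝ}
    (hL : 0 < ∑ e, ℓ e) (hq : ∀ e, 0 ≤ ℓ e / (2 * ∑ e, ℓ e)) :
    G.bgMeasure ℓ = Measure.comap Subtype.val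
      ((ENNReal.ofReal ((2 * π) ^ Fintype.card E))⁻¹ • phaseFlux hθa hq) := by
  set σ := phaseFlux hθa (q := 1) fun _ => zero_le_one with hσ
  have hσR : ∀ᵐ κ ∂σ, κ ∈ G.regularPart := by
    rw [ae_iff]
    exact phaseFlux_compl_regularPart hG hθa _
  have hs : Measurable fun κ => ENNReal.ofReal ‖G.shareVec κ‖ :=
    measurable_shareVec.norm.ennreal_ofReal
  have hD : Measurable fun κ => ENNReal.ofReal (∑ e, ℓ e * G.edgeShare κ e) :=
    (Finset.measurable_fun_sum _ fun e _ => (measurable_edgeShare e).const_mul _).ennreal_ofReal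
  have hN : Measurable fun κ => ENNReal.ofReal
      (‖G.shareVec κ‖⁻¹ * ∑ e, ℓ e * G.edgeShare κ e) :=
    (measurable_shareVec.norm.inv.mul
      (Finset.measurable_fun_sum _ fun e _ => (measurable_edgeShare e).const_mul _)).ennreal_ofReal
  have h1 : (σ.withDensity fun κ => ENNReal.ofReal ‖G.shareVec κ‖).withDensity
      (fun κ => ENNReal.ofReal (∑ e, G.normal κ e * ℓ e)) =
      σ.withDensity fun κ => ENNReal.ofReal (∑ e, ℓ e * G.edgeShare κ e) := by
    rw [withDensity_congr_ae (g := fun κ => ENNReal.ofReal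
      (‖G.shareVec κ‖⁻¹ * ∑ e, ℓ e * G.edgeShare κ e)), ← withDensity_mul _ hs hN]
    · refine withDensity_congr_ae ?_
      filter_upwards [hσR] with κ hκ
      rw [Pi.mul_apply, ← ENNReal.ofReal_mul (norm_nonneg _), mul_inv_cancel_left₀]
      exact norm_ne_zero_iff.mpr (shareVec_ne_zero hκ)
    · refine (withDensity_absolutelyContinuous _ _).ae_le ?_
      filter_upwards [hσR] with κ hκ
      rw [normal_eq (fun κ => ⟨_, _, hθa κ⟩) hκ, Finset.mul_sum]
      congr 1
      refine Finset.sum_congr rfl fun e _ => ?_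
      simp only [PiLp.smul_apply, smul_eq_mul, shareVec]
      ring
  have h2 : phaseFlux hθa hq = ENNReal.ofReal (2 * ∑ e, ℓ e)⁻¹ •
      σ.withDensity fun κ => ENNReal.ofReal (∑ e, ℓ e * G.edgeShare κ e) := by
    rw [phaseFlux_eq_withDensity hG hθa hq, ← withDensity_smul _ hD]
    congr 1
    ext κ
    rw [Pi.smul_apply, smul_eq_mul, ← ENNReal.ofReal_mul (by positivity)]
    congr 1
    rw [Finset.mul_sum _ _ (2 * ∑ e, ℓ e)⁻¹]
    exact Finset.sum_congr rfl fun e _ => by rw [div_eq_inv_mul, mul_assoc]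
  rw [bgMeasure, riemannianVolume_regularPart hG hθa, withDensity_smul_measure, h1, h2, smul_smul,
    smul_smul, ← ENNReal.ofReal_inv_of_pos (by positivity), ← ENNReal.ofReal_inv_of_pos
    (by positivity), ← ENNReal.ofReal_mul (by positivity), ← ENNReal.ofReal_mul (by positivity)]
  congr 3
  field_simp

end QGraph

/-! ### Conclusion: from the flux on the torus to integrals over `Σ` -/

namespace QGraph

variable {V E : Type*} {G : QGraph V E} [DecidableEq V] [Fintype E] [DecidableEq E]
  {θ : Torus E → Fin (2 * Fintype.card E) → AddCircle (2 * π)}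
  {a : Torus E → OrthonormalBasis (Fin (2 * Fintype.card E)) ℂ (EuclideanSpace ℂ (E ⊕ E))}

theorem measurableSet_secularManifold : MeasurableSet G.secularManifold :=
  (isClosed_singleton.preimage continuous_secular).measurableSet

theorem phaseFlux_restrict_secularManifold (hθa : ∀ κ, G.IsEigensystem κ (θ κ) (a κ)) {q : E → ℝ}
    (hq : ∀ e, 0 ≤ q e) : (phaseFlux hθa hq).restrict G.secularManifold = phaseFlux hθa hq := by
  have hm : MeasurableSet G.secularManifoldᶜ := measurableSet_secularManifold.compl
  have h0 : phaseFlux hθa hq G.secularManifoldᶜ = 0 := by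
    rw [← lintegral_indicator_one hm, lintegral_phaseFlux hθa hq (measurable_one.indicator hm)]
    refine (lintegral_congr fun κ => ?_).trans lintegral_zero
    simp [(hθa κ).subDiag_mem]
  exact Measure.restrict_eq_self_of_ae_mem (mem_ae_iff.mpr h0)

end QGraph

end

theorem mainTheorem4 {V E : Type*} [Fintype V] [DecidableEq V] [Fintype E] [DecidableEq E]
    (G : QGraph V E) (hG : G.IsAdmissible)
    (ℓ : E → ℝ) (hℓ : ∀ e, 0 ≤ ℓ e) (hℓ0 : ℓ ≠ 0)
    (θ : Torus E → Fin (2 * Fintype.card E) → AddCircle (2 * π))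
    (a : Torus E →
      OrthonormalBasis (Fin (2 * Fintype.card E)) ℂ (EuclideanSpace ℂ (E ⊕ E)))
    (hθa : ∀ κ, G.IsEigensystem κ (θ κ) (a κ)) :
    (∀ h : G.secularManifold → ℂ, Measurable h →
      Measurable (fun κ => ∑ n, h (QGraph.phasePoint (hθa κ) n) * QGraph.weight ℓ (a κ n)) ∧
      (Integrable h (G.bgMeasure ℓ) →
        Integrable (fun κ => ∑ n, h (QGraph.phasePoint (hθa κ) n) * QGraph.weight ℓ (a κ n)) ∧
        ∫ κ, h κ ∂(G.bgMeasure ℓ) =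
          (∫ κ, ∑ n, h (QGraph.phasePoint (hθa κ) n) * QGraph.weight ℓ (a κ n)) /
            (2 * π) ^ Fintype.card E)) ∧
    (∀ h : G.secularManifold → ℝ≥0∞, Measurable h →
      Measurable (fun κ => ∑ n, h (QGraph.phasePoint (hθa κ) n) *
        ENNReal.ofReal (QGraph.weight ℓ (a κ n)).re) ∧
      ∫⁻ κ, h κ ∂(G.bgMeasure ℓ) =
        (∫⁻ κ, ∑ n, h (QGraph.phasePoint (hθa κ) n) *
            ENNReal.ofReal (QGraph.weight ℓ (a κ n)).re) /
          ENNReal.ofReal ((2 * π) ^ Fintype.card E)) := by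
  have hL : 0 < ∑ e, ℓ e := by
    obtain ⟨e, he⟩ := Function.ne_iff.mp hℓ0
    exact Finset.sum_pos' (fun e _ => hℓ e) ⟨e, Finset.mem_univ e, (hℓ e).lt_of_ne (Ne.symm he)⟩
  have hq : ∀ e, 0 ≤ ℓ e / (2 * ∑ e, ℓ e) := fun e => div_nonneg (hℓ e) (by positivity)
  have hK : (0 : ℝ) < (2 * π) ^ Fintype.card E := by positivity
  have hS : MeasurableSet G.secularManifold := QGraph.measurableSet_secularManifold
  have hval : MeasurableEmbedding (Subtype.val : G.secularManifold → Torus E) :=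
    MeasurableEmbedding.subtype_coe hS
  -- The flux is carried by `Σ`, so passing to the subtype and back loses nothing. Both parts of the
  -- theorem now concern integrals against the flux on the torus.
  have hmap : Measure.map Subtype.val (G.bgMeasure ℓ) =
      (ENNReal.ofReal ((2 * π) ^ Fintype.card E))⁻¹ • QGraph.phaseFlux hθa hq := by
    rw [QGraph.bgMeasure_eq_comap_phaseFlux hG hθa hL hq, map_comap_subtype_coe hS,
      Measure.restrict_smul, QGraph.phaseFlux_restrict_secularManifold]
  constructor
  · intro h hh
    -- Extension by zero off the measurable set `Σ`; the value there is irrelevant because only the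
    -- points `κ - θ_n` are evaluated.
    let H : Torus E → ℂ := Function.extend Subtype.val h 0
    have hH : Measurable H := hval.measurable_extend hh measurable_const
    have hHval : ∀ κ : G.secularManifold, H κ = h κ := Subtype.val_injective.extend_apply h 0
    have hsum : (fun κ => ∑ n, h (QGraph.phasePoint (hθa κ) n) * QGraph.weight ℓ (a κ n)) =
        fun κ => ∑ n, H (κ.subDiag (θ κ n)) *
          ((∑ e, ℓ e / (2 * ∑ e, ℓ e) * QGraph.edgeMass (a κ n) e : ℝ) : ℂ) := by
      ext κ
      refine Finset.sum_congr rfl fun n _ => ?_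
      rw [QGraph.weight_eq, ← hHval]
      rfl
    refine ⟨hsum ▸ QGraph.measurable_sum_phase_complex hθa hq hH, fun hfi => ?_⟩
    have hHint : Integrable H (Measure.map Subtype.val (G.bgMeasure ℓ)) :=
      hval.integrable_map_iff.mpr (hfi.congr (Filter.Eventually.of_forall fun κ => (hHval κ).symm))
    have hH' : ∫ κ, h κ ∂G.bgMeasure ℓ = ∫ κ, H κ ∂Measure.map Subtype.val (G.bgMeasure ℓ) := by
      rw [hval.integral_map]
      simp_rw [hHval]
    rw [hmap] at hHint hH'
    have hflux : Integrable H (QGraph.phaseFlux hθa hq) :=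
      (integrable_smul_measure (by simp) (by simpa using hK)).mp hHint
    obtain ⟨h1, h2⟩ := QGraph.integral_phaseFlux hθa hq hH hflux
    refine ⟨hsum ▸ h1, ?_⟩
    rw [hH', integral_smul_measure, h2, hsum, ENNReal.toReal_inv, ENNReal.toReal_ofReal hK.le,
      Complex.real_smul, div_eq_inv_mul]
    push_cast
    rfl
  · intro h hh
    let H : Torus E → ℝ≥0∞ := Function.extend Subtype.val h 0
    have hH : Measurable H := hval.measurable_extend hh measurable_const
    have hHval : ∀ κ : G.secularManifold, H κ = h κ := Subtype.val_injective.extend_apply h 0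
    have hsum : (fun κ => ∑ n, h (QGraph.phasePoint (hθa κ) n) *
        ENNReal.ofReal (QGraph.weight ℓ (a κ n)).re) =
        fun κ => ∑ n, ENNReal.ofReal (∑ e, ℓ e / (2 * ∑ e, ℓ e) * QGraph.edgeMass (a κ n) e) *
          H (κ.subDiag (θ κ n)) := by
      ext κ
      refine Finset.sum_congr rfl fun n _ => ?_
      rw [QGraph.weight_eq, ← hHval, Complex.ofReal_re, mul_comm]
      rfl
    refine ⟨hsum ▸ QGraph.measurable_sum_phase hθa hq hH, ?_⟩
    have hH' : ∫⁻ κ, h κ ∂G.bgMeasure ℓ = ∫⁻ κ, H κ ∂Measure.map Subtype.val (G.bgMeasure ℓ) := by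
      rw [hval.lintegral_map]
      simp_rw [hHval]
    rw [hH', hmap, lintegral_smul_measure, QGraph.lintegral_phaseFlux hθa hq hH, hsum, smul_eq_mul,
      mul_comm, div_eq_mul_inv]
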